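/- Let $(M,g)$ be a smooth Hausdorff Lorentzian manifold of dimension $n=1+d$, with signature $(-,+,\dots,+)$ and Levi-Civita connection $\nabla$, time-oriented by a continuous timelike vector field. Let $F$ be a smooth two-form on $M$, let $q\in\mathbb{R}$ and $m>0$, and let $\tilde F$ be the field of endomorphisms of the tangent spaces defined by $g(X,\tilde F(Y))=F(X,Y)$. For $x\in M$ let $$P_x^+=\{p\in T_xM:\ p\text{ future-directed},\ g_x(p,p)=-m^2\},\qquad \Gamma_m^+=\{(x,p)\in TM:\ p\in P_x^+\}$$ be the future mass hyperboloid and the future mass shell, and let $\pi_x$ be the natural (Lorentz-invariant) volume element of $P_x^+$: if $e_0,\dots,e_d$ is an orthonormal basis of $T_xM$ with $e_0$ timelike and future-directed, and $p=\sqrt{m^2+|k|^2}\,e_0+\sum_i k^i e_i$ with $k\in\mathbb{R}^d$, then $\pi_x=dk^1\cdots dk^d/\sqrt{m^2+|k|^2}$. Let $L$ be the Liouville vector field on $TM$, given in adapted local coordinates by $$L_{(x,p)}=p^\mu\frac{\partial}{\partial x^\mu}+\left[q F^\mu{}_\nu(x)p^\nu-\Gamma^\mu{}_{\alpha\beta}(x)p^\alpha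 p^\beta\right]\frac{\partial}{\partial p^\mu},$$ where $F^\mu{}_\nu$ are the components of $\tilde F$ and $\Gamma^\mu{}_{\alpha\beta}$ the Christoffel symbols of $g$. It is tangent to $\Gamma_m^+$, so that the derivative $\pounds_L f$ of a smooth function $f$ on $\Gamma_m^+$ is defined. Let $f:\Gamma_m^+\to\mathbb{R}$ be a $C^\infty$ function of compact support, and for $\alpha,\beta\in T_x^*M$ put $$J_x(\alpha)=\int_{P_x^+}f(x,p)\,\alpha(p)\,\pi_x,\qquad T_x(\alpha,\beta)=\int_{P_x^+}f(x,p)\,\alpha(p)\beta(p)\,\pi_x .$$ Then all integrals in this statement exist, the components of $J$ and $T$ in local coordinates are differentiable, and for all $x\in M$ and all $\beta\in T_x^*M$ $$\operatorname{div}J_x=\int_{P_x^+}(\pounds_Lf)(x,p)\,\pi_x,$$ $$\operatorname{div}T_x(\beta)=\int_{P_x^+}(\pounds_Lf)(x,p)\,\beta(p)\,\pi_x+q\,\beta(\tilde F_x(J_x)),$$ where $\operatorname{div}J=\nabla_\mu J^\mu$ and $\operatorname{div}T(\beta)=\beta_\nu\nabla_\mu T^{\mu\nu}$. In particular, if $\pounds_Lf=0$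 on $\Gamma_m^+$, then $\operatorname{div}J=0$ and $\operatorname{div}T=q\tilde F(J)$ on $M$. -/

import Mathlib

open scoped Manifold ContDiff Topology

noncomputable section

namespace KineticTheory

/-- A smooth Lorentzian metric of signature `(-,+,…,+)` on a manifold of dimension `d + 1`. -/
structure LorentzMetric (d : ℕ) (M : Type*) [TopologicalSpace M]
    [ChartedSpace (EuclideanSpace ℝ (Fin (d + 1))) M] [IsManifold (𝓡 (d + 1)) ∞ M] where
  val : ∀ x : M, TangentSpace (𝓡 (d + 1)) x →L[ℝ] TangentSpace (𝓡 (d + 1)) x →L[ℝ] ℝ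
  symm : ∀ (x : M) (X Y : TangentSpace (𝓡 (d + 1)) x), val x X Y = val x Y X
  signature : ∀ x : M, ∃ b : Module.Basis (Fin (d + 1)) ℝ (TangentSpace (𝓡 (d + 1)) x),
    ∀ i j, val x (b i) (b j) = if i = j then (if i = 0 then -1 else 1) else 0
  contMDiff : ContMDiff (𝓡 (d + 1))
    ((𝓡 (d + 1)).prod 𝓘(ℝ, EuclideanSpace ℝ (Fin (d + 1)) →L[ℝ]
      EuclideanSpace ℝ (Fin (d + 1)) →L[ℝ] ℝ)) ∞
    (fun x ↦ Bundle.TotalSpace.mk' (EuclideanSpace ℝ (Fin (d + 1)) →L[ℝ]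
      EuclideanSpace ℝ (Fin (d + 1)) →L[ℝ] ℝ) x (val x))

/-- A smooth two-form on `M` (the electromagnetic field). -/
structure TwoForm (d : ℕ) (M : Type*) [TopologicalSpace M]
    [ChartedSpace (EuclideanSpace ℝ (Fin (d + 1))) M] [IsManifold (𝓡 (d + 1)) ∞ M] where
  val : ∀ x : M, TangentSpace (𝓡 (d + 1)) x →L[ℝ] TangentSpace (𝓡 (d + 1)) x →L[ℝ] ℝ
  antisymm : ∀ (x : M) (X Y : TangentSpace (𝓡 (d + 1)) x), val x X Y = - val x Y X
  contMDiff : ContMDiff (𝓡 (d + 1))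
    ((𝓡 (d + 1)).prod 𝓘(ℝ, EuclideanSpace ℝ (Fin (d + 1)) →L[ℝ]
      EuclideanSpace ℝ (Fin (d + 1)) →L[ℝ] ℝ)) ∞
    (fun x ↦ Bundle.TotalSpace.mk' (EuclideanSpace ℝ (Fin (d + 1)) →L[ℝ]
      EuclideanSpace ℝ (Fin (d + 1)) →L[ℝ] ℝ) x (val x))

variable {d : ℕ} {M : Type*} [TopologicalSpace M]
  [ChartedSpace (EuclideanSpace ℝ (Fin (d + 1))) M] [IsManifold (𝓡 (d + 1)) ∞ M]

/-- A time orientation, given by a continuous timelike vector field. A timelike vector `p` at `x`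
is future-directed if `g x p (τ x) < 0`. -/
structure TimeOrientation (g : LorentzMetric d M) where
  val : ∀ x : M, TangentSpace (𝓡 (d + 1)) x
  timelike : ∀ x, g.val x (val x) (val x) < 0
  continuous : Continuous (fun x ↦ (⟨x, val x⟩ : TangentBundle (𝓡 (d + 1)) M))

/-! ### Coordinates -/

/-- The coordinate one-form `dx^μ` at `x`, for the preferred chart around `x₀`. -/
def coordForm (x₀ x : M) (μ : Fin (d + 1)) : TangentSpace (𝓡 (d + 1)) x →L[ℝ] ℝ :=
  (EuclideanSpace.proj (𝕜 := ℝ) μ : EuclideanSpace ℝ (Fin (d + 1)) →L[ℝ] ℝ).comp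
    (mfderiv (𝓡 (d + 1)) 𝓘(ℝ, EuclideanSpace ℝ (Fin (d + 1))) (extChartAt (𝓡 (d + 1)) x₀) x)

/-- The coordinate vector `∂/∂x^μ` at `x`, for the preferred chart around `x₀`. -/
def coordVec (x₀ x : M) (μ : Fin (d + 1)) : TangentSpace (𝓡 (d + 1)) x :=
  (mfderiv (𝓡 (d + 1)) 𝓘(ℝ, EuclideanSpace ℝ (Fin (d + 1)))
    (extChartAt (𝓡 (d + 1)) x₀) x).inverse (EuclideanSpace.single μ (1 : ℝ))

/-- The partial derivative `∂h/∂x^μ` at `x` of a function `h` on `M`, in the chart around `x₀`. -/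
def partialDeriv (x₀ : M) (μ : Fin (d + 1)) (h : M → ℝ) (x : M) : ℝ :=
  fderiv ℝ (h ∘ (extChartAt (𝓡 (d + 1)) x₀).symm) (extChartAt (𝓡 (d + 1)) x₀ x)
    (EuclideanSpace.single μ (1 : ℝ))

/-- The coefficients `g_{μν}` in the chart around `x₀`. -/
def LorentzMetric.coeff (g : LorentzMetric d M) (x₀ x : M) :
    Matrix (Fin (d + 1)) (Fin (d + 1)) ℝ :=
  fun μ ν ↦ g.val x (coordVec x₀ x μ) (coordVec x₀ x ν)

/-- The Christoffel symbols `Γ^μ_{αβ}(x)` of the Levi-Civita connection, in the chart around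
`x₀`. -/
def LorentzMetric.christoffel (g : LorentzMetric d M) (x₀ x : M) (μ α β : Fin (d + 1)) : ℝ :=
  (1 / 2) * ∑ σ, (g.coeff x₀ x)⁻¹ μ σ *
    (partialDeriv x₀ α (fun y ↦ g.coeff x₀ y σ β) x
      + partialDeriv x₀ β (fun y ↦ g.coeff x₀ y σ α) x
      - partialDeriv x₀ σ (fun y ↦ g.coeff x₀ y α β) x)

/-- The divergence `∇_μ V^μ = ∂_μ V^μ + Γ^μ_{μλ} V^λ` of a vector field, where vectors are regarded
as functions of covectors, so that `V^μ = V(dx^μ)`. -/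
def LorentzMetric.divVector (g : LorentzMetric d M)
    (V : ∀ x : M, (TangentSpace (𝓡 (d + 1)) x →L[ℝ] ℝ) → ℝ) (x : M) : ℝ :=
  ∑ μ, (partialDeriv x μ (fun y ↦ V y (coordForm x y μ)) x
    + ∑ l, g.christoffel x x μ μ l * V x (coordForm x x l))

/-- The divergence `β_ν ∇_μ T^{μν}`, with
`∇_μ T^{μν} = ∂_μ T^{μν} + Γ^μ_{μλ} T^{λν} + Γ^ν_{μλ} T^{μλ}`, of a contravariant tensor field of
rank two, regarded as a function of two covectors, so that `T^{μν} = T(dx^μ, dx^ν)`. -/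
def LorentzMetric.divTensor (g : LorentzMetric d M)
    (T : ∀ x : M, (TangentSpace (𝓡 (d + 1)) x →L[ℝ] ℝ) →
      (TangentSpace (𝓡 (d + 1)) x →L[ℝ] ℝ) → ℝ)
    (x : M) (β : TangentSpace (𝓡 (d + 1)) x →L[ℝ] ℝ) : ℝ :=
  ∑ ν, β (coordVec x x ν) *
    ∑ μ, (partialDeriv x μ (fun y ↦ T y (coordForm x y μ) (coordForm x y ν)) x
      + ∑ l, g.christoffel x x μ μ l * T x (coordForm x x l) (coordForm x x ν)
      + ∑ l, g.christoffel x x ν μ l * T x (coordForm x x μ) (coordForm x x l))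

/-! ### The electromagnetic endomorphism and the Liouville vector field -/

/-- The endomorphism `F̃` of the tangent spaces with `g(X, F̃ Y) = F(X, Y) = -F(Y, X)`. -/
def TwoForm.endo (F : TwoForm d M) (g : LorentzMetric d M) (x : M)
    (Y : TangentSpace (𝓡 (d + 1)) x) : TangentSpace (𝓡 (d + 1)) x :=
  (g.val x).inverse (-(F.val x Y))

lemma LorentzMetric.isInvertible (g : LorentzMetric d M) (x : M) : (g.val x).IsInvertible := by
  obtain ⟨b, hb⟩ := g.signature x
  have hinj : Function.Injective (g.val x) := by
    rw [injective_iff_map_eq_zero]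
    intro X hX
    apply b.ext_elem
    intro i
    have h : g.val x X (b i) = 0 := by rw [hX]; rfl
    rw [← b.sum_repr X] at h
    simp only [map_sum, map_smul, sum_apply, smul_apply,
      hb, smul_eq_mul, mul_ite, mul_zero, Finset.sum_ite_eq', Finset.mem_univ, if_true] at h
    split_ifs at h <;> simpa using h
  have : FiniteDimensional ℝ (TangentSpace (𝓡 (d + 1)) x) := b.finiteDimensional_of_finite
  have : FiniteDimensional ℝ (TangentSpace (𝓡 (d + 1)) x →L[ℝ] ℝ) :=
    inferInstanceAs (FiniteDimensional ℝ (EuclideanSpace ℝ (Fin (d + 1)) →L[ℝ] ℝ))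
  have hT : T2Space (EuclideanSpace ℝ (Fin (d + 1))) :=
    TopologicalSpace.t2Space_of_metrizableSpace
  have : T2Space (TangentSpace (𝓡 (d + 1)) x) := hT
  have hrank : Module.finrank ℝ (TangentSpace (𝓡 (d + 1)) x)
      = Module.finrank ℝ (TangentSpace (𝓡 (d + 1)) x →L[ℝ] ℝ) := by
    rw [← Subspace.dual_finrank_eq]
    exact (LinearMap.toContinuousLinearMap (𝕜 := ℝ) (E := EuclideanSpace ℝ (Fin (d + 1)))
      (F' := ℝ)).finrank_eq
  exact ⟨(LinearEquiv.ofInjectiveOfFinrankEq (g.val x : _ →ₗ[ℝ] _)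
    hinj hrank).toContinuousLinearEquiv, by ext; rfl⟩

lemma TwoForm.metric_endo (F : TwoForm d M) (g : LorentzMetric d M) (x : M)
    (X Y : TangentSpace (𝓡 (d + 1)) x) : g.val x X (F.endo g x Y) = F.val x X Y := by
  obtain ⟨e, he⟩ := g.isInvertible x
  have h : g.val x (F.endo g x Y) = -(F.val x Y) := by
    rw [TwoForm.endo, ← he, ContinuousLinearMap.inverse_equiv]
    exact e.apply_symm_apply _
  rw [g.symm, h, F.antisymm]
  rfl

/-- The Liouville vector field on `TM`. The tangent space of `TM` at `v = (x, p)` is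
written in the adapted coordinates `(x^μ, p^μ)` that belong to the preferred chart around `x`:
`L = p^μ ∂/∂x^μ + (q F^μ_ν p^ν - Γ^μ_{αβ} p^α p^β) ∂/∂p^μ`. -/
def liouville (g : LorentzMetric d M) (F : TwoForm d M) (q : ℝ)
    (v : TangentBundle (𝓡 (d + 1)) M) : TangentSpace (𝓡 (d + 1)).tangent v :=
  ((WithLp.toLp 2 fun μ ↦ coordForm v.1 v.1 μ v.2,
    WithLp.toLp 2 fun μ ↦ q * coordForm v.1 v.1 μ (F.endo g v.1 v.2)
      - ∑ α, ∑ β, g.christoffel v.1 v.1 μ α β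
          * coordForm v.1 v.1 α v.2 * coordForm v.1 v.1 β v.2) :
    EuclideanSpace ℝ (Fin (d + 1)) × EuclideanSpace ℝ (Fin (d + 1)))

/-! ### The future mass shell -/

/-- The future mass hyperboloid `P_x⁺` at `x`. -/
def massHyperboloid (g : LorentzMetric d M) (τ : TimeOrientation g) (m : ℝ) (x : M) :
    Set (TangentSpace (𝓡 (d + 1)) x) :=
  {p | g.val x p p = -m ^ 2 ∧ g.val x p (τ.val x) < 0}

/-- The future mass shell `Γ_m⁺`: all `(x, p)` with `p ∈ P_x⁺`. -/
def massShell (g : LorentzMetric d M) (τ : TimeOrientation g) (m : ℝ) :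
    Set (TangentBundle (𝓡 (d + 1)) M) :=
  {v | v.2 ∈ massHyperboloid g τ m v.1}

/-- A real function on the future mass shell is smooth if, near every point of the mass shell, it
is the restriction of a smooth function on an open subset of the tangent bundle. -/
def SmoothOnShell {g : LorentzMetric d M} {τ : TimeOrientation g} {m : ℝ}
    (f : massShell g τ m → ℝ) : Prop :=
  ∀ v : massShell g τ m, ∃ (U : Set (TangentBundle (𝓡 (d + 1)) M))
    (h : TangentBundle (𝓡 (d + 1)) M → ℝ), IsOpen U ∧ v.1 ∈ U ∧
      ContMDiffOn (𝓡 (d + 1)).tangent 𝓘(ℝ, ℝ) ∞ h U ∧ ∀ w : massShell g τ m, w.1 ∈ U → h w.1 = f w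

open Classical in
/-- For `m > 0`, the extension of a function on the future mass shell to the open set of all
future-directed timelike vectors that is constant along rays:
`(x, p) ↦ f (x, m p / √(-g_x(p, p)))`. Vectors that are not future-directed timelike have no
multiple of this form on the mass shell, and the value there is zero. -/
def rayExtension {g : LorentzMetric d M} {τ : TimeOrientation g} {m : ℝ}
    (f : massShell g τ m → ℝ) (v : TangentBundle (𝓡 (d + 1)) M) : ℝ :=
  if hv : (⟨v.1, (m / √(-g.val v.1 v.2 v.2)) • v.2⟩ : TangentBundle (𝓡 (d + 1)) M)
    ∈ massShell g τ m then f ⟨_, hv⟩ else 0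

/-- The Lie derivative `£_L f` of a function on the future mass shell along the Liouville vector
field. As `L` is tangent to the mass shell, the derivative of `f` in the direction of `L` is the
derivative of any smooth extension of `f` to a neighbourhood in the tangent bundle; the extension
that is constant along rays is used here. -/
def lieDeriv {g : LorentzMetric d M} {τ : TimeOrientation g} {m : ℝ} (F : TwoForm d M) (q : ℝ)
    (f : massShell g τ m → ℝ) (v : massShell g τ m) : ℝ :=
  mfderiv (𝓡 (d + 1)).tangent 𝓘(ℝ, ℝ) (rayExtension f) v.1 (liouville g F q v.1)

/-! ### Integration over the mass hyperboloids -/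

/-- An inertial frame at `x`: an orthonormal frame `e_0, …, e_d` of the tangent space, with `e_0`
timelike and future-directed. -/
structure InertialFrame (g : LorentzMetric d M) (τ : TimeOrientation g) (x : M) where
  basis : Module.Basis (Fin (d + 1)) ℝ (TangentSpace (𝓡 (d + 1)) x)
  orthonormal : ∀ i j,
    g.val x (basis i) (basis j) = if i = j then (if i = 0 then -1 else 1) else 0
  future : g.val x (basis 0) (τ.val x) < 0

lemma metric_basis_left (g : LorentzMetric d M) (x : M)
    (b : Module.Basis (Fin (d + 1)) ℝ (TangentSpace (𝓡 (d + 1)) x))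
    (hb : ∀ i j, g.val x (b i) (b j) = if i = j then (if i = 0 then -1 else 1) else 0)
    (i : Fin (d + 1)) (X : TangentSpace (𝓡 (d + 1)) x) :
    g.val x (b i) X = (if i = 0 then -1 else 1) * b.repr X i := by
  conv_lhs => rw [← b.sum_repr X]
  simp only [map_sum, map_smul, hb, smul_eq_mul, mul_ite, mul_zero, Finset.sum_ite_eq,
    Finset.mem_univ, if_true]
  split_ifs <;> ring

lemma metric_eq_of_basis (g : LorentzMetric d M) (x : M)
    (b : Module.Basis (Fin (d + 1)) ℝ (TangentSpace (𝓡 (d + 1)) x))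
    (hb : ∀ i j, g.val x (b i) (b j) = if i = j then (if i = 0 then -1 else 1) else 0)
    (X Y : TangentSpace (𝓡 (d + 1)) x) :
    g.val x X Y = -(b.repr X 0 * b.repr Y 0) + ∑ i : Fin d, b.repr X i.succ * b.repr Y i.succ := by
  conv_lhs => rw [← b.sum_repr X]
  simp only [map_sum, map_smul, sum_apply, smul_apply,
    metric_basis_left g x b hb, smul_eq_mul]
  simp [Fin.sum_univ_succ]

lemma InertialFrame.nonempty (g : LorentzMetric d M) (τ : TimeOrientation g) (x : M) :
    Nonempty (InertialFrame g τ x) := by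
  obtain ⟨b, hb⟩ := g.signature x
  have h1 := τ.timelike x
  rw [metric_eq_of_basis g x b hb] at h1
  have h2 : b.repr (τ.val x) 0 ≠ 0 := by
    intro h
    have : 0 ≤ ∑ i : Fin d, b.repr (τ.val x) i.succ * b.repr (τ.val x) i.succ :=
      Finset.sum_nonneg fun i _ ↦ mul_self_nonneg _
    rw [h] at h1
    linarith
  have h3 : g.val x (b 0) (τ.val x) = -b.repr (τ.val x) 0 := by
    rw [metric_basis_left g x b hb]; simp
  rcases lt_or_gt_of_ne h2 with h | h
  · refine ⟨⟨b.unitsSMul fun _ ↦ -1, fun i j ↦ ?_, ?_⟩⟩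
    · simp [Module.Basis.unitsSMul_apply, Units.smul_def, hb]
    · simp only [Module.Basis.unitsSMul_apply, Units.smul_def, Units.val_neg, Units.val_one,
        neg_smul, one_smul, map_neg, neg_apply, h3]
      linarith
  · exact ⟨⟨b, hb, by rw [h3]; linarith⟩⟩

/-- The point of `P_x⁺` with spatial components `k` in an inertial frame:
`p = √(m² + |k|²) e_0 + k^i e_i`. -/
def InertialFrame.point {g : LorentzMetric d M} {τ : TimeOrientation g} {x : M}
    (e : InertialFrame g τ x) (m : ℝ) (k : EuclideanSpace ℝ (Fin d)) :
    TangentSpace (𝓡 (d + 1)) x :=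
  √(m ^ 2 + ‖k‖ ^ 2) • e.basis 0 + ∑ i, k i • e.basis i.succ

lemma InertialFrame.point_mem {g : LorentzMetric d M} {τ : TimeOrientation g} {x : M}
    (e : InertialFrame g τ x) {m : ℝ} (hm : 0 < m) (k : EuclideanSpace ℝ (Fin d)) :
    e.point m k ∈ massHyperboloid g τ m x := by
  have hk : ‖k‖ ^ 2 = ∑ i, k i * k i := by
    rw [EuclideanSpace.real_norm_sq_eq]; simp [sq]
  have r0 : e.basis.repr (e.point m k) 0 = √(m ^ 2 + ‖k‖ ^ 2) := by
    simp [InertialFrame.point]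
  have rs (i : Fin d) : e.basis.repr (e.point m k) i.succ = k i := by
    simp [InertialFrame.point, Finsupp.single_apply]
  have h2 : √(m ^ 2 + ‖k‖ ^ 2) ^ 2 = m ^ 2 + ‖k‖ ^ 2 := Real.sq_sqrt (by positivity)
  have hpos : 0 < √(m ^ 2 + ‖k‖ ^ 2) := Real.sqrt_pos.2 (by positivity)
  constructor
  · rw [metric_eq_of_basis g x e.basis e.orthonormal, r0]
    simp only [rs, ← hk]
    rw [← sq, h2]; ring
  · have ht := τ.timelike x
    have hf := e.future
    rw [metric_basis_left g x e.basis e.orthonormal] at hf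
    rw [metric_eq_of_basis g x e.basis e.orthonormal] at ht ⊢
    rw [r0]
    simp only [rs]
    simp only [if_true] at hf
    set c := e.basis.repr (τ.val x) 0
    have hcs := Finset.sum_mul_sq_le_sq_mul_sq Finset.univ k
      (fun i : Fin d ↦ e.basis.repr (τ.val x) i.succ)
    simp only [sq (k _), sq (e.basis.repr _ _), ← hk] at hcs
    by_contra hcon
    have h5 : √(m ^ 2 + ‖k‖ ^ 2) * c ≤ ∑ i : Fin d, k i * e.basis.repr (τ.val x) i.succ := by
      linarith
    have h6 : (√(m ^ 2 + ‖k‖ ^ 2) * c) ^ 2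
        ≤ (∑ i : Fin d, k i * e.basis.repr (τ.val x) i.succ) ^ 2 := by
      have : 0 < c := by linarith
      gcongr
    rw [mul_pow, h2] at h6
    set S := ∑ i : Fin d, e.basis.repr (τ.val x) i.succ * e.basis.repr (τ.val x) i.succ
    have hS : 0 ≤ S := Finset.sum_nonneg fun i _ ↦ mul_self_nonneg _
    nlinarith [sq_nonneg ‖k‖, mul_pos (sq_pos_of_pos hm) (show 0 < c * c - S by linarith),
      mul_nonneg (sq_nonneg ‖k‖) (show 0 ≤ c * c - S by linarith), mul_nonneg (sq_nonneg m) hS]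

/-- A choice of an inertial frame at `x`. By Lorentz invariance, the integrals over `P_x⁺` below do
not depend on it. -/
def inertialFrame (g : LorentzMetric d M) (τ : TimeOrientation g) (x : M) : InertialFrame g τ x :=
  (InertialFrame.nonempty g τ x).some

/-- The integral `∫_{P_x⁺} φ π_x` over the future mass hyperboloid, with the natural volume element
`π_x = dk^1 ∧ … ∧ dk^d / √(m² + |k|²)` in an inertial frame. -/
def fibreIntegral {g : LorentzMetric d M} {τ : TimeOrientation g} {m : ℝ} (hm : 0 < m) (x : M)
    (φ : massHyperboloid g τ m x → ℝ) : ℝ :=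
  ∫ k : EuclideanSpace ℝ (Fin d),
    φ ⟨(inertialFrame g τ x).point m k, (inertialFrame g τ x).point_mem hm k⟩ / √(m ^ 2 + ‖k‖ ^ 2)

/-- Integrability over the future mass hyperboloid with respect to `π_x`. -/
def FibreIntegrable {g : LorentzMetric d M} {τ : TimeOrientation g} {m : ℝ} (hm : 0 < m) (x : M)
    (φ : massHyperboloid g τ m x → ℝ) : Prop :=
  MeasureTheory.Integrable fun k : EuclideanSpace ℝ (Fin d) ↦
    φ ⟨(inertialFrame g τ x).point m k, (inertialFrame g τ x).point_mem hm k⟩ / √(m ^ 2 + ‖k‖ ^ 2)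

/-- The function `p ↦ f(x, p)` on `P_x⁺`. -/
def onFibre {g : LorentzMetric d M} {τ : TimeOrientation g} {m : ℝ}
    (f : massShell g τ m → ℝ) (x : M) (p : massHyperboloid g τ m x) : ℝ :=
  f ⟨⟨x, p.1⟩, p.2⟩

/-- The current density `J_x(α) = ∫_{P_x⁺} f(x, p) α(p) π_x`. -/
def currentDensity {g : LorentzMetric d M} {τ : TimeOrientation g} {m : ℝ} (hm : 0 < m)
    (f : massShell g τ m → ℝ) (x : M) (α : TangentSpace (𝓡 (d + 1)) x →L[ℝ] ℝ) : ℝ :=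
  fibreIntegral (g := g) (τ := τ) hm x fun p ↦ onFibre f x p * α p.1

/-- The stress-energy tensor `T_x(α, β) = ∫_{P_x⁺} f(x, p) α(p) β(p) π_x`. -/
def stressEnergy {g : LorentzMetric d M} {τ : TimeOrientation g} {m : ℝ} (hm : 0 < m)
    (f : massShell g τ m → ℝ) (x : M) (α β : TangentSpace (𝓡 (d + 1)) x →L[ℝ] ℝ) : ℝ :=
  fibreIntegral (g := g) (τ := τ) hm x fun p ↦ onFibre f x p * α p.1 * β p.1

/-- The current density as a tangent vector, `J = J^μ ∂/∂x^μ` with `J^μ = J(dx^μ)`. -/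
def currentVector {g : LorentzMetric d M} {τ : TimeOrientation g} {m : ℝ} (hm : 0 < m)
    (f : massShell g τ m → ℝ) (x : M) : TangentSpace (𝓡 (d + 1)) x :=
  ∑ μ, currentDensity hm f x (coordForm x x μ) • coordVec x x μ

end KineticTheory

end

/-! The inertial frames used in `fibreIntegral` are chosen point by point, so the integrals cannot
be differentiated in `x` as they stand. Each one is therefore replaced by an integral over the whole
coordinate space of `T_xM`. Extend `f` to be constant along rays and multiply by a cut-off `χ(s)`,
`s = -g(p,p)/m²`, supported away from the light cone. In polar coordinates `p = l · (point of the
hyperboloid)`, Lebesgue measure in an inertial frame is `m² l^d dl dk / √(m² + |k|²)`, and the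
determinant of the frame cancels `√(-det g)`. Hence `√(-det g) ∫ H p^μ dp` is the component `J^μ`
times a nonzero constant independent of `x` (`sqrt_mul_integral_eq_fibreIntegral`,
`RegularNear.sqrt_mul_integral_cutRep`).

Now the domain is fixed and the integrand `H` is `C¹` with locally uniform compact support, so one
may differentiate under the integral sign. The derivative of `√(-det g)` contributes `Γ^μ_{μl}`, the
covariant divergence contributes it once more, and the momentum divergence of `-Γ^μ_{αβ} p^α p^β` is
`-2 Γ^μ_{μl} p^l`. Integration by parts thus turns the divergence into the integral of the geodesic
part of `L` applied to `H` (`divergence_integral`). This part is tangent to the level sets of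
`g(p,p)`, so it passes through the cut-off. The electromagnetic part is a trace-free linear field in
`p`, hence its integral vanishes and it can be added freely. Under dilations of `p` it has one
degree less than the geodesic part, which is repaired by the second cut-off `√s χ(s)`
(`RegularNear.sqrt_mul_integral_fderiv_cutRep`). This gives the identity for `J`.

For `T`, the identity for `J` is applied to `f p^ν` in a fixed chart. By the Leibniz rule, `£_L p^ν
= -Γ^ν_{αβ} p^α p^β + q F^ν_σ p^σ`. The first term cancels the additional Christoffel term of `div
T`; the second gives `q F̃(J)` (`RegularNear.divTensor_stressEnergy`). Since `p^ν` makes sense only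
near one fibre, the regularity assumption `RegularNear` is local. -/

noncomputable section

namespace KineticTheory

open MeasureTheory Set

/-! ### Integration over the solid future cone of Minkowski space -/

section Cone

variable {V : Type*} [NormedAddCommGroup V] [InnerProductSpace ℝ V]

/-- Polar coordinates of the solid future cone: the scale `l` and the spatial part `k` of a point
of the hyperboloid of mass `m`. -/
def conePolar (m : ℝ) (z : ℝ × V) : ℝ × V := (z.1 * √(m ^ 2 + ‖z.2‖ ^ 2), z.1 • z.2)

/-- The derivative of `conePolar`. -/
def conePolarDeriv (m : ℝ) (z : ℝ × V) : ℝ × V →L[ℝ] ℝ × V :=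
  (√(m ^ 2 + ‖z.2‖ ^ 2) • ContinuousLinearMap.fst ℝ ℝ V
    + (z.1 / √(m ^ 2 + ‖z.2‖ ^ 2)) • (innerSL ℝ z.2).comp (ContinuousLinearMap.snd ℝ ℝ V)).prod
  ((ContinuousLinearMap.fst ℝ ℝ V).smulRight z.2 + z.1 • ContinuousLinearMap.snd ℝ ℝ V)

lemma hasFDerivAt_conePolar {m : ℝ} (hm : 0 < m) (z : ℝ × V) :
    HasFDerivAt (conePolar m) (conePolarDeriv m z) z := by
  have hpos : m ^ 2 + ‖z.2‖ ^ 2 ≠ 0 := by positivity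
  have h1 : HasFDerivAt (fun z : ℝ × V ↦ ‖z.2‖ ^ 2)
      ((2 • (innerSL ℝ z.2)).comp (ContinuousLinearMap.snd ℝ ℝ V)) z :=
    (hasStrictFDerivAt_norm_sq z.2).hasFDerivAt.comp z hasFDerivAt_snd
  have h2 := (h1.const_add (m ^ 2)).sqrt hpos
  have h3 := (hasFDerivAt_fst (𝕜 := ℝ) (p := z)).mul h2
  have h4 := (hasFDerivAt_fst (𝕜 := ℝ) (p := z)).smul (hasFDerivAt_snd (𝕜 := ℝ) (p := z))
  refine (h3.prodMk h4).congr_fderiv ?_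
  have hs : √(m ^ 2 + ‖z.2‖ ^ 2) ≠ 0 := by positivity
  ext <;> simp [conePolarDeriv]
  field_simp

/-- The derivative is a product of two transvections and the block map `id × l`. With `s = √(m² +
|k|²)`, the block map contributes `l^n`, the inner transvection `1`, and the outer one `s - |k|²/s =
m²/s`. This is where the density `1/√(m² + |k|²)` of `π_x` comes from. -/
lemma det_conePolarDeriv [FiniteDimensional ℝ V] {m : ℝ} (hm : 0 < m) (z : ℝ × V) :
    (conePolarDeriv m z).det
      = m ^ 2 * z.1 ^ Module.finrank ℝ V / √(m ^ 2 + ‖z.2‖ ^ 2) := by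
  set s := √(m ^ 2 + ‖z.2‖ ^ 2) with hs
  have hs0 : s ≠ 0 := by positivity
  have hs2 : s ^ 2 = m ^ 2 + ‖z.2‖ ^ 2 := Real.sq_sqrt (by positivity)
  have key : (conePolarDeriv m z : ℝ × V →ₗ[ℝ] ℝ × V)
      = LinearMap.transvection ((s - 1 - ‖z.2‖ ^ 2 / s) • LinearMap.fst ℝ ℝ V
          + s⁻¹ • (innerSL ℝ z.2 : V →ₗ[ℝ] ℝ).comp (LinearMap.snd ℝ ℝ V)) ((1, 0) : ℝ × V)
        * (LinearMap.transvection (LinearMap.fst ℝ ℝ V) ((0, z.2) : ℝ × V)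
        * LinearMap.prodMap LinearMap.id (z.1 • LinearMap.id)) := by
    refine LinearMap.ext fun w ↦ ?_
    ext
    · simp [conePolarDeriv, LinearMap.transvection.apply, ← hs, inner_smul_right, inner_add_right]
      field_simp
      ring
    · simp [conePolarDeriv, LinearMap.transvection.apply, ← hs, add_comm]
  change LinearMap.det (conePolarDeriv m z : ℝ × V →ₗ[ℝ] ℝ × V) = _
  rw [key, map_mul, map_mul, LinearMap.transvection.det, LinearMap.transvection.det,
    LinearMap.det_prodMap]
  simp
  field_simp
  linear_combination z.1 ^ Module.finrank ℝ V * hs2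

/-- The Minkowski square of the image point is `-l² m²`, so the image determines `l > 0` and then
`k`. -/
lemma injOn_conePolar {m : ℝ} (hm : 0 < m) :
    InjOn (conePolar m) (Ioi (0 : ℝ) ×ˢ (univ : Set V)) := by
  rintro ⟨l, k⟩ ⟨hl, -⟩ ⟨l', k'⟩ ⟨hl', -⟩ h
  simp only [conePolar, Prod.mk.injEq, mem_Ioi] at h hl hl'
  obtain ⟨h1, h2⟩ := h
  have h3 : (l * √(m ^ 2 + ‖k‖ ^ 2)) ^ 2 = (l' * √(m ^ 2 + ‖k'‖ ^ 2)) ^ 2 := by rw [h1]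
  have h4 : ‖l • k‖ ^ 2 = ‖l' • k'‖ ^ 2 := by rw [h2]
  rw [mul_pow, mul_pow, Real.sq_sqrt (by positivity), Real.sq_sqrt (by positivity)] at h3
  rw [norm_smul, norm_smul, mul_pow, mul_pow, Real.norm_eq_abs, Real.norm_eq_abs, sq_abs,
    sq_abs] at h4
  have h5 : l ^ 2 = l' ^ 2 := by
    have : m ^ 2 * l ^ 2 = m ^ 2 * l' ^ 2 := by linarith
    exact mul_left_cancel₀ (by positivity) this
  have h6 : l = l' := by
    rwa [sq_eq_sq₀ hl.le hl'.le] at h5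
  subst h6
  rw [smul_right_injective V hl.ne' h2]

lemma image_conePolar {m : ℝ} (hm : 0 < m) :
    conePolar m '' (Ioi (0 : ℝ) ×ˢ (univ : Set V)) = {z | ‖z.2‖ < z.1} := by
  ext ⟨a, v⟩
  constructor
  · rintro ⟨⟨l, k⟩, ⟨hl, -⟩, h⟩
    simp only [conePolar, Prod.mk.injEq, mem_Ioi] at h hl
    obtain ⟨rfl, rfl⟩ := h
    simp only [mem_ofPred_eq, norm_smul, Real.norm_eq_abs, abs_of_pos hl]
    gcongr
    exact Real.lt_sqrt_of_sq_lt (by nlinarith)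
  · intro h
    simp only [mem_ofPred_eq] at h
    have ha : 0 < a := (norm_nonneg v).trans_lt h
    have hpos : 0 < a ^ 2 - ‖v‖ ^ 2 := by nlinarith [norm_nonneg v]
    -- The scale is the Minkowski length of the point in units of `m`.
    set l := √(a ^ 2 - ‖v‖ ^ 2) / m with hl
    have hl0 : 0 < l := div_pos (Real.sqrt_pos.2 hpos) hm
    have hl2 : l ^ 2 * m ^ 2 = a ^ 2 - ‖v‖ ^ 2 := by
      rw [hl, div_pow, Real.sq_sqrt hpos.le]; field_simp
    refine ⟨(l, l⁻¹ • v), ⟨hl0, mem_univ _⟩, ?_⟩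
    simp only [conePolar, Prod.mk.injEq]
    constructor
    · rw [norm_smul, ← Real.sqrt_sq hl0.le, ← Real.sqrt_mul (by positivity), Real.sqrt_sq hl0.le,
        Real.norm_eq_abs, mul_pow, sq_abs]
      have : l ^ 2 * (m ^ 2 + l⁻¹ ^ 2 * ‖v‖ ^ 2) = a ^ 2 := by
        rw [mul_add, hl2]; field_simp; ring
      rw [this, Real.sqrt_sq ha.le]
    · rw [smul_smul, mul_inv_cancel₀ hl0.ne', one_smul]

instance isAddHaarMeasure_volume_real_prod [FiniteDimensional ℝ V] [MeasurableSpace V]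
    [BorelSpace V] : (volume : Measure (ℝ × V)).IsAddHaarMeasure :=
  inferInstanceAs ((volume : Measure ℝ).prod (volume : Measure V)).IsAddHaarMeasure

/-- Integration over the solid cone in polar coordinates, for functions that are a product of a
function of the scale and a function on the hyperboloid. -/
theorem integral_cone [FiniteDimensional ℝ V] [MeasurableSpace V] [BorelSpace V] {m : ℝ}
    (hm : 0 < m) (ψ : ℝ × V → ℝ) (κ : ℝ → ℝ) (φ : V → ℝ)
    (h0 : ∀ z, z.1 ≤ ‖z.2‖ → ψ z = 0)
    (h1 : ∀ l, 0 < l → ∀ k, ψ (conePolar m (l, k)) = κ l * φ k) :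
    ∫ z, ψ z = (∫ l in Ioi 0, m ^ 2 * l ^ Module.finrank ℝ V * κ l)
      * ∫ k, φ k / √(m ^ 2 + ‖k‖ ^ 2) := by
  have hS : MeasurableSet (Ioi (0 : ℝ) ×ˢ (univ : Set V)) := measurableSet_Ioi.prod .univ
  have e1 : ∫ z, ψ z = ∫ z in {z : ℝ × V | ‖z.2‖ < z.1}, ψ z := by
    symm
    apply setIntegral_eq_integral_of_forall_compl_eq_zero
    intro z hz
    exact h0 z (not_lt.1 hz)
  rw [e1, ← image_conePolar hm, integral_image_eq_integral_abs_det_fderiv_smul volume hS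
    (fun z _ ↦ (hasFDerivAt_conePolar hm z).hasFDerivWithinAt) (injOn_conePolar hm)]
  rw [Measure.volume_eq_prod, ← Measure.prod_restrict, Measure.restrict_univ, ← integral_prod_mul,
    ← Measure.restrict_univ (μ := (volume : Measure V)), Measure.prod_restrict]
  refine setIntegral_congr_fun hS ?_
  rintro ⟨l, k⟩ ⟨hl, -⟩
  have hl : 0 < l := hl
  simp only [det_conePolarDeriv hm, smul_eq_mul, h1 l hl]
  rw [abs_of_nonneg (by positivity)]
  ring

/-- The vector with components `z` in a family `b_0, …, b_d`. -/
def frameVec {d : ℕ} {W : Type*} [AddCommGroup W] [Module ℝ W] (b : Fin (d + 1) → W)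
    (z : ℝ × EuclideanSpace ℝ (Fin d)) : W := z.1 • b 0 + ∑ i, z.2 i • b i.succ

lemma map_frameVec {d : ℕ} {W W' : Type*} [AddCommGroup W] [Module ℝ W] [AddCommGroup W']
    [Module ℝ W'] (T : W →ₗ[ℝ] W') (b : Fin (d + 1) → W) (z : ℝ × EuclideanSpace ℝ (Fin d)) :
    T (frameVec b z) = frameVec (fun i ↦ T (b i)) z := by
  simp [frameVec]

/-- Change to the components in a frame in an integral over a vector space: up to a universal
constant, the Jacobian is the determinant of the frame. -/
theorem exists_integral_eq_frameVec (d : ℕ) : ∃ C : ℝ, C ≠ 0 ∧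
    ∀ (A : Matrix (Fin (d + 1)) (Fin (d + 1)) ℝ) (_ : A.det ≠ 0)
      (ψ : EuclideanSpace ℝ (Fin (d + 1)) → ℝ),
      ∫ p, ψ p = C * |A.det| * ∫ z, ψ (frameVec (fun i ↦ WithLp.toLp 2 fun μ ↦ A μ i) z) := by
  let e : Fin (d + 1) → EuclideanSpace ℝ (Fin (d + 1)) := fun i ↦ EuclideanSpace.single i 1
  let L0 : (ℝ × EuclideanSpace ℝ (Fin d)) →ₗ[ℝ] EuclideanSpace ℝ (Fin (d + 1)) :=
    { toFun := frameVec e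
      map_add' := fun z w ↦ by
        simp only [frameVec, Prod.fst_add, Prod.snd_add, PiLp.add_apply, add_smul,
          Finset.sum_add_distrib]; abel
      map_smul' := fun c z ↦ by
        simp [frameVec, smul_smul, Finset.smul_sum] }
  have hval0 (z) : L0 z 0 = z.1 := by
    change frameVec e z 0 = z.1
    simp [frameVec, e]
  have hvals (z) (i : Fin d) : L0 z i.succ = z.2 i := by
    change frameVec e z i.succ = z.2 i
    simp [frameVec, e, Pi.single_apply]
  have hinj : Function.Injective L0 := by
    intro z w h
    ext i
    · rw [← hval0, ← hval0, h]
    · rw [← hvals, ← hvals, h]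
  let L : (ℝ × EuclideanSpace ℝ (Fin d)) ≃L[ℝ] EuclideanSpace ℝ (Fin (d + 1)) :=
    (LinearEquiv.ofInjectiveOfFinrankEq L0 hinj (by simp [add_comm])).toContinuousLinearEquiv
  have hL (z) : L z = frameVec e z := rfl
  have : (Measure.map L volume).IsAddHaarMeasure :=
    L.isAddHaarMeasure_map (volume : Measure (ℝ × EuclideanSpace ℝ (Fin d)))
  -- Both measures are Haar measures, hence proportional. The value of the factor is never needed,
  -- only that it is nonzero and independent of the frame `A`.
  have hμ := Measure.isAddLeftInvariant_eq_smul (volume : Measure (EuclideanSpace ℝ (Fin (d + 1))))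
    (Measure.map L volume)
  set c := Measure.addHaarScalarFactor (volume : Measure (EuclideanSpace ℝ (Fin (d + 1))))
    (Measure.map L volume) with hc
  have hc0 : c ≠ 0 := (Measure.addHaarScalarFactor_pos_of_isAddHaarMeasure _ _).ne'
  refine ⟨c, by exact_mod_cast hc0, fun A hA ψ ↦ ?_⟩
  let T : EuclideanSpace ℝ (Fin (d + 1)) →ₗ[ℝ] EuclideanSpace ℝ (Fin (d + 1)) :=
    Matrix.toEuclideanLin A
  have hTe (i) : T (e i) = WithLp.toLp 2 fun μ ↦ A μ i := by
    ext μ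
    simp [T, e, Matrix.toLpLin_apply]
  have hTdet : LinearMap.det T = A.det := by
    simp [T]
  have h1 : ∫ p, ψ p = |A.det| * ∫ p, ψ (T p) := by
    have hT0 : LinearMap.det T ≠ 0 := by rwa [hTdet]
    have hm := Measure.map_linearMap_addHaar_eq_smul_addHaar
      (volume : Measure (EuclideanSpace ℝ (Fin (d + 1)))) hT0
    let T' := ((LinearEquiv.ofIsUnitDet (f := T) (v := (EuclideanSpace.basisFun _ ℝ).toBasis)
      (v' := (EuclideanSpace.basisFun _ ℝ).toBasis)
      (by rw [LinearMap.det_toMatrix]; exact isUnit_iff_ne_zero.2 hT0))).toContinuousLinearEquiv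
    have hT' : ∫ p, ψ (T p) = ∫ p, ψ p ∂(Measure.map T volume) :=
      (T'.toHomeomorph.measurableEmbedding.integral_map ψ).symm
    rw [hT', hm, integral_smul_measure, ENNReal.toReal_ofReal (abs_nonneg _), hTdet, smul_eq_mul,
      ← mul_assoc, ← abs_mul, mul_inv_cancel₀ hA, abs_one, one_mul]
  have h2 : ∫ p, ψ (T p) = c * ∫ z, ψ (T (L z)) := by
    conv_lhs => rw [hμ]
    rw [integral_smul_nnreal_measure]
    exact congrArg (c • ·)
      (L.toHomeomorph.measurableEmbedding.integral_map (μ := volume) fun p ↦ ψ (T p))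
  rw [h1, h2]
  simp only [hL, map_frameVec, hTe]
  ring

end Cone

/-! ### Calculus lemmas -/

section Calculus

/-- Along the line `A + tB` the determinant is `det A · det(1 + t A⁻¹B)`, whose linear coefficient
is a trace. -/
lemma fderiv_det_apply {n : Type*} [Fintype n] [DecidableEq n] (A B : n → n → ℝ)
    (hA : (Matrix.of A).det ≠ 0) :
    fderiv ℝ (fun A : n → n → ℝ ↦ (Matrix.of A).det) A B
      = (Matrix.of A).det * ((Matrix.of A)⁻¹ * Matrix.of B).trace := by
  have hd : Differentiable ℝ (fun A : n → n → ℝ ↦ (Matrix.of A).det) := by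
    simp only [Matrix.det_apply, Matrix.of_apply]
    fun_prop
  have h1 : HasDerivAt (fun t : ℝ ↦ (Matrix.of (A + t • B)).det)
      (fderiv ℝ (fun A : n → n → ℝ ↦ (Matrix.of A).det) A B) 0 := by
    have hl : HasDerivAt (fun t : ℝ ↦ A + t • B) B 0 := by
      simpa using ((hasDerivAt_id (0 : ℝ)).smul_const B).const_add A
    have := (hd (A + (0 : ℝ) • B)).hasFDerivAt.comp_hasDerivAt (0 : ℝ) hl
    rw [zero_smul, add_zero] at this
    exact this
  -- `Q` is what remains of the polynomial `det(1 + t A⁻¹B)` after its two lowest terms are dropped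
  -- and `t²` is divided out.
  set Q := (1 + Polynomial.X (R := ℝ) • ((Matrix.of A)⁻¹ * Matrix.of B).map Polynomial.C).det.divX.divX
    with hQ
  have h2 : ∀ t : ℝ, (Matrix.of (A + t • B)).det = (Matrix.of A).det *
      (1 + ((Matrix.of A)⁻¹ * Matrix.of B).trace * t + Q.eval t * t ^ 2) := by
    intro t
    rw [hQ, ← Matrix.det_one_add_smul, ← Matrix.det_mul, mul_add, mul_one, Matrix.mul_smul,
      Matrix.mul_nonsing_inv_cancel_left _ _ (isUnit_iff_ne_zero.2 hA)]
    rfl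
  have h3 : HasDerivAt (fun t : ℝ ↦ (Matrix.of (A + t • B)).det)
      ((Matrix.of A).det * ((Matrix.of A)⁻¹ * Matrix.of B).trace) 0 := by
    simp only [h2]
    have h4 := (((hasDerivAt_id (0 : ℝ)).const_mul
      ((Matrix.of A)⁻¹ * Matrix.of B).trace).const_add 1).add
      ((Q.hasDerivAt 0).mul (hasDerivAt_pow 2 (0 : ℝ)))
    simpa using h4.const_mul (Matrix.of A).det
  exact h1.unique h3

/-- Jacobi's formula. -/
lemma hasFDerivAt_det {X n : Type*} [NormedAddCommGroup X] [NormedSpace ℝ X] [Fintype n]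
    [DecidableEq n] {G : X → Matrix n n ℝ} {G' : n → n → X →L[ℝ] ℝ} {u : X}
    (hG : ∀ i j, HasFDerivAt (fun v ↦ G v i j) (G' i j) u) (h0 : (G u).det ≠ 0) :
    HasFDerivAt (fun v ↦ (G v).det) ((G u).det • ∑ i, ∑ j, (G u)⁻¹ i j • G' j i) u := by
  have hd : Differentiable ℝ (fun A : n → n → ℝ ↦ (Matrix.of A).det) := by
    simp only [Matrix.det_apply, Matrix.of_apply]
    fun_prop
  have h1 : HasFDerivAt (fun v i j ↦ G v i j)
      (ContinuousLinearMap.pi fun i ↦ ContinuousLinearMap.pi fun j ↦ G' i j) u :=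
    hasFDerivAt_pi.2 fun i ↦ hasFDerivAt_pi.2 fun j ↦ hG i j
  have h2 := (hd (fun i j ↦ G u i j)).hasFDerivAt.comp u h1
  refine h2.congr_fderiv ?_
  ext v
  rw [ContinuousLinearMap.comp_apply, fderiv_det_apply _ _ h0]
  simp only [Matrix.trace, Matrix.diag, Matrix.mul_apply, smul_apply,
    sum_apply, smul_eq_mul]
  rfl

variable {X Y : Type*} [NormedAddCommGroup X] [NormedSpace ℝ X] [NormedAddCommGroup Y]
  [NormedSpace ℝ Y] {N : Set X} {H : X × Y → ℝ} {K : Set Y} {u : X}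

lemma contDiff_slice (hH : ContDiffOn ℝ 1 H (N ×ˢ univ)) (hu : u ∈ N) :
    ContDiff ℝ 1 (fun p ↦ H (u, p)) := by
  rw [← contDiffOn_univ]
  exact hH.comp (contDiff_prodMk_right u).contDiffOn fun p _ ↦ ⟨hu, mem_univ p⟩

lemma hasFDerivAt_of_slab (hN : IsOpen N) (hH : ContDiffOn ℝ 1 H (N ×ˢ univ)) (hu : u ∈ N)
    (p : Y) : HasFDerivAt H (fderiv ℝ H (u, p)) (u, p) :=
  ((hH.contDiffAt ((hN.prod isOpen_univ).mem_nhds ⟨hu, mem_univ p⟩)).differentiableAt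
    (by simp)).hasFDerivAt

lemma fderiv_slice (hN : IsOpen N) (hH : ContDiffOn ℝ 1 H (N ×ˢ univ)) (hu : u ∈ N) (p v : Y) :
    fderiv ℝ (fun p ↦ H (u, p)) p v = fderiv ℝ H (u, p) (0, v) := by
  have h := (hasFDerivAt_of_slab hN hH hu p).comp p (hasFDerivAt_prodMk_right u p)
  rw [show (fun p ↦ H (u, p)) = H ∘ fun p ↦ (u, p) from rfl, h.fderiv]
  simp

lemma continuous_fderiv_slice (hN : IsOpen N) (hH : ContDiffOn ℝ 1 H (N ×ˢ univ)) (hu : u ∈ N) :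
    Continuous fun p ↦ fderiv ℝ H (u, p) := by
  have h := hH.continuousOn_fderiv_of_isOpen (hN.prod isOpen_univ) le_rfl
  rw [← continuousOn_univ]
  exact h.comp (by fun_prop) fun p _ ↦ ⟨hu, mem_univ p⟩

lemma fderiv_eq_zero_of_notMem (hN : IsOpen N) (hK : IsClosed K) (hu : u ∈ N)
    (h0 : ∀ v ∈ N, ∀ p ∉ K, H (v, p) = 0) {p : Y} (hp : p ∉ K) : fderiv ℝ H (u, p) = 0 := by
  have : H =ᶠ[𝓝 (u, p)] fun _ ↦ 0 := by
    filter_upwards [(hN.prod hK.isOpen_compl).mem_nhds ⟨hu, hp⟩] with z hz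
    exact h0 z.1 hz.1 z.2 hz.2
  rw [this.fderiv_eq]
  simp

variable [FiniteDimensional ℝ X] [MeasurableSpace Y] [BorelSpace Y]
  {μ : Measure Y} [μ.IsAddHaarMeasure]

/-- Differentiation under the integral sign for integrands with locally uniform compact support. -/
lemma hasFDerivAt_integral_of_compact (hN : IsOpen N) (hH : ContDiffOn ℝ 1 H (N ×ˢ univ))
    (hK : IsCompact K) (h0 : ∀ v ∈ N, ∀ p ∉ K, H (v, p) = 0) (hu : u ∈ N) :
    HasFDerivAt (fun v ↦ ∫ p, H (v, p) ∂μ)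
      (∫ p, (fderiv ℝ H (u, p)).comp (ContinuousLinearMap.inl ℝ X Y) ∂μ) u := by
  obtain ⟨r, hr, hrN⟩ := Metric.nhds_basis_closedBall.mem_iff.1 (hN.mem_nhds hu)
  -- The dominating function is constant on `K`, by compactness of the product of a closed ball with
  -- `K`, and zero off `K`, where the derivative vanishes as well.
  have hc := hH.continuousOn_fderiv_of_isOpen (hN.prod isOpen_univ) le_rfl
  obtain ⟨C, hC⟩ := ((isCompact_closedBall u r).prod hK).exists_bound_of_continuousOn
    (hc.mono (prod_mono hrN (subset_univ K)))
  have hinl : ‖ContinuousLinearMap.inl ℝ X Y‖ ≤ 1 :=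
    ContinuousLinearMap.opNorm_le_bound _ zero_le_one fun x ↦ by simp
  refine hasFDerivAt_integral_of_dominated_of_fderiv_le (Metric.closedBall_mem_nhds u hr)
    (F := fun v p ↦ H (v, p))
    (F' := fun v p ↦ (fderiv ℝ H (v, p)).comp (ContinuousLinearMap.inl ℝ X Y))
    (bound := K.indicator fun _ ↦ C) ?_ ?_ ?_ ?_ ?_ ?_
  · filter_upwards [hN.mem_nhds hu] with v hv
    exact (contDiff_slice hH hv).continuous.aestronglyMeasurable
  · exact (contDiff_slice hH hu).continuous.integrable_of_hasCompactSupport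
      (HasCompactSupport.intro hK fun p hp ↦ h0 u hu p hp)
  · exact ((continuous_fderiv_slice hN hH hu).clm_comp continuous_const).aestronglyMeasurable
  · refine Filter.Eventually.of_forall fun p v hv ↦ ?_
    by_cases hp : p ∈ K
    · rw [indicator_of_mem hp]
      calc _ ≤ ‖fderiv ℝ H (v, p)‖ * ‖ContinuousLinearMap.inl ℝ X Y‖ :=
            ContinuousLinearMap.opNorm_comp_le _ _
        _ ≤ ‖fderiv ℝ H (v, p)‖ * 1 := by gcongr
        _ ≤ C := by rw [mul_one]; exact hC (v, p) ⟨hv, hp⟩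
    · rw [indicator_of_notMem hp, fderiv_eq_zero_of_notMem hN hK.isClosed (hrN hv) h0 hp]
      simp
  · rw [integrable_indicator_iff hK.measurableSet]
    exact integrableOn_const hK.measure_lt_top.ne
  · refine Filter.Eventually.of_forall fun p v hv ↦ ?_
    exact (hasFDerivAt_of_slab hN hH (hrN hv) p).comp v (hasFDerivAt_prodMk_left v p)

/-- Integration by parts against a compactly supported function. -/
lemma integral_mul_fderiv_eq_neg [FiniteDimensional ℝ Y] {b h : Y → ℝ} (hb : ContDiff ℝ 1 b) (hh : ContDiff ℝ 1 h)
    (hs : HasCompactSupport h) (v : Y) :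
    ∫ p, b p * fderiv ℝ h p v ∂μ = -∫ p, fderiv ℝ b p v * h p ∂μ := by
  have cb := hb.continuous
  have ch := hh.continuous
  have cb' : Continuous fun p ↦ fderiv ℝ b p v := (hb.continuous_fderiv one_ne_zero).clm_apply
    continuous_const
  have ch' : Continuous fun p ↦ fderiv ℝ h p v := (hh.continuous_fderiv one_ne_zero).clm_apply
    continuous_const
  apply integral_mul_fderiv_eq_neg_fderiv_mul_of_integrable
  · exact (cb'.mul ch).integrable_of_hasCompactSupport hs.mul_left
  · refine (cb.mul ch').integrable_of_hasCompactSupport (HasCompactSupport.mul_left ?_)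
    exact hs.fderiv_apply (𝕜 := ℝ) v
  · exact (cb.mul ch).integrable_of_hasCompactSupport hs.mul_left
  · exact fun p _ ↦ hb.differentiable (by simp) p
  · exact fun p _ ↦ hh.differentiable (by simp) p

end Calculus

/-! ### Divergences in local coordinates -/

section LocalDivergence

variable {d : ℕ} {N : Set (EuclideanSpace ℝ (Fin (d + 1)))}
  {H : EuclideanSpace ℝ (Fin (d + 1)) × EuclideanSpace ℝ (Fin (d + 1)) → ℝ}
  {K : Set (EuclideanSpace ℝ (Fin (d + 1)))} {u : EuclideanSpace ℝ (Fin (d + 1))}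

lemma sum_smul_single (p : EuclideanSpace ℝ (Fin (d + 1))) :
    ∑ μ, p μ • EuclideanSpace.single μ (1 : ℝ) = p := by
  ext i
  simp [Pi.single_apply]

lemma fderiv_prod_eq_sum (L : EuclideanSpace ℝ (Fin (d + 1)) × EuclideanSpace ℝ (Fin (d + 1)) →L[ℝ] ℝ)
    (a b : EuclideanSpace ℝ (Fin (d + 1))) :
    L (a, b) = ∑ μ, a μ * L (EuclideanSpace.single μ 1, 0)
      + ∑ μ, b μ * L (0, EuclideanSpace.single μ 1) := by
  have h1 : (a, b) = ∑ μ, a μ • ((EuclideanSpace.single μ 1, 0) :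
      EuclideanSpace ℝ (Fin (d + 1)) × EuclideanSpace ℝ (Fin (d + 1)))
      + ∑ μ, b μ • ((0, EuclideanSpace.single μ 1) :
      EuclideanSpace ℝ (Fin (d + 1)) × EuclideanSpace ℝ (Fin (d + 1))) := by
    ext1
    · simp only [Prod.fst_add, Prod.fst_sum, Prod.smul_fst, smul_zero, Finset.sum_const_zero,
        add_zero, sum_smul_single]
    · simp only [Prod.snd_add, Prod.snd_sum, Prod.smul_snd, smul_zero, Finset.sum_const_zero,
        zero_add, sum_smul_single]
  rw [h1]
  simp only [map_add, map_sum, map_smul, smul_eq_mul]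

/-- The quadratic vector field `p ↦ -Γ^μ_{αβ} p^α p^β`. -/
def geodesicForce (γ : Fin (d + 1) → Fin (d + 1) → Fin (d + 1) → ℝ)
    (p : EuclideanSpace ℝ (Fin (d + 1))) : EuclideanSpace ℝ (Fin (d + 1)) :=
  WithLp.toLp 2 fun μ ↦ -∑ α, ∑ β, γ μ α β * p α * p β

lemma contDiff_geodesicForce (γ : Fin (d + 1) → Fin (d + 1) → Fin (d + 1) → ℝ) (μ : Fin (d + 1)) :
    ContDiff ℝ 1 (fun p ↦ geodesicForce γ p μ) := by
  simp only [geodesicForce]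
  fun_prop

lemma fderiv_geodesicForce {γ : Fin (d + 1) → Fin (d + 1) → Fin (d + 1) → ℝ}
    (hγ : ∀ μ α β, γ μ α β = γ μ β α) (μ : Fin (d + 1)) (p : EuclideanSpace ℝ (Fin (d + 1))) :
    fderiv ℝ (fun p ↦ geodesicForce γ p μ) p (EuclideanSpace.single μ 1)
      = -(2 * ∑ l, γ μ μ l * p l) := by
  have hc (i : Fin (d + 1)) : HasFDerivAt (fun p : EuclideanSpace ℝ (Fin (d + 1)) ↦ p i)
      (EuclideanSpace.proj (𝕜 := ℝ) i) p := (EuclideanSpace.proj (𝕜 := ℝ) i).hasFDerivAt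
  have h : HasFDerivAt (fun p ↦ geodesicForce γ p μ) _ p :=
    (HasFDerivAt.fun_sum (u := Finset.univ) fun α _ ↦ HasFDerivAt.fun_sum (u := Finset.univ)
      fun β _ ↦ ((hc α).const_mul (γ μ α β)).mul (hc β)).neg
  rw [h.fderiv]
  simp only [neg_apply, sum_apply, add_apply,
    smul_apply, PiLp.proj_apply, smul_eq_mul,
    PiLp.single_apply, Finset.sum_add_distrib]
  simp only [mul_ite, mul_one, mul_zero, Finset.sum_ite_eq', Finset.mem_univ, if_true]
  rw [Finset.sum_comm]
  simp only [Finset.sum_ite_eq', Finset.mem_univ, if_true]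
  rw [two_mul]
  congr 2
  · exact Finset.sum_congr rfl fun α _ ↦ by rw [hγ]
  · exact Finset.sum_congr rfl fun α _ ↦ by ring

/-- Integration by parts; the factor `2` comes from the symmetry of `γ` in its lower indices. In
`divergence_integral` one copy matches the derivative of the density and the other the Christoffel
term of the divergence. -/
lemma integral_geodesicForce {γ : Fin (d + 1) → Fin (d + 1) → Fin (d + 1) → ℝ}
    (hγ : ∀ μ α β, γ μ α β = γ μ β α) {h : EuclideanSpace ℝ (Fin (d + 1)) → ℝ}
    (hh : ContDiff ℝ 1 h) (hs : HasCompactSupport h) :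
    ∑ μ, ∫ p, geodesicForce γ p μ * fderiv ℝ h p (EuclideanSpace.single μ 1)
      = 2 * ∑ μ, ∑ l, γ μ μ l * ∫ p, h p * p l := by
  rw [Finset.mul_sum]
  refine Finset.sum_congr rfl fun μ _ ↦ ?_
  rw [integral_mul_fderiv_eq_neg (contDiff_geodesicForce γ μ) hh hs, ← integral_neg, Finset.mul_sum]
  simp only [fderiv_geodesicForce hγ, neg_mul, neg_neg, Finset.mul_sum, Finset.sum_mul]
  rw [integral_finsetSum]
  · refine Finset.sum_congr rfl fun l _ ↦ ?_
    rw [← integral_const_mul, ← integral_const_mul]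
    congr 1 with p
    ring
  · intro l _
    have hc := hh.continuous
    exact (Continuous.mul (by fun_prop) hc).integrable_of_hasCompactSupport hs.mul_left

/-- A trace-free linear vector field is divergence-free. -/
lemma integral_fderiv_traceless {A : Matrix (Fin (d + 1)) (Fin (d + 1)) ℝ} (hA : A.trace = 0)
    {h : EuclideanSpace ℝ (Fin (d + 1)) → ℝ} (hh : ContDiff ℝ 1 h) (hs : HasCompactSupport h) :
    ∫ p, fderiv ℝ h p (WithLp.toLp 2 (A.mulVec p)) = 0 := by
  have hc (i : Fin (d + 1)) (p : EuclideanSpace ℝ (Fin (d + 1))) :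
      HasFDerivAt (fun p : EuclideanSpace ℝ (Fin (d + 1)) ↦ p i)
      (EuclideanSpace.proj (𝕜 := ℝ) i) p := (EuclideanSpace.proj (𝕜 := ℝ) i).hasFDerivAt
  have hb (μ : Fin (d + 1)) :
      ContDiff ℝ 1 fun p : EuclideanSpace ℝ (Fin (d + 1)) ↦ ∑ ν, A μ ν * p ν := by fun_prop
  have hb' (μ : Fin (d + 1)) (p : EuclideanSpace ℝ (Fin (d + 1))) :
      fderiv ℝ (fun p : EuclideanSpace ℝ (Fin (d + 1)) ↦ ∑ ν, A μ ν * p ν) p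
        (EuclideanSpace.single μ 1) = A μ μ := by
    have h : HasFDerivAt (fun p : EuclideanSpace ℝ (Fin (d + 1)) ↦ ∑ ν, A μ ν * p ν) _ p :=
      HasFDerivAt.fun_sum (u := Finset.univ) fun ν _ ↦ (hc ν p).const_mul (A μ ν)
    rw [h.fderiv]
    simp
  have h1 (p) : fderiv ℝ h p (WithLp.toLp 2 (A.mulVec p))
      = ∑ μ, (∑ ν, A μ ν * p ν) * fderiv ℝ h p (EuclideanSpace.single μ 1) := by
    conv_lhs => rw [← sum_smul_single (WithLp.toLp 2 (A.mulVec p))]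
    simp [Matrix.mulVec, dotProduct]
  simp only [h1]
  have ch' (v) : Continuous fun p ↦ fderiv ℝ h p v := (hh.continuous_fderiv one_ne_zero).clm_apply
    continuous_const
  rw [integral_finsetSum]
  · simp only [integral_mul_fderiv_eq_neg (hb _) hh hs, hb', integral_const_mul, ← neg_mul]
    rw [← Finset.sum_mul, Finset.sum_neg_distrib]
    change -A.trace * _ = 0
    rw [hA]
    simp
  · intro μ _
    exact ((hb μ).continuous.mul (ch' _)).integrable_of_hasCompactSupport
      (HasCompactSupport.mul_left (hs.fderiv_apply (𝕜 := ℝ) _))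

variable (hN : IsOpen N) (hH : ContDiffOn ℝ 1 H (N ×ˢ univ)) (hK : IsCompact K)
    (h0 : ∀ v ∈ N, ∀ p ∉ K, H (v, p) = 0) (hu : u ∈ N)

include hN hH hK h0 hu in
lemma hasFDerivAt_integral_mul_coord (l : Fin (d + 1)) :
    ∃ L : EuclideanSpace ℝ (Fin (d + 1)) →L[ℝ] ℝ, HasFDerivAt (fun v ↦ ∫ p, H (v, p) * p l) L u ∧
      ∀ v, L v = ∫ p, p l * fderiv ℝ H (u, p) (v, 0) := by
  have hH' : ContDiffOn ℝ 1 (fun z : _ × _ ↦ H z * z.2 l) (N ×ˢ univ) :=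
    hH.mul (ContDiff.contDiffOn (by fun_prop))
  have h := hasFDerivAt_integral_of_compact (μ := volume) hN hH' hK
    (fun v hv p hp ↦ by simp [h0 v hv p hp]) hu
  refine ⟨_, h, fun v ↦ ?_⟩
  have hint : Integrable fun p ↦ (fderiv ℝ (fun z : _ × _ ↦ H z * z.2 l) (u, p)).comp
      (ContinuousLinearMap.inl ℝ _ _) := by
    refine Continuous.integrable_of_hasCompactSupport
      ((continuous_fderiv_slice hN hH' hu).clm_comp continuous_const)
      (HasCompactSupport.intro hK fun p hp ↦ ?_)
    rw [fderiv_eq_zero_of_notMem hN hK.isClosed hu (fun v hv p hp ↦ by simp [h0 v hv p hp]) hp]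
    simp
  rw [ContinuousLinearMap.integral_apply hint]
  congr 1 with p
  have hp : HasFDerivAt (fun z : EuclideanSpace ℝ (Fin (d + 1)) × EuclideanSpace ℝ (Fin (d + 1)) ↦
      z.2 l) ((EuclideanSpace.proj (𝕜 := ℝ) l).comp (ContinuousLinearMap.snd ℝ _ _)) (u, p) :=
    ((EuclideanSpace.proj (𝕜 := ℝ) l : EuclideanSpace ℝ (Fin (d + 1)) →L[ℝ] ℝ).hasFDerivAt).comp
      (u, p) hasFDerivAt_snd
  rw [((hasFDerivAt_of_slab hN hH hu p).fun_mul hp).fderiv]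
  simp

include hN hH hK h0 hu in
/-- The divergence of `w ∫ H p^μ dp`, for a density `w` with `∂_l w = Γ^μ_{μl} w`. -/
theorem divergence_integral {γ : Fin (d + 1) → Fin (d + 1) → Fin (d + 1) → ℝ}
    (hγ : ∀ μ α β, γ μ α β = γ μ β α) {w : EuclideanSpace ℝ (Fin (d + 1)) → ℝ}
    {w' : EuclideanSpace ℝ (Fin (d + 1)) →L[ℝ] ℝ} (hw : HasFDerivAt w w' u)
    (hw' : ∀ l, w' (EuclideanSpace.single l 1) = (∑ μ, γ μ μ l) * w u) :
    ∑ μ, (fderiv ℝ (fun v ↦ w v * ∫ p, H (v, p) * p μ) u (EuclideanSpace.single μ 1)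
      + ∑ l, γ μ μ l * (w u * ∫ p, H (u, p) * p l))
      = w u * ∫ p, fderiv ℝ H (u, p) (p, geodesicForce γ p) := by
  choose L hL hL' using hasFDerivAt_integral_mul_coord hN hH hK h0 hu
  have h1 (μ) : fderiv ℝ (fun v ↦ w v * ∫ p, H (v, p) * p μ) u (EuclideanSpace.single μ 1)
      = w u * (∫ p, p μ * fderiv ℝ H (u, p) (EuclideanSpace.single μ 1, 0))
        + (∑ l, γ l l μ) * w u * ∫ p, H (u, p) * p μ := by
    rw [(hw.fun_mul (hL μ)).fderiv]
    simp [hL', hw', mul_comm]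
  have hs : HasCompactSupport fun p ↦ H (u, p) :=
    HasCompactSupport.intro hK fun p hp ↦ h0 u hu p hp
  have hint (v) {b : EuclideanSpace ℝ (Fin (d + 1)) → ℝ} (hb : Continuous b) :
      Integrable fun p ↦ b p * fderiv ℝ H (u, p) v := by
    refine Continuous.integrable_of_hasCompactSupport
      (hb.mul ((continuous_fderiv_slice hN hH hu).clm_apply continuous_const))
      (HasCompactSupport.intro hK fun p hp ↦ ?_)
    rw [fderiv_eq_zero_of_notMem hN hK.isClosed hu h0 hp]
    simp
  have h2 : ∫ p, fderiv ℝ H (u, p) (p, geodesicForce γ p)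
      = ∑ μ, (∫ p, p μ * fderiv ℝ H (u, p) (EuclideanSpace.single μ 1, 0))
        + 2 * ∑ μ, ∑ l, γ μ μ l * ∫ p, H (u, p) * p l := by
    rw [← integral_geodesicForce hγ (contDiff_slice hH hu) hs]
    simp only [fderiv_slice hN hH hu]
    rw [← integral_finsetSum, ← integral_finsetSum, ← integral_add]
    · congr 1 with p
      exact fderiv_prod_eq_sum _ _ _
    · exact integrable_finsetSum _ fun μ _ ↦ hint _ (by fun_prop)
    · exact integrable_finsetSum _ fun μ _ ↦ hint _ (contDiff_geodesicForce γ μ).continuous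
    · exact fun μ _ ↦ hint _ (contDiff_geodesicForce γ μ).continuous
    · exact fun μ _ ↦ hint _ (by fun_prop)
  simp only [h1]
  rw [h2]
  simp only [Finset.sum_add_distrib, mul_add, Finset.mul_sum, Finset.sum_mul]
  -- Up to renaming indices, the contribution of the derivative of `w` equals the explicit
  -- Christoffel term. Together they account for the factor `2` in `h2`.
  have h3 : ∑ x, ∑ i, γ i i x * w u * ∫ p, H (u, p) * p x
      = ∑ x, ∑ i, γ x x i * (w u * ∫ p, H (u, p) * p i) := by
    rw [Finset.sum_comm]
    simp only [mul_assoc]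
  rw [h3, add_assoc, ← Finset.sum_add_distrib]
  congr 1
  refine Finset.sum_congr rfl fun μ _ ↦ ?_
  rw [← Finset.sum_add_distrib]
  refine Finset.sum_congr rfl fun l _ ↦ ?_
  ring

end LocalDivergence

/-! ### Charts of `M` and the adapted coordinates on the tangent bundle -/

section Coordinates

variable {d : ℕ} {M : Type*} [TopologicalSpace M]
  [ChartedSpace (EuclideanSpace ℝ (Fin (d + 1))) M]

/-- The isomorphism of `T_xM` with the coordinate space given by the chart around `x₀`. -/
def chartDiff (x₀ x : M) : TangentSpace (𝓡 (d + 1)) x →L[ℝ] EuclideanSpace ℝ (Fin (d + 1)) :=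
  mfderiv (𝓡 (d + 1)) 𝓘(ℝ, EuclideanSpace ℝ (Fin (d + 1))) (extChartAt (𝓡 (d + 1)) x₀) x

/-- The tangent vector with adapted coordinates `z = (x^μ, p^μ)` in the chart around `x₀`. -/
def liftPoint (x₀ : M) (z : EuclideanSpace ℝ (Fin (d + 1)) × EuclideanSpace ℝ (Fin (d + 1))) :
    TangentBundle (𝓡 (d + 1)) M :=
  ⟨(extChartAt (𝓡 (d + 1)) x₀).symm z.1,
    (chartDiff x₀ ((extChartAt (𝓡 (d + 1)) x₀).symm z.1)).inverse z.2⟩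

lemma coordForm_apply (x₀ x : M) (μ : Fin (d + 1)) (X : TangentSpace (𝓡 (d + 1)) x) :
    coordForm x₀ x μ X = chartDiff x₀ x X μ := rfl

lemma coordVec_eq (x₀ x : M) (μ : Fin (d + 1)) :
    coordVec x₀ x μ = (chartDiff x₀ x).inverse (EuclideanSpace.single μ 1) := rfl

lemma mem_chart_source_of_mem_target {x₀ : M} {u : EuclideanSpace ℝ (Fin (d + 1))}
    (hu : u ∈ (extChartAt (𝓡 (d + 1)) x₀).target) :
    (extChartAt (𝓡 (d + 1)) x₀).symm u
      ∈ (chartAt (EuclideanSpace ℝ (Fin (d + 1))) x₀).source := by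
  rw [← extChartAt_source (𝓡 (d + 1))]
  exact (extChartAt (𝓡 (d + 1)) x₀).map_target hu

variable [IsManifold (𝓡 (d + 1)) ∞ M]

lemma isInvertible_chartDiff {x₀ x : M} (hx : x ∈ (chartAt (EuclideanSpace ℝ (Fin (d + 1))) x₀).source) :
    (chartDiff (d := d) x₀ x).IsInvertible := by
  have : IsManifold (𝓡 (d + 1)) 1 M := .of_le (n := ∞) (by simp)
  exact isInvertible_mfderiv_extChartAt (by rwa [extChartAt_source])

lemma inverse_chartDiff_apply {x₀ x : M} (hx : x ∈ (chartAt (EuclideanSpace ℝ (Fin (d + 1))) x₀).source)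
    (X : TangentSpace (𝓡 (d + 1)) x) : (chartDiff x₀ x).inverse (chartDiff x₀ x X) = X := by
  obtain ⟨e, he⟩ := isInvertible_chartDiff hx
  rw [← he, ContinuousLinearMap.inverse_equiv]
  exact e.symm_apply_apply X

lemma chartDiff_inverse_apply {x₀ x : M} (hx : x ∈ (chartAt (EuclideanSpace ℝ (Fin (d + 1))) x₀).source)
    (p : EuclideanSpace ℝ (Fin (d + 1))) : chartDiff x₀ x ((chartDiff x₀ x).inverse p) = p := by
  obtain ⟨e, he⟩ := isInvertible_chartDiff hx
  rw [← he, ContinuousLinearMap.inverse_equiv]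
  exact e.apply_symm_apply p

lemma sum_smul_coordVec {x₀ x : M} (hx : x ∈ (chartAt (EuclideanSpace ℝ (Fin (d + 1))) x₀).source)
    (X : TangentSpace (𝓡 (d + 1)) x) : ∑ μ, chartDiff x₀ x X μ • coordVec x₀ x μ = X := by
  conv_rhs => rw [← inverse_chartDiff_apply hx X, ← sum_smul_single (chartDiff x₀ x X)]
  simp only [coordVec_eq, map_sum, map_smul]

/-- Over the chart domain, the trivialization of `TM` is the derivative of the chart. This
identifies the preferred charts of `TM` with the adapted coordinates in which `liouville` is
written. -/
lemma extChartAt_tangent_apply (v w : TangentBundle (𝓡 (d + 1)) M)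
    (hw : w.1 ∈ (chartAt (EuclideanSpace ℝ (Fin (d + 1))) v.1).source) :
    extChartAt (𝓡 (d + 1)).tangent v w
      = (extChartAt (𝓡 (d + 1)) v.1 w.1, chartDiff v.1 w.1 w.2) := by
  have : IsManifold (𝓡 (d + 1)) 1 M := .of_le (n := ∞) (by simp)
  rw [chartDiff, ← TangentBundle.continuousLinearMapAt_trivializationAt hw]
  rw [FiberBundle.extChartAt, PartialEquiv.trans_apply]
  refine Prod.ext rfl ?_
  rw [Bundle.Trivialization.continuousLinearMapAt_apply,
    Bundle.Trivialization.coe_linearMapAt_of_mem _ hw]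
  rfl

lemma liftPoint_chart {x₀ x : M} (hx : x ∈ (chartAt (EuclideanSpace ℝ (Fin (d + 1))) x₀).source)
    (X : TangentSpace (𝓡 (d + 1)) x) :
    liftPoint x₀ (extChartAt (𝓡 (d + 1)) x₀ x, chartDiff x₀ x X) = ⟨x, X⟩ := by
  have h : (extChartAt (𝓡 (d + 1)) x₀).symm (extChartAt (𝓡 (d + 1)) x₀ x) = x :=
    (extChartAt (𝓡 (d + 1)) x₀).left_inv (by rwa [extChartAt_source])
  -- The fibre component has a type depending on the base point, so the base point is generalized
  -- before it is substituted.
  have key : ∀ y, y = x → (⟨y, (chartDiff x₀ y).inverse (chartDiff x₀ x X)⟩ :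
      TangentBundle (𝓡 (d + 1)) M) = ⟨x, X⟩ := by
    rintro y rfl
    rw [inverse_chartDiff_apply hx]
  exact key _ h

lemma extChartAt_tangent_symm_eq (v : TangentBundle (𝓡 (d + 1)) M)
    {z : EuclideanSpace ℝ (Fin (d + 1)) × EuclideanSpace ℝ (Fin (d + 1))}
    (hz : z.1 ∈ (extChartAt (𝓡 (d + 1)) v.1).target) :
    (extChartAt (𝓡 (d + 1)).tangent v).symm z = liftPoint v.1 z := by
  have : IsManifold (𝓡 (d + 1)) 1 M := .of_le (n := ∞) (by simp)
  have hs := mem_chart_source_of_mem_target hz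
  have h1 : (liftPoint v.1 z : TangentBundle (𝓡 (d + 1)) M)
      ∈ (extChartAt (𝓡 (d + 1)).tangent v).source := by
    rw [extChartAt_source, TangentBundle.mem_chart_source_iff]
    exact hs
  rw [← (extChartAt (𝓡 (d + 1)).tangent v).left_inv h1, extChartAt_tangent_apply _ _ hs]
  congr 1
  refine Prod.ext ((extChartAt (𝓡 (d + 1)) v.1).right_inv hz).symm ?_
  exact (chartDiff_inverse_apply hs z.2).symm

lemma extChartAt_liftPoint (v : TangentBundle (𝓡 (d + 1)) M)
    {z : EuclideanSpace ℝ (Fin (d + 1)) × EuclideanSpace ℝ (Fin (d + 1))}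
    (hz : z.1 ∈ (extChartAt (𝓡 (d + 1)) v.1).target) :
    extChartAt (𝓡 (d + 1)).tangent v (liftPoint v.1 z) = z := by
  have hs := mem_chart_source_of_mem_target hz
  rw [extChartAt_tangent_apply _ _ hs]
  exact Prod.ext ((extChartAt (𝓡 (d + 1)) v.1).right_inv hz) (chartDiff_inverse_apply hs z.2)

lemma contMDiffOn_liftPoint (x₀ : M) :
    ContMDiffOn 𝓘(ℝ, EuclideanSpace ℝ (Fin (d + 1)) × EuclideanSpace ℝ (Fin (d + 1)))
      (𝓡 (d + 1)).tangent ∞ (liftPoint (d := d) x₀)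
      ((extChartAt (𝓡 (d + 1)) x₀).target ×ˢ univ) := by
  -- The adapted coordinates depend only on the base point, so any vector over `x₀` may serve as the
  -- centre of the chart of `TM`.
  let v : TangentBundle (𝓡 (d + 1)) M := ⟨x₀, 0⟩
  have h := contMDiffOn_extChartAt_symm (I := (𝓡 (d + 1)).tangent) (n := ∞) v
  refine (h.mono ?_).congr fun z hz ↦ (extChartAt_tangent_symm_eq v hz.1).symm
  intro z hz
  have h2 := (extChartAt (𝓡 (d + 1)).tangent v).map_source (x := liftPoint x₀ z) (by
    rw [extChartAt_source, TangentBundle.mem_chart_source_iff]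
    exact mem_chart_source_of_mem_target hz.1)
  rwa [show x₀ = v.1 from rfl, extChartAt_liftPoint v hz.1] at h2

/-- A function on the tangent bundle in the adapted coordinates of the chart around `x₀` has the
expected manifold derivative over `x₀`. -/
lemma mfderiv_eq_fderiv_liftPoint {h : TangentBundle (𝓡 (d + 1)) M → ℝ}
    (v : TangentBundle (𝓡 (d + 1)) M) (hh : MDifferentiableAt (𝓡 (d + 1)).tangent 𝓘(ℝ, ℝ) h v)
    (X : EuclideanSpace ℝ (Fin (d + 1)) × EuclideanSpace ℝ (Fin (d + 1))) :
    mfderiv (𝓡 (d + 1)).tangent 𝓘(ℝ, ℝ) h v X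
      = fderiv ℝ (h ∘ liftPoint v.1) (extChartAt (𝓡 (d + 1)) v.1 v.1, chartDiff v.1 v.1 v.2) X := by
  rw [hh.mfderiv, ← extChartAt_tangent_apply v v (mem_chart_source _ _)]
  change fderivWithin ℝ (writtenInExtChartAt (𝓡 (d + 1)).tangent 𝓘(ℝ, ℝ) v h)
    (range (𝓡 (d + 1)).tangent) (extChartAt (𝓡 (d + 1)).tangent v v) X = _
  rw [ModelWithCorners.range_eq_univ, fderivWithin_univ]
  congr 1
  apply Filter.EventuallyEq.fderiv_eq
  have hopen : IsOpen ((extChartAt (𝓡 (d + 1)) v.1).target ×ˢ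
      (univ : Set (EuclideanSpace ℝ (Fin (d + 1))))) := (isOpen_extChartAt_target v.1).prod isOpen_univ
  have hmem : extChartAt (𝓡 (d + 1)).tangent v v ∈ (extChartAt (𝓡 (d + 1)) v.1).target ×ˢ
      (univ : Set (EuclideanSpace ℝ (Fin (d + 1)))) := by
    rw [extChartAt_tangent_apply v v (mem_chart_source _ _)]
    exact ⟨mem_extChartAt_target _, mem_univ _⟩
  filter_upwards [hopen.mem_nhds hmem] with z hz
  simp only [writtenInExtChartAt, extChartAt_model_space_eq_id, Function.comp_apply,
    PartialEquiv.refl_coe, id_eq]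
  rw [extChartAt_tangent_symm_eq v hz.1]

/-! ### The metric in coordinates -/

lemma contMDiffOn_coordVec (x₀ : M) (μ : Fin (d + 1)) :
    ContMDiffOn (𝓡 (d + 1)) (𝓡 (d + 1)).tangent ∞
      (fun x ↦ (⟨x, coordVec x₀ x μ⟩ : TangentBundle (𝓡 (d + 1)) M))
      (chartAt (EuclideanSpace ℝ (Fin (d + 1))) x₀).source := by
  have h1 : ContMDiffOn (𝓡 (d + 1))
      𝓘(ℝ, EuclideanSpace ℝ (Fin (d + 1)) × EuclideanSpace ℝ (Fin (d + 1))) ∞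
      (fun x ↦ (extChartAt (𝓡 (d + 1)) x₀ x, EuclideanSpace.single μ (1 : ℝ)))
      (chartAt (EuclideanSpace ℝ (Fin (d + 1))) x₀).source :=
    contMDiffOn_extChartAt.prodMk_space contMDiffOn_const
  refine ((contMDiffOn_liftPoint x₀).comp h1 fun x hx ↦ ⟨?_, mem_univ _⟩).congr fun x hx ↦ ?_
  · exact (extChartAt (𝓡 (d + 1)) x₀).map_source (by rwa [extChartAt_source])
  · rw [Function.comp_apply, ← liftPoint_chart hx, coordVec_eq, chartDiff_inverse_apply hx]

lemma contDiffOn_coeff (g : LorentzMetric d M) (x₀ : M) (μ ν : Fin (d + 1)) :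
    ContDiffOn ℝ ∞ (fun u ↦ g.coeff x₀ ((extChartAt (𝓡 (d + 1)) x₀).symm u) μ ν)
      (extChartAt (𝓡 (d + 1)) x₀).target := by
  have h1 : ContMDiffOn (𝓡 (d + 1)) 𝓘(ℝ, ℝ) ∞ (fun x ↦ g.coeff x₀ x μ ν)
      (chartAt (EuclideanSpace ℝ (Fin (d + 1))) x₀).source := by
    have h := ContMDiffOn.clm_bundle_apply₂ (g.contMDiff.contMDiffOn
      (s := (chartAt (EuclideanSpace ℝ (Fin (d + 1))) x₀).source))
      (contMDiffOn_coordVec x₀ μ) (contMDiffOn_coordVec x₀ ν) (E₃ := Bundle.Trivial M ℝ) (F₃ := ℝ)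
    intro x hx
    exact ((Bundle.contMDiffWithinAt_totalSpace).1 (h x hx)).2
  rw [← contMDiffOn_iff_contDiffOn]
  exact h1.comp (contMDiffOn_extChartAt_symm x₀) fun u hu ↦ mem_chart_source_of_mem_target hu

lemma metric_eq_sum (g : LorentzMetric d M) {x₀ x : M}
    (hx : x ∈ (chartAt (EuclideanSpace ℝ (Fin (d + 1))) x₀).source)
    (X Y : TangentSpace (𝓡 (d + 1)) x) :
    g.val x X Y = ∑ μ, ∑ ν, g.coeff x₀ x μ ν * chartDiff x₀ x X μ * chartDiff x₀ x Y ν := by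
  conv_lhs => rw [← sum_smul_coordVec hx X, ← sum_smul_coordVec hx Y]
  simp only [map_sum, map_smul, sum_apply, smul_apply, smul_eq_mul, Finset.mul_sum,
    LorentzMetric.coeff]
  rw [Finset.sum_comm]
  refine Finset.sum_congr rfl fun μ _ ↦ Finset.sum_congr rfl fun ν _ ↦ ?_
  ring

lemma coeff_symm (g : LorentzMetric d M) (x₀ x : M) (μ ν : Fin (d + 1)) :
    g.coeff x₀ x μ ν = g.coeff x₀ x ν μ := g.symm _ _ _

/-- The components of `τ` are continuous functions of the coordinates. -/
lemma continuousOn_chartDiff_timeOrientation {g : LorentzMetric d M} (τ : TimeOrientation g)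
    (x₀ : M) : ContinuousOn (fun u ↦ chartDiff x₀ ((extChartAt (𝓡 (d + 1)) x₀).symm u)
      (τ.val ((extChartAt (𝓡 (d + 1)) x₀).symm u))) (extChartAt (𝓡 (d + 1)) x₀).target := by
  let v : TangentBundle (𝓡 (d + 1)) M := ⟨x₀, 0⟩
  have h1 := continuousOn_extChartAt (I := (𝓡 (d + 1)).tangent) v
  have h2 := τ.continuous.comp_continuousOn (continuousOn_extChartAt_symm (I := 𝓡 (d + 1)) x₀)
  have h3 := continuous_snd.comp_continuousOn (h1.comp h2 fun u hu ↦ by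
    rw [extChartAt_source, TangentBundle.mem_chart_source_iff]
    exact mem_chart_source_of_mem_target hu)
  refine h3.congr fun u hu ↦ ?_
  simp only [Function.comp_apply]
  rw [extChartAt_tangent_apply v _ (mem_chart_source_of_mem_target hu)]

end Coordinates

section Metric

variable {d : ℕ} {M : Type*} [TopologicalSpace M]
  [ChartedSpace (EuclideanSpace ℝ (Fin (d + 1))) M] [IsManifold (𝓡 (d + 1)) ∞ M]

/-! ### Frames and determinants -/

/-- The components of an inertial frame in the chart around `x₀`. -/
def InertialFrame.matrix {g : LorentzMetric d M} {τ : TimeOrientation g} {x : M}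
    (e : InertialFrame g τ x) (x₀ : M) : Matrix (Fin (d + 1)) (Fin (d + 1)) ℝ :=
  fun μ i ↦ chartDiff x₀ x (e.basis i) μ

/-- Take determinants in `Eᵀ G E = diag(-1, 1, …, 1)`. -/
lemma InertialFrame.det_sq_mul {g : LorentzMetric d M} {τ : TimeOrientation g} {x : M}
    (e : InertialFrame g τ x) {x₀ : M}
    (hx : x ∈ (chartAt (EuclideanSpace ℝ (Fin (d + 1))) x₀).source) :
    (e.matrix x₀).det ^ 2 * (g.coeff x₀ x).det = -1 := by
  have h : (e.matrix x₀).transpose * g.coeff x₀ x * e.matrix x₀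
      = Matrix.diagonal fun i ↦ if i = 0 then -1 else 1 := by
    ext i j
    have := e.orthonormal i j
    rw [metric_eq_sum g hx] at this
    rw [Matrix.diagonal_apply, ← this]
    simp only [Matrix.mul_apply, Matrix.transpose_apply, Finset.sum_mul, InertialFrame.matrix]
    rw [Finset.sum_comm]
    refine Finset.sum_congr rfl fun μ _ ↦ Finset.sum_congr rfl fun ν _ ↦ ?_
    ring
  have h2 := congrArg Matrix.det h
  rw [Matrix.det_mul, Matrix.det_mul, Matrix.det_transpose, Matrix.det_diagonal,
    Fin.prod_univ_succ] at h2
  simp only [if_true, Fin.succ_ne_zero, if_false, Finset.prod_const_one, mul_one] at h2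
  linarith

lemma det_coeff_neg (g : LorentzMetric d M) (τ : TimeOrientation g) {x₀ x : M}
    (hx : x ∈ (chartAt (EuclideanSpace ℝ (Fin (d + 1))) x₀).source) :
    (g.coeff x₀ x).det < 0 := by
  have h := (inertialFrame g τ x).det_sq_mul hx
  by_contra hcon
  nlinarith [mul_nonneg (sq_nonneg ((inertialFrame g τ x).matrix x₀).det) (not_lt.1 hcon)]

/-- The Jacobian of the passage to inertial components cancels against `√(-det g)`: this removes the
chosen frame from the fibre integrals. -/
lemma InertialFrame.sqrt_mul_abs_det {g : LorentzMetric d M} {τ : TimeOrientation g} {x : M}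
    (e : InertialFrame g τ x) {x₀ : M}
    (hx : x ∈ (chartAt (EuclideanSpace ℝ (Fin (d + 1))) x₀).source) :
    √(-(g.coeff x₀ x).det) * |(e.matrix x₀).det| = 1 := by
  have h := e.det_sq_mul hx
  rw [← Real.sqrt_sq_eq_abs, ← Real.sqrt_mul (by linarith [det_coeff_neg g τ hx])]
  rw [show -(g.coeff x₀ x).det * (e.matrix x₀).det ^ 2 = 1 by linarith, Real.sqrt_one]

/-! ### The time orientation in an inertial frame -/

lemma metric_frameVec (g : LorentzMetric d M) (τ : TimeOrientation g) {x : M}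
    (e : InertialFrame g τ x) (z w : ℝ × EuclideanSpace ℝ (Fin d)) :
    g.val x (frameVec e.basis z) (frameVec e.basis w) = -(z.1 * w.1) + inner ℝ z.2 w.2 := by
  have r0 (z : ℝ × EuclideanSpace ℝ (Fin d)) : e.basis.repr (frameVec e.basis z) 0 = z.1 := by
    simp [frameVec]
  have rs (z : ℝ × EuclideanSpace ℝ (Fin d)) (i : Fin d) :
      e.basis.repr (frameVec e.basis z) i.succ = z.2 i := by
    simp [frameVec, Finsupp.single_apply]
  rw [metric_eq_of_basis g x e.basis e.orthonormal]
  simp only [r0, rs, PiLp.inner_apply, RCLike.inner_apply, conj_trivial]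
  congr 1
  exact Finset.sum_congr rfl fun i _ ↦ mul_comm _ _

/-- The components of a tangent vector in an inertial frame. -/
def InertialFrame.comp {g : LorentzMetric d M} {τ : TimeOrientation g} {x : M}
    (e : InertialFrame g τ x) (X : TangentSpace (𝓡 (d + 1)) x) : ℝ × EuclideanSpace ℝ (Fin d) :=
  (e.basis.repr X 0, WithLp.toLp 2 fun i ↦ e.basis.repr X i.succ)

lemma InertialFrame.frameVec_comp {g : LorentzMetric d M} {τ : TimeOrientation g} {x : M}
    (e : InertialFrame g τ x) (X : TangentSpace (𝓡 (d + 1)) x) :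
    frameVec e.basis (e.comp X) = X := by
  conv_rhs => rw [← e.basis.sum_repr X, Fin.sum_univ_succ]
  rfl

lemma InertialFrame.chartDiff_frameVec {g : LorentzMetric d M} {τ : TimeOrientation g} {x : M}
    (e : InertialFrame g τ x) (x₀ : M) (z : ℝ × EuclideanSpace ℝ (Fin d)) :
    chartDiff x₀ x (frameVec e.basis z)
      = frameVec (fun i ↦ WithLp.toLp 2 fun μ ↦ e.matrix x₀ μ i) z := by
  simp only [frameVec, map_add, map_sum, map_smul]
  rfl

/-- In frame components `t` of `τ`, timelikeness together with the future direction of `e_0` gives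
`‖t.2‖ < t.1`; then Cauchy–Schwarz for the spatial parts yields the sign. -/
lemma metric_timeOrientation_neg {g : LorentzMetric d M} {τ : TimeOrientation g} {x : M}
    (e : InertialFrame g τ x) {z : ℝ × EuclideanSpace ℝ (Fin d)} (hz : ‖z.2‖ < z.1) :
    g.val x (frameVec e.basis z) (τ.val x) < 0 := by
  have h1 := τ.timelike x
  have h2 := e.future
  rw [← e.frameVec_comp (τ.val x)] at h1 h2 ⊢
  rw [show e.basis 0 = frameVec e.basis (1, 0) by simp [frameVec]] at h2
  rw [metric_frameVec] at h1 h2 ⊢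
  set t := e.comp (τ.val x)
  rw [real_inner_self_eq_norm_sq] at h1
  simp only [inner_zero_left, one_mul, add_zero] at h2
  have h3 : ‖t.2‖ < t.1 := by nlinarith [norm_nonneg t.2]
  have h4 := real_inner_le_norm z.2 t.2
  nlinarith [norm_nonneg t.2, norm_nonneg z.2]

lemma metric_timeOrientation_pos {g : LorentzMetric d M} {τ : TimeOrientation g} {x : M}
    (e : InertialFrame g τ x) {z : ℝ × EuclideanSpace ℝ (Fin d)} (hz : z.1 < -‖z.2‖) :
    0 < g.val x (frameVec e.basis z) (τ.val x) := by
  have h := metric_timeOrientation_neg e (z := -z) (by simpa using by linarith)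
  rw [show frameVec e.basis (-z) = -frameVec e.basis z by
    simp [frameVec, Finset.sum_neg_distrib, add_comm]] at h
  simpa using h

/-- A timelike vector is not orthogonal to the time orientation. -/
lemma metric_timeOrientation_ne_zero {g : LorentzMetric d M} (τ : TimeOrientation g) {x : M}
    {X : TangentSpace (𝓡 (d + 1)) x} (hX : g.val x X X < 0) : g.val x X (τ.val x) ≠ 0 := by
  let e := inertialFrame g τ x
  rw [← e.frameVec_comp X] at hX ⊢
  rw [metric_frameVec, real_inner_self_eq_norm_sq] at hX
  rcases lt_or_ge ‖(e.comp X).2‖ (e.comp X).1 with h | h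
  · exact (metric_timeOrientation_neg e h).ne
  · refine (metric_timeOrientation_pos e ?_).ne'
    nlinarith [norm_nonneg (e.comp X).2]

/-! ### Fibre integrals in coordinates -/

/-- The constant of `exists_integral_eq_frameVec`. -/
def frameConstant (d : ℕ) : ℝ := (exists_integral_eq_frameVec d).choose

/-- Up to a universal constant, the integral over the mass hyperboloid of `φ` is the integral over
the solid future cone of a function that is a product of `φ` and a function of the scale. -/
theorem sqrt_mul_integral_eq_fibreIntegral {g : LorentzMetric d M} {τ : TimeOrientation g} {m : ℝ}
    (hm : 0 < m) {x₀ x : M} (hx : x ∈ (chartAt (EuclideanSpace ℝ (Fin (d + 1))) x₀).source)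
    (κ : ℝ → ℝ) (ψ : EuclideanSpace ℝ (Fin (d + 1)) → ℝ) (φ : massHyperboloid g τ m x → ℝ)
    (h0 : ∀ X : TangentSpace (𝓡 (d + 1)) x, ¬(g.val x X X < 0 ∧ g.val x X (τ.val x) < 0) →
      ψ (chartDiff x₀ x X) = 0)
    (h1 : ∀ l, 0 < l → ∀ p : massHyperboloid g τ m x, ψ (l • chartDiff x₀ x p.1) = κ l * φ p) :
    √(-(g.coeff x₀ x).det) * ∫ p, ψ p
      = frameConstant d * (∫ l in Ioi 0, m ^ 2 * l ^ d * κ l) * fibreIntegral hm x φ := by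
  have H := (exists_integral_eq_frameVec d).choose_spec.2
  let e := inertialFrame g τ x
  have hdet := e.sqrt_mul_abs_det hx
  have hA : (e.matrix x₀).det ≠ 0 := by
    intro h
    rw [h] at hdet
    simp at hdet
  have hf := e.chartDiff_frameVec x₀
  rw [H _ hA]
  simp only [← hf]
  rw [integral_cone hm _ κ
    (fun k ↦ φ ⟨e.point m k, e.point_mem hm k⟩)]
  · rw [finrank_euclideanSpace_fin]
    change _ * (frameConstant d * _ * _) = frameConstant d * _ * ∫ k : EuclideanSpace ℝ (Fin d),
      φ ⟨e.point m k, e.point_mem hm k⟩ / √(m ^ 2 + ‖k‖ ^ 2)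
    linear_combination (frameConstant d * (∫ l in Ioi 0, m ^ 2 * l ^ d * κ l) *
      ∫ k : EuclideanSpace ℝ (Fin d), φ ⟨e.point m k, e.point_mem hm k⟩ / √(m ^ 2 + ‖k‖ ^ 2)) * hdet
  · intro z hz
    -- A timelike point outside the solid future cone lies in the past cone, where the pairing with
    -- `τ` is positive.
    refine h0 _ fun ⟨h2, h3⟩ ↦ ?_
    rw [metric_frameVec, real_inner_self_eq_norm_sq] at h2
    refine h3.not_gt (metric_timeOrientation_pos e ?_)
    nlinarith [norm_nonneg z.2]
  · intro l hl k
    rw [← h1 l hl, ← map_smul]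
    congr 2
    simp [frameVec, conePolar, InertialFrame.point, smul_smul, Finset.smul_sum]

/-- Continuity of `Φ` is required only on the hyperboloid, because ray extensions are regular only
inside the open cone. -/
lemma fibreIntegrable_of_continuousAt {g : LorentzMetric d M} {τ : TimeOrientation g} {m : ℝ}
    (hm : 0 < m) {x₀ x : M} (hx : x ∈ (chartAt (EuclideanSpace ℝ (Fin (d + 1))) x₀).source)
    {φ : massHyperboloid g τ m x → ℝ} {Φ : EuclideanSpace ℝ (Fin (d + 1)) → ℝ}
    (hφ : ∀ p : massHyperboloid g τ m x, φ p = Φ (chartDiff x₀ x p.1))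
    (hΦ : ∀ p ∈ massHyperboloid g τ m x, ContinuousAt Φ (chartDiff x₀ x p)) {R : ℝ}
    (hR : ∀ p ∈ massHyperboloid g τ m x, R < ‖chartDiff x₀ x p‖ → Φ (chartDiff x₀ x p) = 0) :
    FibreIntegrable hm x φ := by
  let e := inertialFrame g τ x
  have hcont : Continuous fun k : EuclideanSpace ℝ (Fin d) ↦ chartDiff x₀ x (e.point m k) := by
    simp only [InertialFrame.point, map_add, map_smul, map_sum]
    fun_prop
  have h1 : Continuous fun k : EuclideanSpace ℝ (Fin d) ↦
      Φ (chartDiff x₀ x (e.point m k)) / √(m ^ 2 + ‖k‖ ^ 2) := by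
    refine Continuous.div ?_ (by fun_prop) fun k ↦ by positivity
    rw [continuous_iff_continuousAt]
    exact fun k ↦ (hΦ _ (e.point_mem hm k)).comp (f := fun k ↦ chartDiff x₀ x (e.point m k))
      hcont.continuousAt
  -- The spatial part `k` is a linear function of the chart components of `p`, so a bound on the
  -- latter bounds `k`.
  let T : EuclideanSpace ℝ (Fin (d + 1)) →ₗ[ℝ] EuclideanSpace ℝ (Fin d) :=
    { toFun := fun p ↦ (e.comp ((chartDiff x₀ x).inverse p)).2
      map_add' := fun p q ↦ by ext; simp [InertialFrame.comp]
      map_smul' := fun c p ↦ by ext; simp [InertialFrame.comp] }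
  have hT (k) : T (chartDiff x₀ x (e.point m k)) = k := by
    change (e.comp ((chartDiff x₀ x).inverse (chartDiff x₀ x (e.point m k)))).2 = k
    rw [inverse_chartDiff_apply hx]
    ext i
    simp [InertialFrame.comp, InertialFrame.point, Finsupp.single_apply]
  have h2 : HasCompactSupport fun k : EuclideanSpace ℝ (Fin d) ↦
      Φ (chartDiff x₀ x (e.point m k)) / √(m ^ 2 + ‖k‖ ^ 2) := by
    refine HasCompactSupport.intro
      (isCompact_closedBall 0 (‖T.toContinuousLinearMap‖ * R)) fun k hk ↦ ?_
    rw [hR _ (e.point_mem hm k), zero_div]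
    by_contra hcon
    apply hk
    rw [mem_closedBall_zero_iff]
    calc ‖k‖ = ‖T.toContinuousLinearMap (chartDiff x₀ x (e.point m k))‖ := by
          rw [LinearMap.coe_toContinuousLinearMap', hT]
      _ ≤ ‖T.toContinuousLinearMap‖ * ‖chartDiff x₀ x (e.point m k)‖ :=
          ContinuousLinearMap.le_opNorm _ _
      _ ≤ _ := by gcongr; exact not_lt.1 hcon
  refine (h1.integrable_of_hasCompactSupport h2).congr (Filter.Eventually.of_forall fun k ↦ ?_)
  simp only [hφ]
  rfl

/-! ### Christoffel symbols -/

/-- The derivatives `∂_α g_{σβ}` at `x` in the chart around `x`. -/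
def LorentzMetric.coeffDeriv (g : LorentzMetric d M) (x : M) (α σ β : Fin (d + 1)) : ℝ :=
  partialDeriv x α (fun y ↦ g.coeff x y σ β) x

lemma coeffDeriv_symm (g : LorentzMetric d M) (x : M) (α σ β : Fin (d + 1)) :
    g.coeffDeriv x α σ β = g.coeffDeriv x α β σ := by
  simp only [LorentzMetric.coeffDeriv, coeff_symm g x _ σ β]

lemma christoffel_eq (g : LorentzMetric d M) (x : M) (μ α β : Fin (d + 1)) :
    g.christoffel x x μ α β = (1 / 2) * ∑ σ, (g.coeff x x)⁻¹ μ σ *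
      (g.coeffDeriv x α σ β + g.coeffDeriv x β σ α - g.coeffDeriv x σ α β) := rfl

lemma christoffel_symm (g : LorentzMetric d M) (x : M) (μ α β : Fin (d + 1)) :
    g.christoffel x x μ α β = g.christoffel x x μ β α := by
  rw [christoffel_eq, christoffel_eq]
  congr 1
  refine Finset.sum_congr rfl fun σ _ ↦ ?_
  rw [coeffDeriv_symm g x σ α β]
  ring

lemma coeff_mul_christoffel (g : LorentzMetric d M) (τ : TimeOrientation g) (x : M)
    (ρ α β : Fin (d + 1)) :
    ∑ μ, g.coeff x x ρ μ * g.christoffel x x μ α β = (1 / 2) *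
      (g.coeffDeriv x α ρ β + g.coeffDeriv x β ρ α - g.coeffDeriv x ρ α β) := by
  have hdet := (det_coeff_neg g τ (mem_chart_source (EuclideanSpace ℝ (Fin (d + 1))) x)).ne
  simp only [christoffel_eq]
  set S : Fin (d + 1) → ℝ := fun σ ↦
    g.coeffDeriv x α σ β + g.coeffDeriv x β σ α - g.coeffDeriv x σ α β
  have h : (g.coeff x x).mulVec ((g.coeff x x)⁻¹.mulVec S) = S := by
    rw [Matrix.mulVec_mulVec, Matrix.mul_nonsing_inv _ (isUnit_iff_ne_zero.2 hdet),
      Matrix.one_mulVec]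
  have h2 := congrFun h ρ
  simp only [Matrix.mulVec, dotProduct] at h2
  change _ = 1 / 2 * S ρ
  rw [← h2, Finset.mul_sum]
  refine Finset.sum_congr rfl fun μ _ ↦ ?_
  simp only [S]
  ring

lemma hasFDerivAt_coeff (g : LorentzMetric d M) (x₀ : M) {u : EuclideanSpace ℝ (Fin (d + 1))}
    (hu : u ∈ (extChartAt (𝓡 (d + 1)) x₀).target) (μ ν : Fin (d + 1)) :
    HasFDerivAt (fun u ↦ g.coeff x₀ ((extChartAt (𝓡 (d + 1)) x₀).symm u) μ ν)
      (fderiv ℝ (fun u ↦ g.coeff x₀ ((extChartAt (𝓡 (d + 1)) x₀).symm u) μ ν) u) u :=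
  (((contDiffOn_coeff g x₀ μ ν).contDiffAt
    ((isOpen_extChartAt_target x₀).mem_nhds hu)).differentiableAt (by simp)).hasFDerivAt

/-- `∂_l √(-det g) = Γ^μ_{μl} √(-det g)`. -/
lemma hasFDerivAt_sqrt_det (g : LorentzMetric d M) (τ : TimeOrientation g) (x : M) :
    ∃ w' : EuclideanSpace ℝ (Fin (d + 1)) →L[ℝ] ℝ,
      HasFDerivAt (fun u ↦ √(-(g.coeff x ((extChartAt (𝓡 (d + 1)) x).symm u)).det)) w'
        (extChartAt (𝓡 (d + 1)) x x) ∧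
      ∀ l, w' (EuclideanSpace.single l 1)
        = (∑ μ, g.christoffel x x μ μ l) * √(-(g.coeff x x).det) := by
  have hdet := det_coeff_neg g τ (mem_chart_source (EuclideanSpace ℝ (Fin (d + 1))) x)
  have hxx : (extChartAt (𝓡 (d + 1)) x).symm (extChartAt (𝓡 (d + 1)) x x) = x :=
    extChartAt_to_inv x
  have h1 := hasFDerivAt_det (G := fun u ↦ g.coeff x ((extChartAt (𝓡 (d + 1)) x).symm u))
    (fun μ ν ↦ hasFDerivAt_coeff g x (mem_extChartAt_target x) μ ν) (by rw [hxx]; exact hdet.ne)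
  have h2 := h1.neg.sqrt (by simp only [Pi.neg_apply]; rw [hxx]; linarith)
  refine ⟨_, h2, fun l ↦ ?_⟩
  have hd (i j : Fin (d + 1)) :
      fderiv ℝ (fun u ↦ g.coeff x ((extChartAt (𝓡 (d + 1)) x).symm u) i j)
        (extChartAt (𝓡 (d + 1)) x x) (EuclideanSpace.single l 1) = g.coeffDeriv x l i j := rfl
  simp only [smul_apply, neg_apply, sum_apply, hd, smul_eq_mul, Pi.neg_apply]
  rw [hxx]
  set D := (g.coeff x x).det with hD
  have hsq : √(-D) ^ 2 = -D := Real.sq_sqrt (by linarith)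
  have hpos : 0 < √(-D) := Real.sqrt_pos.2 (by linarith)
  have hinv (i j) : (g.coeff x x)⁻¹ i j = (g.coeff x x)⁻¹ j i := by
    have : (g.coeff x x).transpose = g.coeff x x := by
      ext i j; exact coeff_symm g x x _ _
    conv_lhs => rw [← this, ← Matrix.transpose_nonsing_inv]
    rfl
  have htr : ∑ μ, g.christoffel x x μ μ l
      = (1 / 2) * ∑ i, ∑ j, (g.coeff x x)⁻¹ i j * g.coeffDeriv x l j i := by
    simp only [christoffel_eq]
    rw [← Finset.mul_sum]
    congr 1
    -- In the trace of the Christoffel symbols, two of the three derivative terms cancel because the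
    -- inverse metric is symmetric. The remaining one is the trace in Jacobi's formula.
    have : ∑ i, ∑ σ, (g.coeff x x)⁻¹ i σ * g.coeffDeriv x i σ l
        = ∑ i, ∑ σ, (g.coeff x x)⁻¹ i σ * g.coeffDeriv x σ i l := by
      rw [Finset.sum_comm]
      simp only [hinv]
    simp only [mul_add, mul_sub, Finset.sum_add_distrib, Finset.sum_sub_distrib]
    rw [this]
    ring
  rw [htr]
  field_simp
  rw [hsq]
  ring

end Metric

section RayExtension

variable {d : ℕ} {M : Type*} [TopologicalSpace M]
  [ChartedSpace (EuclideanSpace ℝ (Fin (d + 1))) M] [IsManifold (𝓡 (d + 1)) ∞ M]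
  {g : LorentzMetric d M} {τ : TimeOrientation g} {m : ℝ}

/-! ### The ray extension -/

open Classical in
/-- The extension by zero of a function on the mass shell. -/
def zeroExtension (f : massShell g τ m → ℝ) (v : TangentBundle (𝓡 (d + 1)) M) : ℝ :=
  if hv : v ∈ massShell g τ m then f ⟨v, hv⟩ else 0

/-- `zeroExtension` is a function of the tangent vector alone, so the rescaled vector can be
rewritten without carrying a membership proof. -/
lemma rayExtension_apply (f : massShell g τ m → ℝ) (x : M) (X : TangentSpace (𝓡 (d + 1)) x) :
    rayExtension f ⟨x, X⟩ = zeroExtension f ⟨x, (m / √(-g.val x X X)) • X⟩ := rfl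

lemma rayExtension_smul (f : massShell g τ m → ℝ) (x : M) (X : TangentSpace (𝓡 (d + 1)) x)
    {l : ℝ} (hl : 0 < l) : rayExtension f ⟨x, l • X⟩ = rayExtension f ⟨x, X⟩ := by
  have h : (m / √(-g.val x (l • X) (l • X))) • (l • X) = (m / √(-g.val x X X)) • X := by
    have : -g.val x (l • X) (l • X) = l ^ 2 * -g.val x X X := by
      simp only [map_smul, smul_apply, smul_eq_mul]; ring
    rw [this, Real.sqrt_mul (by positivity), Real.sqrt_sq hl.le, smul_smul]
    congr 1
    rw [div_mul_eq_div_div_swap, div_mul_cancel₀ _ hl.ne']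
  rw [rayExtension_apply, rayExtension_apply, h]

lemma rayExtension_of_mem (hm : 0 < m) (f : massShell g τ m → ℝ) (v : massShell g τ m) :
    rayExtension f v.1 = f v := by
  obtain ⟨⟨x, X⟩, hv⟩ := v
  have h : (m / √(-g.val x X X)) • X = X := by
    rw [hv.1, neg_neg, Real.sqrt_sq hm.le, div_self hm.ne', one_smul]
  rw [rayExtension_apply, h, zeroExtension, dif_pos hv]

lemma rayExtension_eq_zero (hm : 0 < m) (f : massShell g τ m → ℝ) {x : M}
    {X : TangentSpace (𝓡 (d + 1)) x} (hX : ¬(g.val x X X < 0 ∧ g.val x X (τ.val x) < 0)) :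
    rayExtension f ⟨x, X⟩ = 0 := by
  rw [rayExtension_apply, zeroExtension, dif_neg]
  -- Only `c ≥ 0` matters from here on. If `X` is not timelike, the root is `0` and the quotient is
  -- `0` by convention; this case needs no separate treatment.
  have hc : 0 ≤ m / √(-g.val x X X) := by positivity
  generalize m / √(-g.val x X X) = c at hc
  rintro ⟨h1, h2⟩
  apply hX
  have h1' : c * (c * g.val x X X) = -m ^ 2 := by
    simpa only [map_smul, smul_apply, smul_eq_mul] using h1
  have h2' : c * g.val x X (τ.val x) < 0 := by
    simpa only [map_smul, smul_apply, smul_eq_mul] using h2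
  constructor
  · by_contra hcon
    nlinarith [mul_nonneg (mul_nonneg hc hc) (not_lt.1 hcon), sq_pos_of_pos hm]
  · by_contra hcon
    nlinarith [mul_nonneg hc (not_lt.1 hcon)]

/-- A future-directed timelike vector is a positive multiple of a vector of mass `m`. -/
lemma exists_eq_smul_massHyperboloid (hm : 0 < m) {x : M} {X : TangentSpace (𝓡 (d + 1)) x}
    (h1 : g.val x X X < 0) (h2 : g.val x X (τ.val x) < 0) :
    ∃ l, 0 < l ∧ l ^ 2 = -g.val x X X / m ^ 2 ∧ ∃ p ∈ massHyperboloid g τ m x, X = l • p := by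
  set l := √(-g.val x X X) / m
  have hs : 0 < √(-g.val x X X) := Real.sqrt_pos.2 (by linarith)
  have hl : 0 < l := by positivity
  have hl2 : l ^ 2 = -g.val x X X / m ^ 2 := by
    rw [div_pow, Real.sq_sqrt (by linarith)]
  refine ⟨l, hl, hl2, l⁻¹ • X, ⟨?_, ?_⟩, by rw [smul_smul, mul_inv_cancel₀ hl.ne', one_smul]⟩
  · simp only [map_smul, smul_apply, smul_eq_mul]
    rw [← mul_assoc, ← mul_inv, ← sq, hl2]
    field_simp
    rw [div_self h1.ne]
  · simp only [map_smul, smul_apply, smul_eq_mul]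
    exact mul_neg_of_pos_of_neg (by positivity) h2

/-- The ray extension in the adapted coordinates of the chart around `x₀`. -/
def localRep (f : massShell g τ m → ℝ) (x₀ : M)
    (z : EuclideanSpace ℝ (Fin (d + 1)) × EuclideanSpace ℝ (Fin (d + 1))) : ℝ :=
  rayExtension f (liftPoint x₀ z)

lemma localRep_smul (f : massShell g τ m → ℝ) (x₀ : M) (u p : EuclideanSpace ℝ (Fin (d + 1)))
    {l : ℝ} (hl : 0 < l) : localRep f x₀ (u, l • p) = localRep f x₀ (u, p) := by
  simp only [localRep, liftPoint, map_smul]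
  exact rayExtension_smul f _ _ hl

/-- Chain rule for the fibre dilation, under which `localRep` is invariant. The dilation is a linear
equivalence, so no differentiability of `localRep` is needed. The vertical direction is dilated
together with the base point. -/
lemma fderiv_localRep_smul (f : massShell g τ m → ℝ) (x₀ : M)
    (u p a b : EuclideanSpace ℝ (Fin (d + 1))) {l : ℝ} (hl : 0 < l) :
    fderiv ℝ (localRep f x₀) (u, l • p) (a, l • b) = fderiv ℝ (localRep f x₀) (u, p) (a, b) := by
  let S : (EuclideanSpace ℝ (Fin (d + 1)) × EuclideanSpace ℝ (Fin (d + 1))) ≃L[ℝ]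
      EuclideanSpace ℝ (Fin (d + 1)) × EuclideanSpace ℝ (Fin (d + 1)) :=
    (ContinuousLinearEquiv.refl ℝ _).prodCongr (ContinuousLinearEquiv.smulLeft (Units.mk0 l hl.ne'))
  have hS (z) : S z = (z.1, l • z.2) := rfl
  have h : localRep f x₀ ∘ S = localRep f x₀ := by
    ext z
    rw [Function.comp_apply, hS, localRep_smul f x₀ _ _ hl]
  have h2 := S.comp_right_fderiv (f := localRep f x₀) (x := (u, p))
  rw [h] at h2
  rw [h2]
  rfl

/-! ### The cone of future-directed timelike vectors in coordinates -/

/-- The function `g_{μν}(x) p^μ p^ν` in the adapted coordinates of the chart around `x₀`. -/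
def localNorm (g : LorentzMetric d M) (x₀ : M)
    (z : EuclideanSpace ℝ (Fin (d + 1)) × EuclideanSpace ℝ (Fin (d + 1))) : ℝ :=
  ∑ μ, ∑ ν, g.coeff x₀ ((extChartAt (𝓡 (d + 1)) x₀).symm z.1) μ ν * z.2 μ * z.2 ν

/-- The function `g_{μν}(x) p^μ τ^ν` in the adapted coordinates of the chart around `x₀`. -/
def localTime (τ : TimeOrientation g) (x₀ : M)
    (z : EuclideanSpace ℝ (Fin (d + 1)) × EuclideanSpace ℝ (Fin (d + 1))) : ℝ :=
  ∑ μ, ∑ ν, g.coeff x₀ ((extChartAt (𝓡 (d + 1)) x₀).symm z.1) μ ν * z.2 μ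
    * chartDiff x₀ ((extChartAt (𝓡 (d + 1)) x₀).symm z.1)
      (τ.val ((extChartAt (𝓡 (d + 1)) x₀).symm z.1)) ν

/-- The future-directed timelike vectors in the adapted coordinates of the chart around `x₀`. -/
def localCone (τ : TimeOrientation g) (x₀ : M) :
    Set (EuclideanSpace ℝ (Fin (d + 1)) × EuclideanSpace ℝ (Fin (d + 1))) :=
  {z | z.1 ∈ (extChartAt (𝓡 (d + 1)) x₀).target ∧ localNorm g x₀ z < 0 ∧ localTime τ x₀ z < 0}

variable {x₀ : M} {u p : EuclideanSpace ℝ (Fin (d + 1))}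

lemma localNorm_chartDiff (hu : u ∈ (extChartAt (𝓡 (d + 1)) x₀).target)
    (X : TangentSpace (𝓡 (d + 1)) ((extChartAt (𝓡 (d + 1)) x₀).symm u)) :
    localNorm g x₀ (u, chartDiff x₀ _ X) = g.val _ X X :=
  (metric_eq_sum g (mem_chart_source_of_mem_target hu) X X).symm

lemma localTime_chartDiff (hu : u ∈ (extChartAt (𝓡 (d + 1)) x₀).target)
    (X : TangentSpace (𝓡 (d + 1)) ((extChartAt (𝓡 (d + 1)) x₀).symm u)) :
    localTime τ x₀ (u, chartDiff x₀ _ X) = g.val _ X (τ.val _) :=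
  (metric_eq_sum g (mem_chart_source_of_mem_target hu) X (τ.val _)).symm

lemma localRep_chartDiff (f : massShell g τ m → ℝ) (hu : u ∈ (extChartAt (𝓡 (d + 1)) x₀).target)
    (X : TangentSpace (𝓡 (d + 1)) ((extChartAt (𝓡 (d + 1)) x₀).symm u)) :
    localRep f x₀ (u, chartDiff x₀ _ X) = rayExtension f ⟨_, X⟩ := by
  simp only [localRep, liftPoint]
  rw [inverse_chartDiff_apply (mem_chart_source_of_mem_target hu)]

lemma exists_chartDiff_eq (hu : u ∈ (extChartAt (𝓡 (d + 1)) x₀).target)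
    (p : EuclideanSpace ℝ (Fin (d + 1))) :
    ∃ X : TangentSpace (𝓡 (d + 1)) ((extChartAt (𝓡 (d + 1)) x₀).symm u),
      chartDiff x₀ _ X = p :=
  ⟨_, chartDiff_inverse_apply (mem_chart_source_of_mem_target hu) p⟩

lemma localRep_eq_zero (hm : 0 < m) (f : massShell g τ m → ℝ)
    (hu : u ∈ (extChartAt (𝓡 (d + 1)) x₀).target) (h : (u, p) ∉ localCone τ x₀) :
    localRep f x₀ (u, p) = 0 := by
  obtain ⟨X, rfl⟩ := exists_chartDiff_eq hu p
  rw [localRep_chartDiff f hu]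
  apply rayExtension_eq_zero hm
  rwa [localCone, mem_ofPred_eq, localNorm_chartDiff hu, localTime_chartDiff hu,
    and_iff_right hu] at h

lemma localTime_ne_zero (hu : u ∈ (extChartAt (𝓡 (d + 1)) x₀).target)
    (h : localNorm g x₀ (u, p) < 0) : localTime τ x₀ (u, p) ≠ 0 := by
  obtain ⟨X, rfl⟩ := exists_chartDiff_eq hu p
  rw [localNorm_chartDiff hu] at h
  rw [localTime_chartDiff hu]
  exact metric_timeOrientation_ne_zero τ h

lemma contDiffOn_localNorm (g : LorentzMetric d M) (x₀ : M) :
    ContDiffOn ℝ ∞ (localNorm g x₀) ((extChartAt (𝓡 (d + 1)) x₀).target ×ˢ univ) := by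
  have h (μ ν) : ContDiffOn ℝ ∞ (fun z : EuclideanSpace ℝ (Fin (d + 1)) ×
      EuclideanSpace ℝ (Fin (d + 1)) ↦
        g.coeff x₀ ((extChartAt (𝓡 (d + 1)) x₀).symm z.1) μ ν * z.2 μ * z.2 ν)
      ((extChartAt (𝓡 (d + 1)) x₀).target ×ˢ univ) :=
    (((contDiffOn_coeff g x₀ μ ν).comp contDiffOn_fst fun z hz ↦ hz.1).mul
      (ContDiff.contDiffOn (by fun_prop))).mul (ContDiff.contDiffOn (by fun_prop))
  exact ContDiffOn.sum fun μ _ ↦ ContDiffOn.sum fun ν _ ↦ h μ ν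

lemma continuousOn_localTime (τ : TimeOrientation g) (x₀ : M) :
    ContinuousOn (localTime τ x₀) ((extChartAt (𝓡 (d + 1)) x₀).target ×ˢ univ) := by
  refine continuousOn_finsetSum _ fun μ _ ↦ continuousOn_finsetSum _ fun ν _ ↦ ?_
  have h1 := (contDiffOn_coeff g x₀ μ ν).continuousOn.comp
    (t := (extChartAt (𝓡 (d + 1)) x₀).target) (s := (extChartAt (𝓡 (d + 1)) x₀).target ×ˢ
      (univ : Set (EuclideanSpace ℝ (Fin (d + 1))))) continuousOn_fst fun z hz ↦ hz.1
  have h2 := (continuousOn_chartDiff_timeOrientation τ x₀).comp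
    (s := (extChartAt (𝓡 (d + 1)) x₀).target ×ˢ
      (univ : Set (EuclideanSpace ℝ (Fin (d + 1))))) continuousOn_fst fun z hz ↦ hz.1
  have h3 := (EuclideanSpace.proj (𝕜 := ℝ) ν :
    EuclideanSpace ℝ (Fin (d + 1)) →L[ℝ] ℝ).continuous.comp_continuousOn h2
  exact (h1.mul (by fun_prop)).mul h3

lemma isOpen_localCone (τ : TimeOrientation g) (x₀ : M) : IsOpen (localCone τ x₀) := by
  have ho : IsOpen ((extChartAt (𝓡 (d + 1)) x₀).target ×ˢ
      (univ : Set (EuclideanSpace ℝ (Fin (d + 1))))) :=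
    (isOpen_extChartAt_target x₀).prod isOpen_univ
  have h := ((contDiffOn_localNorm g x₀).continuousOn.prodMk
    (continuousOn_localTime τ x₀)).isOpen_inter_preimage ho
      ((isOpen_Iio (a := (0 : ℝ))).prod (isOpen_Iio (a := (0 : ℝ))))
  refine (congrArg IsOpen ?_).mp h
  ext z
  exact ⟨fun ⟨h1, h2⟩ ↦ ⟨h1.1, h2.1, h2.2⟩, fun ⟨h1, h2, h3⟩ ↦ ⟨⟨h1, mem_univ _⟩, h2, h3⟩⟩

/-! ### Functions on the mass shell that are regular near a fibre -/

/-- A function on the mass shell whose ray extension is continuously differentiable over the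
neighbourhood `N` in the chart around `x₀`, and that is supported in momenta of length at most
`R` there. -/
structure RegularNear (f : massShell g τ m → ℝ) (x₀ : M)
    (N : Set (EuclideanSpace ℝ (Fin (d + 1)))) (R : ℝ) : Prop where
  isOpen : IsOpen N
  mem : extChartAt (𝓡 (d + 1)) x₀ x₀ ∈ N
  subset : N ⊆ (extChartAt (𝓡 (d + 1)) x₀).target
  contDiffAt : ∀ z ∈ localCone τ x₀, z.1 ∈ N → ContDiffAt ℝ 1 (localRep f x₀) z
  radius_nonneg : 0 ≤ R
  eq_zero : ∀ u ∈ N, ∀ v : massShell g τ m, v.1.1 = (extChartAt (𝓡 (d + 1)) x₀).symm u →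
    R < ‖chartDiff x₀ v.1.1 v.1.2‖ → f v = 0

variable {f : massShell g τ m → ℝ} {N : Set (EuclideanSpace ℝ (Fin (d + 1)))} {R : ℝ}

/-- A cut-off: a function of `s = -g(p, p) / m²` that is supported in `1/2 < s < 4`. -/
structure IsCutoff (χ : ℝ → ℝ) : Prop where
  contDiffAt : ∀ s, 0 < s → ContDiffAt ℝ 1 χ s
  eq_zero : ∀ s, s ≤ 1 / 2 ∨ 4 ≤ s → χ s = 0

/-- The product of the ray extension with a cut-off. -/
def cutRep (f : massShell g τ m → ℝ) (x₀ : M) (χ : ℝ → ℝ)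
    (z : EuclideanSpace ℝ (Fin (d + 1)) × EuclideanSpace ℝ (Fin (d + 1))) : ℝ :=
  localRep f x₀ z * χ (-localNorm g x₀ z / m ^ 2)

/-- Either `s < 1/2`, which persists nearby and is killed by the cut-off, or the vector is timelike
and past-directed. The latter is an open condition, for which continuity of `τ` suffices. -/
lemma cutRep_eventually_zero (hm : 0 < m) {χ : ℝ → ℝ} (hχ : IsCutoff χ)
    (hu : u ∈ (extChartAt (𝓡 (d + 1)) x₀).target) (h : (u, p) ∉ localCone τ x₀) :
    cutRep f x₀ χ =ᶠ[𝓝 (u, p)] fun _ ↦ 0 := by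
  have ho : IsOpen ((extChartAt (𝓡 (d + 1)) x₀).target ×ˢ
      (univ : Set (EuclideanSpace ℝ (Fin (d + 1))))) :=
    (isOpen_extChartAt_target x₀).prod isOpen_univ
  have hz : (u, p) ∈ (extChartAt (𝓡 (d + 1)) x₀).target ×ˢ
      (univ : Set (EuclideanSpace ℝ (Fin (d + 1)))) := ⟨hu, mem_univ p⟩
  have c1 := (contDiffOn_localNorm g x₀).continuousOn.continuousAt (ho.mem_nhds hz)
  have c2 := (continuousOn_localTime τ x₀).continuousAt (ho.mem_nhds hz)
  by_cases h1 : -(m ^ 2 / 2) < localNorm g x₀ (u, p)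
  · filter_upwards [c1.eventually_const_lt h1] with z h2
    rw [cutRep, hχ.eq_zero, mul_zero]
    left
    rw [div_le_iff₀ (by positivity)]
    linarith
  · have h2 : localNorm g x₀ (u, p) < 0 := by
      have : 0 < m ^ 2 / 2 := by positivity
      linarith
    have h3 : 0 < localTime τ x₀ (u, p) := by
      rcases lt_or_gt_of_ne (localTime_ne_zero (τ := τ) hu h2) with h4 | h4
      · exact absurd ⟨hu, h2, h4⟩ h
      · exact h4
    filter_upwards [c2.eventually_const_lt h3, ho.mem_nhds hz] with z h4 h5
    rw [cutRep, localRep_eq_zero hm f h5.1, zero_mul]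
    exact fun h6 ↦ h4.not_gt h6.2.2

/-- The cut-off makes the product regular on whole fibres, including the light cone and `p = 0`,
where `localRep` itself need not be continuous. -/
lemma RegularNear.contDiffOn_cutRep (hm : 0 < m) (hf : RegularNear f x₀ N R) {χ : ℝ → ℝ}
    (hχ : IsCutoff χ) : ContDiffOn ℝ 1 (cutRep f x₀ χ) (N ×ˢ univ) := by
  rintro ⟨u, p⟩ ⟨hu, -⟩
  apply ContDiffAt.contDiffWithinAt
  have hu' := hf.subset hu
  by_cases h : (u, p) ∈ localCone τ x₀
  · refine (hf.contDiffAt _ h hu).mul (ContDiffAt.comp (u, p) (hχ.contDiffAt _ ?_) ?_)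
    · exact div_pos (by linarith [h.2.1]) (by positivity)
    · refine ContDiffAt.div_const (ContDiffAt.neg ?_) _
      exact (((contDiffOn_localNorm g x₀).contDiffAt
        (((isOpen_extChartAt_target x₀).prod isOpen_univ).mem_nhds
          ⟨hu', mem_univ p⟩))).of_le (by simp)
  · exact contDiffAt_const.congr_of_eventuallyEq (cutRep_eventually_zero hm hχ hu' h)

/-- The ray extension is not compactly supported in `p`, but the cut-off vanishes for `s = l² ≥ 4`.
Where it survives, `p` is less than twice a vector on the shell, whence the radius `2R`. -/
lemma RegularNear.cutRep_eq_zero (hm : 0 < m) (hf : RegularNear f x₀ N R) {χ : ℝ → ℝ}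
    (hχ : IsCutoff χ) : ∀ u ∈ N, ∀ p ∉ Metric.closedBall 0 (2 * R),
      cutRep f x₀ χ (u, p) = 0 := by
  intro u hu p hp
  have hu' := hf.subset hu
  by_cases h : (u, p) ∈ localCone τ x₀
  swap
  · rw [cutRep, localRep_eq_zero hm f hu' h, zero_mul]
  obtain ⟨X, rfl⟩ := exists_chartDiff_eq hu' p
  obtain ⟨-, h1, h2⟩ := h
  rw [localNorm_chartDiff hu'] at h1
  rw [localTime_chartDiff hu'] at h2
  obtain ⟨l, hl, hl2, P, hP, rfl⟩ := exists_eq_smul_massHyperboloid hm h1 h2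
  by_cases h4 : 4 ≤ l ^ 2
  · rw [cutRep, localNorm_chartDiff hu', ← hl2, hχ.eq_zero _ (Or.inr h4), mul_zero]
  · rw [cutRep, localRep_chartDiff f hu', rayExtension_smul f _ _ hl]
    rw [rayExtension_of_mem hm f ⟨⟨_, P⟩, hP⟩, hf.eq_zero u hu _ rfl, zero_mul]
    rw [mem_closedBall_zero_iff, map_smul, norm_smul, Real.norm_of_nonneg hl.le] at hp
    by_contra h5
    apply hp
    have : l ≤ 2 := by nlinarith
    exact mul_le_mul this (not_lt.1 h5) (norm_nonneg _) (by norm_num)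

end RayExtension

section Divergence

variable {d : ℕ} {M : Type*} [TopologicalSpace M]
  [ChartedSpace (EuclideanSpace ℝ (Fin (d + 1))) M] [IsManifold (𝓡 (d + 1)) ∞ M]
  {g : LorentzMetric d M} {τ : TimeOrientation g} {m : ℝ}

/-! ### The electromagnetic field in coordinates -/

/-- The components `F^μ_ν` at `x` in the chart around `x`. -/
def TwoForm.matrix (F : TwoForm d M) (g : LorentzMetric d M) (x : M) :
    Matrix (Fin (d + 1)) (Fin (d + 1)) ℝ :=
  fun μ ν ↦ coordForm x x μ (F.endo g x (coordVec x x ν))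

lemma TwoForm.endo_sum_smul (F : TwoForm d M) (g : LorentzMetric d M) (x : M)
    (c : Fin (d + 1) → ℝ) (Y : Fin (d + 1) → TangentSpace (𝓡 (d + 1)) x) :
    F.endo g x (∑ ν, c ν • Y ν) = ∑ ν, c ν • F.endo g x (Y ν) := by
  simp only [TwoForm.endo, map_sum, map_smul, map_neg, smul_neg, Finset.sum_neg_distrib]

lemma TwoForm.chartDiff_endo (F : TwoForm d M) (g : LorentzMetric d M) (x : M)
    (X : TangentSpace (𝓡 (d + 1)) x) :
    chartDiff x x (F.endo g x X) = WithLp.toLp 2 ((F.matrix g x).mulVec (chartDiff x x X)) := by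
  conv_lhs => rw [← sum_smul_coordVec (mem_chart_source _ x) X, F.endo_sum_smul]
  ext μ
  simp only [map_sum, map_smul, PiLp.smul_apply, smul_eq_mul, Matrix.mulVec,
    dotProduct, TwoForm.matrix, coordForm_apply, WithLp.ofLp_sum, Finset.sum_apply]
  exact Finset.sum_congr rfl fun ν _ ↦ mul_comm _ _

/-- The matrix is the product of the symmetric `G⁻¹` and the antisymmetric matrix of `F`. -/
lemma TwoForm.trace_matrix (F : TwoForm d M) (g : LorentzMetric d M) (τ : TimeOrientation g)
    (x : M) : (F.matrix g x).trace = 0 := by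
  have hdet := (det_coeff_neg g τ (mem_chart_source (EuclideanSpace ℝ (Fin (d + 1))) x)).ne
  set G := g.coeff x x
  set A := F.matrix g x
  have hG : G.transpose = G := by ext i j; exact coeff_symm g x x _ _
  have h1 : G * A = fun μ ν ↦ F.val x (coordVec x x μ) (coordVec x x ν) := by
    ext μ ν
    rw [← F.metric_endo g, Matrix.mul_apply]
    conv_rhs => rw [← sum_smul_coordVec (mem_chart_source _ x) (F.endo g x (coordVec x x ν))]
    simp only [map_sum, map_smul, smul_eq_mul]
    exact Finset.sum_congr rfl fun σ _ ↦ mul_comm _ _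
  have h2 : (G * A).transpose = -(G * A) := by
    rw [h1]
    ext μ ν
    exact F.antisymm x _ _
  have h3 : A = G⁻¹ * (G * A) := (Matrix.nonsing_inv_mul_cancel_left _ _ (isUnit_iff_ne_zero.2 hdet)).symm
  have h4 : A.trace = -A.trace := by
    conv_lhs => rw [h3, ← Matrix.trace_transpose, Matrix.transpose_mul, h2,
      Matrix.transpose_nonsing_inv, hG, Matrix.neg_mul, Matrix.trace_neg, Matrix.trace_mul_comm,
      ← h3]
  linarith

/-! ### Tangency of the Liouville vector field -/

/-- The Christoffel symbols at `x` in the chart around `x`. -/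
def LorentzMetric.gamma (g : LorentzMetric d M) (x : M) :
    Fin (d + 1) → Fin (d + 1) → Fin (d + 1) → ℝ := fun μ α β ↦ g.christoffel x x μ α β

lemma fderiv_localNorm (g : LorentzMetric d M) (x : M)
    (p a b : EuclideanSpace ℝ (Fin (d + 1))) :
    fderiv ℝ (localNorm g x) (extChartAt (𝓡 (d + 1)) x x, p) (a, b)
      = ∑ μ, ∑ ν, (∑ α, a α * g.coeffDeriv x α μ ν) * p μ * p ν
        + 2 * ∑ μ, ∑ ν, g.coeff x x μ ν * p μ * b ν := by
  have hc (i : Fin (d + 1)) : HasFDerivAt (fun z : EuclideanSpace ℝ (Fin (d + 1)) ×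
      EuclideanSpace ℝ (Fin (d + 1)) ↦ z.2 i)
      ((EuclideanSpace.proj (𝕜 := ℝ) i).comp (ContinuousLinearMap.snd ℝ _ _))
      (extChartAt (𝓡 (d + 1)) x x, p) :=
    ((EuclideanSpace.proj (𝕜 := ℝ) i : EuclideanSpace ℝ (Fin (d + 1)) →L[ℝ] ℝ).hasFDerivAt).comp
      (extChartAt (𝓡 (d + 1)) x x, p) hasFDerivAt_snd
  have hG (μ ν) := HasFDerivAt.comp (f := Prod.fst) (extChartAt (𝓡 (d + 1)) x x, p)
    (hasFDerivAt_coeff g x (mem_extChartAt_target x) μ ν) hasFDerivAt_fst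
  have h : HasFDerivAt (localNorm g x) _ (extChartAt (𝓡 (d + 1)) x x, p) :=
    HasFDerivAt.fun_sum (u := Finset.univ) fun μ _ ↦ HasFDerivAt.fun_sum (u := Finset.univ)
      fun ν _ ↦ ((hG μ ν).mul (hc μ)).mul (hc ν)
  have hd (μ ν) : fderiv ℝ (fun u ↦ g.coeff x ((extChartAt (𝓡 (d + 1)) x).symm u) μ ν)
      (extChartAt (𝓡 (d + 1)) x x) a = ∑ α, a α * g.coeffDeriv x α μ ν := by
    conv_lhs => rw [← sum_smul_single a]
    simp only [map_sum, map_smul, smul_eq_mul]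
    rfl
  rw [h.fderiv]
  simp only [sum_apply, add_apply, smul_apply, ContinuousLinearMap.comp_apply,
    ContinuousLinearMap.coe_snd', ContinuousLinearMap.coe_fst', PiLp.proj_apply, smul_eq_mul,
    Function.comp_apply, hd, extChartAt_to_inv, Pi.mul_apply]
  have hswap : ∑ μ, ∑ ν, g.coeff x x μ ν * p ν * b μ = ∑ μ, ∑ ν, g.coeff x x μ ν * p μ * b ν := by
    rw [Finset.sum_comm]
    refine Finset.sum_congr rfl fun μ _ ↦ Finset.sum_congr rfl fun ν _ ↦ ?_
    rw [coeff_symm]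
  rw [two_mul]
  nth_rw 2 [← hswap]
  simp only [← Finset.sum_add_distrib]
  refine Finset.sum_congr rfl fun μ _ ↦ Finset.sum_congr rfl fun ν _ ↦ ?_
  ring

/-- Infinitesimally, geodesics preserve `g(p,p)`. Contracted with `p` three times, the three
derivatives in the lowered Christoffel symbol become equal up to sign, and the one left over cancels
the derivative of the metric. -/
lemma fderiv_localNorm_geodesic (g : LorentzMetric d M) (τ : TimeOrientation g) (x : M)
    (p : EuclideanSpace ℝ (Fin (d + 1))) :
    fderiv ℝ (localNorm g x) (extChartAt (𝓡 (d + 1)) x x, p) (p, geodesicForce (g.gamma x) p)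
      = 0 := by
  rw [fderiv_localNorm]
  have h1 : ∑ μ, ∑ ν, g.coeff x x μ ν * p μ * geodesicForce (g.gamma x) p ν
      = -∑ μ, ∑ α, ∑ β, (∑ ν, g.coeff x x μ ν * g.christoffel x x ν α β) * p μ * p α * p β := by
    rw [← Finset.sum_neg_distrib]
    refine Finset.sum_congr rfl fun μ _ ↦ ?_
    simp only [geodesicForce, mul_neg, Finset.sum_neg_distrib, Finset.mul_sum, Finset.sum_mul]
    congr 1
    rw [Finset.sum_comm]
    refine Finset.sum_congr rfl fun α _ ↦ ?_
    rw [Finset.sum_comm]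
    refine Finset.sum_congr rfl fun β _ ↦ Finset.sum_congr rfl fun ν _ ↦ ?_
    simp only [LorentzMetric.gamma]
    ring
  rw [h1]
  simp only [coeff_mul_christoffel g τ]
  set T : Fin (d + 1) → Fin (d + 1) → Fin (d + 1) → ℝ :=
    fun α σ β ↦ g.coeffDeriv x α σ β * p α * p σ * p β with hT
  have e1 : ∑ μ, ∑ ν, (∑ α, p α * g.coeffDeriv x α μ ν) * p μ * p ν
      = ∑ α, ∑ μ, ∑ ν, T α μ ν := by
    simp only [Finset.sum_mul]
    rw [Finset.sum_comm]
    have hν (ν : Fin (d + 1)) : ∑ μ, ∑ α, p α * g.coeffDeriv x α μ ν * p μ * p ν = ∑ α, ∑ μ, T α μ ν := by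
      rw [Finset.sum_comm]
      refine Finset.sum_congr rfl fun μ _ ↦ Finset.sum_congr rfl fun ν _ ↦ ?_
      simp only [hT]; ring
    simp only [hν]
    rw [Finset.sum_comm]
    refine Finset.sum_congr rfl fun α _ ↦ ?_
    rw [Finset.sum_comm]
  have e2 : ∑ μ, ∑ α, ∑ β, (1 / 2) * (g.coeffDeriv x α μ β + g.coeffDeriv x β μ α
        - g.coeffDeriv x μ α β) * p μ * p α * p β
      = (1 / 2) * (∑ μ, ∑ α, ∑ β, T α μ β + ∑ μ, ∑ α, ∑ β, T β μ α - ∑ μ, ∑ α, ∑ β, T μ α β) := by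
    simp only [← Finset.sum_add_distrib, ← Finset.sum_sub_distrib, Finset.mul_sum]
    refine Finset.sum_congr rfl fun μ _ ↦ Finset.sum_congr rfl fun α _ ↦
      Finset.sum_congr rfl fun β _ ↦ ?_
    simp only [hT]; ring
  have e3 : ∑ μ, ∑ α, ∑ β, T α μ β = ∑ α, ∑ μ, ∑ ν, T α μ ν := Finset.sum_comm
  have e4 : ∑ μ, ∑ α, ∑ β, T β μ α = ∑ α, ∑ μ, ∑ ν, T α μ ν := by
    rw [← e3]
    refine Finset.sum_congr rfl fun μ _ ↦ Finset.sum_comm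
  rw [e1, e2, e3, e4]
  ring

/-- Up to a factor, the derivative is `F(p,p)`, which vanishes by antisymmetry: the Lorentz force
preserves mass. -/
lemma fderiv_localNorm_field (F : TwoForm d M) (g : LorentzMetric d M) (x : M)
    (p : EuclideanSpace ℝ (Fin (d + 1))) :
    fderiv ℝ (localNorm g x) (extChartAt (𝓡 (d + 1)) x x, p)
      (0, WithLp.toLp 2 ((F.matrix g x).mulVec p)) = 0 := by
  have hx := mem_chart_source (EuclideanSpace ℝ (Fin (d + 1))) x
  have hX := chartDiff_inverse_apply hx p
  set X := (chartDiff x x).inverse p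
  rw [fderiv_localNorm, ← hX, ← F.chartDiff_endo g x X, ← metric_eq_sum g hx, F.metric_endo]
  have := F.antisymm x X X
  have h0 : F.val x X X = 0 := by linarith
  simp [h0]

/-! ### The Lie derivative in coordinates -/

variable {f : massShell g τ m → ℝ} {N : Set (EuclideanSpace ℝ (Fin (d + 1)))} {R : ℝ} {x : M}

lemma mem_localCone_self (hm : 0 < m) (p : massHyperboloid g τ m x) :
    (extChartAt (𝓡 (d + 1)) x x, chartDiff x x p.1) ∈ localCone τ x := by
  have hx := mem_chart_source (EuclideanSpace ℝ (Fin (d + 1))) x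
  refine ⟨mem_extChartAt_target x, ?_, ?_⟩
  · simp only [localNorm, extChartAt_to_inv]
    rw [← metric_eq_sum g hx, p.2.1]
    have := sq_pos_of_pos hm
    linarith
  · simp only [localTime]
    rw [extChartAt_to_inv x, ← metric_eq_sum g hx]
    exact p.2.2

lemma liftPoint_self (X : TangentSpace (𝓡 (d + 1)) x) :
    liftPoint x (extChartAt (𝓡 (d + 1)) x x, chartDiff x x X) = ⟨x, X⟩ :=
  liftPoint_chart (mem_chart_source _ x) X

/-- Needed for `lieDeriv` to be meaningful, since `mfderiv` is zero by convention where
differentiability fails. -/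
lemma RegularNear.mdifferentiableAt (hf : RegularNear f x N R) {X : TangentSpace (𝓡 (d + 1)) x}
    (hX : (extChartAt (𝓡 (d + 1)) x x, chartDiff x x X) ∈ localCone τ x) :
    MDifferentiableAt (𝓡 (d + 1)).tangent 𝓘(ℝ, ℝ) (rayExtension f) ⟨x, X⟩ := by
  let v : TangentBundle (𝓡 (d + 1)) M := ⟨x, X⟩
  have hv : extChartAt (𝓡 (d + 1)).tangent v v
      = (extChartAt (𝓡 (d + 1)) x x, chartDiff x x X) :=
    extChartAt_tangent_apply v v (mem_chart_source _ _)
  have h1 : MDifferentiableAt (𝓡 (d + 1)).tangent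
      𝓘(ℝ, EuclideanSpace ℝ (Fin (d + 1)) × EuclideanSpace ℝ (Fin (d + 1)))
      (extChartAt (𝓡 (d + 1)).tangent v) v :=
    (contMDiffAt_extChartAt (n := 1)).mdifferentiableAt one_ne_zero
  have h2 : MDifferentiableAt 𝓘(ℝ, EuclideanSpace ℝ (Fin (d + 1)) × EuclideanSpace ℝ (Fin (d + 1)))
      𝓘(ℝ, ℝ) (localRep f x) (extChartAt (𝓡 (d + 1)).tangent v v) := by
    rw [hv]
    exact ((hf.contDiffAt _ hX hf.mem).differentiableAt one_ne_zero).mdifferentiableAt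
  refine (h2.comp v h1).congr_of_eventuallyEq ?_
  filter_upwards [extChartAt_source_mem_nhds (I := (𝓡 (d + 1)).tangent) v] with w hw
  rw [extChartAt_source, TangentBundle.mem_chart_source_iff] at hw
  rw [Function.comp_apply, extChartAt_tangent_apply v w hw, localRep, liftPoint_chart hw]

/-- The Lie derivative along the Liouville field in coordinates. -/
lemma RegularNear.lieDeriv_eq (hm : 0 < m) (hf : RegularNear f x N R) (F : TwoForm d M) (q : ℝ)
    (p : massHyperboloid g τ m x) :
    onFibre (lieDeriv F q f) x p
      = fderiv ℝ (localRep f x) (extChartAt (𝓡 (d + 1)) x x, chartDiff x x p.1)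
          (chartDiff x x p.1, geodesicForce (g.gamma x) (chartDiff x x p.1))
        + q * fderiv ℝ (localRep f x) (extChartAt (𝓡 (d + 1)) x x, chartDiff x x p.1)
          (0, WithLp.toLp 2 ((F.matrix g x).mulVec (chartDiff x x p.1))) := by
  have h := mfderiv_eq_fderiv_liftPoint ⟨x, p.1⟩ (hf.mdifferentiableAt (mem_localCone_self hm p))
    (chartDiff x x p.1, geodesicForce (g.gamma x) (chartDiff x x p.1)
      + q • WithLp.toLp 2 ((F.matrix g x).mulVec (chartDiff x x p.1)))
  have hL : liouville g F q ⟨x, p.1⟩ = ((chartDiff x x p.1,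
      geodesicForce (g.gamma x) (chartDiff x x p.1)
      + q • WithLp.toLp 2 ((F.matrix g x).mulVec (chartDiff x x p.1))) :
      EuclideanSpace ℝ (Fin (d + 1)) × EuclideanSpace ℝ (Fin (d + 1))) := by
    rw [← F.chartDiff_endo g x p.1]
    refine Prod.ext rfl ?_
    ext μ
    simp only [liouville, geodesicForce, PiLp.add_apply, PiLp.smul_apply, smul_eq_mul,
      coordForm_apply, LorentzMetric.gamma]
    ring
  rw [onFibre, lieDeriv]
  refine (congrArg _ hL).trans (h.trans ?_)
  rw [← smul_eq_mul, ← map_smul, ← map_add]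
  simp only [Prod.smul_mk, smul_zero, Prod.mk_add_mk, add_zero]
  rfl

end Divergence

section Current

/-! ### The cut-off -/

/-- A smooth bump function around `1`. -/
def cutoff : ContDiffBump (1 : ℝ) := ⟨1 / 4, 1 / 2, by norm_num, by norm_num⟩

lemma cutoff_eq_zero {s : ℝ} (hs : s ≤ 1 / 2 ∨ 4 ≤ s) : cutoff s = 0 := by
  apply cutoff.zero_of_le_dist
  rw [Real.dist_eq, cutoff]
  rcases hs with h | h
  · rw [abs_of_nonpos (by linarith)]; linarith
  · rw [abs_of_nonneg (by linarith)]; linarith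

lemma isCutoff_cutoff : IsCutoff cutoff :=
  ⟨fun _ _ ↦ cutoff.contDiff.contDiffAt, fun _ hs ↦ cutoff_eq_zero hs⟩

/-- At `l` times a point of the hyperboloid `√s = l`, so this cut-off raises the degree in `l` by
one. `IsCutoff` asks for smoothness only at `s > 0`, which accommodates the root. -/
lemma isCutoff_sqrt_mul_cutoff : IsCutoff fun s ↦ √s * cutoff s :=
  ⟨fun _ hs ↦ (Real.contDiffAt_sqrt hs.ne').mul cutoff.contDiff.contDiffAt,
    fun _ hs ↦ by simp only [cutoff_eq_zero hs, mul_zero]⟩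

/-- The constant that relates integrals over the solid cone to integrals over the hyperboloid. -/
def cutConstant (d : ℕ) (m : ℝ) : ℝ :=
  frameConstant d * ∫ l in Ioi (0 : ℝ), m ^ 2 * l ^ d * (l * cutoff (l ^ 2))

lemma cutConstant_ne_zero (d : ℕ) {m : ℝ} (hm : 0 < m) : cutConstant d m ≠ 0 := by
  refine mul_ne_zero (exists_integral_eq_frameVec d).choose_spec.1 (ne_of_gt ?_)
  -- The absolute values change nothing on `l > 0` and make the integrand continuous, nonnegative
  -- and compactly supported on the whole line. It is positive at `l = 1`, the centre of the bump.
  set h : ℝ → ℝ := fun l ↦ m ^ 2 * |l| ^ d * (|l| * cutoff (l ^ 2)) with hh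
  have hcont : Continuous h := by
    have := cutoff.continuous
    fun_prop
  have hsupp : HasCompactSupport h := by
    refine HasCompactSupport.intro (isCompact_closedBall (0 : ℝ) 2) fun l hl ↦ ?_
    rw [hh]
    simp only
    rw [cutoff_eq_zero (Or.inr ?_), mul_zero, mul_zero]
    rw [mem_closedBall_zero_iff, Real.norm_eq_abs, not_le] at hl
    nlinarith [sq_abs l]
  have e : ∫ l in Ioi (0 : ℝ), m ^ 2 * l ^ d * (l * cutoff (l ^ 2)) = ∫ l in Ioi (0 : ℝ), h l := by
    refine setIntegral_congr_fun measurableSet_Ioi fun l hl ↦ ?_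
    simp only [hh, abs_of_pos (show 0 < l from hl)]
  have h0 : ∀ l, 0 ≤ h l := fun l ↦ by
    have := cutoff.nonneg (x := l ^ 2)
    positivity
  have h1 : h 1 = m ^ 2 := by
    have : cutoff (1 : ℝ) = 1 :=
      cutoff.one_of_mem_closedBall (Metric.mem_closedBall_self cutoff.rIn_pos.le)
    simp [hh, this]
  rw [e, setIntegral_pos_iff_support_of_nonneg_ae (Filter.Eventually.of_forall h0)
    (hcont.integrable_of_hasCompactSupport hsupp).integrableOn]
  refine IsOpen.measure_pos volume (hcont.isOpen_support.inter isOpen_Ioi) ⟨1, ?_, mem_Ioi.2 one_pos⟩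
  rw [Function.mem_support, h1]
  positivity

variable {d : ℕ} {M : Type*} [TopologicalSpace M]
  [ChartedSpace (EuclideanSpace ℝ (Fin (d + 1))) M] [IsManifold (𝓡 (d + 1)) ∞ M]
  {g : LorentzMetric d M} {τ : TimeOrientation g} {m : ℝ}
  {f : massShell g τ m → ℝ} {N : Set (EuclideanSpace ℝ (Fin (d + 1)))} {R : ℝ} {x : M}

/-! ### Integrability -/

/-- The Lie derivative in the adapted coordinates of the chart around `x`, at `x`. -/
def localLie (f : massShell g τ m → ℝ) (F : TwoForm d M) (q : ℝ) (x : M)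
    (p : EuclideanSpace ℝ (Fin (d + 1))) : ℝ :=
  fderiv ℝ (localRep f x) (extChartAt (𝓡 (d + 1)) x x, p) (p, geodesicForce (g.gamma x) p)
    + q * fderiv ℝ (localRep f x) (extChartAt (𝓡 (d + 1)) x x, p)
      (0, WithLp.toLp 2 ((F.matrix g x).mulVec p))

lemma localRep_self (hm : 0 < m) (f : massShell g τ m → ℝ) (p : massHyperboloid g τ m x) :
    localRep f x (extChartAt (𝓡 (d + 1)) x x, chartDiff x x p.1) = onFibre f x p := by
  rw [localRep, liftPoint_self]
  exact rayExtension_of_mem hm f ⟨⟨x, p.1⟩, p.2⟩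

lemma RegularNear.fibreIntegrable (hm : 0 < m) (hf : RegularNear f x N R)
    {h : EuclideanSpace ℝ (Fin (d + 1)) → ℝ} (hh : Continuous h) :
    FibreIntegrable (g := g) (τ := τ) hm x
      (fun p ↦ onFibre f x p * h (chartDiff x x p.1)) := by
  refine fibreIntegrable_of_continuousAt hm (mem_chart_source _ x) (R := R)
    (Φ := fun p ↦ localRep f x (extChartAt (𝓡 (d + 1)) x x, p) * h p) (fun p ↦ ?_) ?_ ?_
  · rw [localRep_self hm]
  · intro p hp
    refine ContinuousAt.mul ?_ hh.continuousAt
    exact ContinuousAt.comp (f := fun p ↦ (extChartAt (𝓡 (d + 1)) x x, p))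
      (hf.contDiffAt _ (mem_localCone_self hm ⟨p, hp⟩) hf.mem).continuousAt (by fun_prop)
  · intro p hp hR
    rw [localRep_self hm f ⟨p, hp⟩, onFibre,
      hf.eq_zero _ hf.mem ⟨⟨x, p⟩, hp⟩ (extChartAt_to_inv x).symm hR, zero_mul]

/-- It is not enough that `f` vanishes at `p`; its extension has to vanish near `p` in the tangent
bundle, including off the mass shell. -/
lemma RegularNear.fderiv_localRep_eq_zero (hm : 0 < m) (hf : RegularNear f x N R)
    (p : massHyperboloid g τ m x) (hR : R < ‖chartDiff x x p.1‖) :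
    fderiv ℝ (localRep f x) (extChartAt (𝓡 (d + 1)) x x, chartDiff x x p.1) = 0 := by
  have hcone := mem_localCone_self hm p
  have hnorm : localNorm g x (extChartAt (𝓡 (d + 1)) x x, chartDiff x x p.1) = -m ^ 2 := by
    simp only [localNorm, extChartAt_to_inv]
    rw [← metric_eq_sum g (mem_chart_source _ x), p.2.1]
  have ho : IsOpen ((extChartAt (𝓡 (d + 1)) x).target ×ˢ
      (univ : Set (EuclideanSpace ℝ (Fin (d + 1))))) :=
    (isOpen_extChartAt_target x).prod isOpen_univ
  -- Positivity of this function is an open condition. On timelike vectors it says that the multiple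
  -- of mass `m` has length greater than `R`.
  have hc : ContinuousAt (fun z : EuclideanSpace ℝ (Fin (d + 1)) ×
      EuclideanSpace ℝ (Fin (d + 1)) ↦ ‖z.2‖ ^ 2 * m ^ 2 + R ^ 2 * localNorm g x z)
      (extChartAt (𝓡 (d + 1)) x x, chartDiff x x p.1) := by
    have := (contDiffOn_localNorm g x).continuousOn.continuousAt
      (ho.mem_nhds ⟨mem_extChartAt_target x, mem_univ _⟩)
      (x := (extChartAt (𝓡 (d + 1)) x x, chartDiff x x p.1))
    fun_prop
  have hpos : 0 < ‖chartDiff x x p.1‖ ^ 2 * m ^ 2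
      + R ^ 2 * localNorm g x (extChartAt (𝓡 (d + 1)) x x, chartDiff x x p.1) := by
    rw [hnorm]
    have := hf.radius_nonneg
    nlinarith [mul_pos (show 0 < ‖chartDiff x x p.1‖ ^ 2 - R ^ 2 by nlinarith) (sq_pos_of_pos hm)]
  have : localRep f x =ᶠ[𝓝 (extChartAt (𝓡 (d + 1)) x x, chartDiff x x p.1)] fun _ ↦ 0 := by
    filter_upwards [hc.eventually_const_lt hpos, (isOpen_localCone τ x).mem_nhds hcone,
      (hf.isOpen.prod isOpen_univ).mem_nhds ⟨hf.mem, mem_univ _⟩]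
    rintro ⟨u, p⟩ h1 hcone hslab
    have hu : u ∈ (extChartAt (𝓡 (d + 1)) x).target := hcone.1
    have hN : u ∈ N := hslab.1
    have h2 := hcone.2.1
    have h3 := hcone.2.2
    obtain ⟨X, rfl⟩ := exists_chartDiff_eq hu p
    simp only at h1
    rw [localNorm_chartDiff hu] at h1 h2
    rw [localTime_chartDiff hu] at h3
    obtain ⟨l, hl, hl2, P, hP, rfl⟩ := exists_eq_smul_massHyperboloid hm h2 h3
    rw [localRep_chartDiff f hu, rayExtension_smul f _ _ hl,
      rayExtension_of_mem hm f ⟨⟨_, P⟩, hP⟩, hf.eq_zero u hN _ rfl]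
    simp only [map_smul, norm_smul, smul_apply, smul_eq_mul, hP.1, Real.norm_of_nonneg hl.le] at h1
    have h4 : 0 < l ^ 2 * m ^ 2 * (‖chartDiff x _ P‖ ^ 2 - R ^ 2) := by linarith
    have h5 : 0 < ‖chartDiff x _ P‖ ^ 2 - R ^ 2 := pos_of_mul_pos_right h4 (by positivity)
    exact lt_of_pow_lt_pow_left₀ 2 (norm_nonneg _) (by linarith)
  rw [this.fderiv_eq]
  simp

lemma RegularNear.fibreIntegrable_lieDeriv (hm : 0 < m) (hf : RegularNear f x N R)
    (F : TwoForm d M) (q : ℝ) {h : EuclideanSpace ℝ (Fin (d + 1)) → ℝ} (hh : Continuous h) :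
    FibreIntegrable (g := g) (τ := τ) hm x
      (fun p ↦ onFibre (lieDeriv F q f) x p * h (chartDiff x x p.1)) := by
  refine fibreIntegrable_of_continuousAt hm (mem_chart_source _ x) (R := R)
    (Φ := fun p ↦ localLie f F q x p * h p) (fun p ↦ ?_) ?_ ?_
  · rw [hf.lieDeriv_eq hm, localLie]
  · intro p hp
    refine ContinuousAt.mul ?_ hh.continuousAt
    have h1 : ContinuousAt (fun p ↦ fderiv ℝ (localRep f x) (extChartAt (𝓡 (d + 1)) x x, p))
        (chartDiff x x p) :=
      ContinuousAt.comp (f := fun p ↦ (extChartAt (𝓡 (d + 1)) x x, p))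
        ((hf.contDiffAt _ (mem_localCone_self hm ⟨p, hp⟩) hf.mem).continuousAt_fderiv one_ne_zero)
        (by fun_prop)
    have h2 : Continuous fun p ↦ geodesicForce (g.gamma x) p := by
      simp only [geodesicForce]
      fun_prop
    have h3 : Continuous fun p : EuclideanSpace ℝ (Fin (d + 1)) ↦
        WithLp.toLp 2 ((F.matrix g x).mulVec p) := by
      fun_prop
    exact (h1.clm_apply (by fun_prop)).add ((h1.clm_apply (by fun_prop)).const_mul q)
  · intro p hp hR
    simp only [localLie]
    rw [hf.fderiv_localRep_eq_zero hm ⟨p, hp⟩ hR]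
    simp

/-! ### The divergence of the current density -/

/-- The ray extension has degree `0` and `p^μ` degree `1` in the scale, hence the weight `l χ(l²)`
in `cutConstant`. The left side has a domain of integration independent of `u`. -/
lemma RegularNear.sqrt_mul_integral_cutRep (hm : 0 < m) (hf : RegularNear f x N R)
    {u : EuclideanSpace ℝ (Fin (d + 1))} (hu : u ∈ N) (μ : Fin (d + 1)) :
    √(-(g.coeff x ((extChartAt (𝓡 (d + 1)) x).symm u)).det) *
        ∫ p, cutRep f x cutoff (u, p) * p μ
      = cutConstant d m * currentDensity hm f ((extChartAt (𝓡 (d + 1)) x).symm u)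
        (coordForm x ((extChartAt (𝓡 (d + 1)) x).symm u) μ) := by
  have hu' := hf.subset hu
  refine sqrt_mul_integral_eq_fibreIntegral hm (mem_chart_source_of_mem_target hu')
    (fun l ↦ l * cutoff (l ^ 2)) _ _ (fun X hX ↦ ?_) fun l hl p ↦ ?_
  · rw [cutRep, localRep_chartDiff f hu', rayExtension_eq_zero hm f hX, zero_mul, zero_mul]
  · rw [← map_smul, cutRep, localRep_chartDiff f hu', rayExtension_smul f _ _ hl,
      localNorm_chartDiff hu']
    rw [rayExtension_of_mem hm f ⟨⟨_, p.1⟩, p.2⟩]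
    have : -g.val _ (l • p.1) (l • p.1) / m ^ 2 = l ^ 2 := by
      simp only [map_smul, smul_apply, smul_eq_mul, p.2.1]
      field_simp
    rw [this, map_smul, PiLp.smul_apply, smul_eq_mul, coordForm_apply, onFibre]
    ring

/-- The cut-off depends on `g(p,p)` alone, so it behaves as a constant in directions tangent to the
level sets. -/
lemma RegularNear.fderiv_cutRep (hf : RegularNear f x N R) {χ : ℝ → ℝ} (hm : 0 < m)
    (hχ : IsCutoff χ) {p : EuclideanSpace ℝ (Fin (d + 1))}
    (hp : (extChartAt (𝓡 (d + 1)) x x, p) ∈ localCone τ x)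
    {X : EuclideanSpace ℝ (Fin (d + 1)) × EuclideanSpace ℝ (Fin (d + 1))}
    (hX : fderiv ℝ (localNorm g x) (extChartAt (𝓡 (d + 1)) x x, p) X = 0) :
    fderiv ℝ (cutRep f x χ) (extChartAt (𝓡 (d + 1)) x x, p) X
      = χ (-localNorm g x (extChartAt (𝓡 (d + 1)) x x, p) / m ^ 2)
        * fderiv ℝ (localRep f x) (extChartAt (𝓡 (d + 1)) x x, p) X := by
  have h1 := ((hf.contDiffAt _ hp hf.mem).differentiableAt one_ne_zero).hasFDerivAt
  have h2 : HasFDerivAt (localNorm g x) _ (extChartAt (𝓡 (d + 1)) x x, p) :=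
    (((contDiffOn_localNorm g x).contDiffAt (((isOpen_extChartAt_target x).prod isOpen_univ).mem_nhds
      ⟨mem_extChartAt_target x, mem_univ p⟩)).differentiableAt (by simp)).hasFDerivAt
  have hs : 0 < -localNorm g x (extChartAt (𝓡 (d + 1)) x x, p) / m ^ 2 :=
    div_pos (by linarith [hp.2.1]) (by positivity)
  have h3 := ((hχ.contDiffAt _ hs).differentiableAt one_ne_zero).hasDerivAt
  have h4 : HasFDerivAt (fun z ↦ -localNorm g x z / m ^ 2) _ (extChartAt (𝓡 (d + 1)) x x, p) :=
    h2.fun_neg.mul_const (m ^ 2)⁻¹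
  have h5 := h1.mul (HasDerivAt.comp_hasFDerivAt (f := fun z ↦ -localNorm g x z / m ^ 2)
    _ h3 h4)
  have h6 : HasFDerivAt (cutRep f x χ) _ (extChartAt (𝓡 (d + 1)) x x, p) := h5
  rw [h6.fderiv]
  simp only [add_apply, smul_apply, neg_apply, smul_eq_mul, hX, neg_zero, mul_zero, zero_add,
    Function.comp_apply]

/-- Only the geodesic part of `L` occurs on the left, yet the full Lie derivative appears on the
right: the electromagnetic part integrates to zero over the cone and is inserted at no cost. -/
lemma RegularNear.sqrt_mul_integral_fderiv_cutRep (hm : 0 < m) (hf : RegularNear f x N R)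
    (F : TwoForm d M) (q : ℝ) :
    √(-(g.coeff x x).det) * ∫ p, fderiv ℝ (cutRep f x cutoff) (extChartAt (𝓡 (d + 1)) x x, p)
        (p, geodesicForce (g.gamma x) p)
      = cutConstant d m * fibreIntegral hm x (onFibre (lieDeriv F q f) x) := by
  set u := extChartAt (𝓡 (d + 1)) x x with hu
  have hut : u ∈ (extChartAt (𝓡 (d + 1)) x).target := mem_extChartAt_target x
  have c1 := hf.contDiffOn_cutRep hm isCutoff_cutoff
  have c2 := hf.contDiffOn_cutRep hm isCutoff_sqrt_mul_cutoff
  have z1 := hf.cutRep_eq_zero hm isCutoff_cutoff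
  have z2 := hf.cutRep_eq_zero hm isCutoff_sqrt_mul_cutoff
  have hK : IsCompact (Metric.closedBall (0 : EuclideanSpace ℝ (Fin (d + 1))) (2 * R)) :=
    isCompact_closedBall _ _
  have hcg : Continuous fun p ↦ geodesicForce (g.gamma x) p := by
    simp only [geodesicForce]
    fun_prop
  have hcA : Continuous fun p : EuclideanSpace ℝ (Fin (d + 1)) ↦
      WithLp.toLp 2 ((F.matrix g x).mulVec p) := by
    fun_prop
  have i1 : Integrable fun p ↦ fderiv ℝ (cutRep f x cutoff) (u, p)
      (p, geodesicForce (g.gamma x) p) := by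
    refine Continuous.integrable_of_hasCompactSupport
      ((continuous_fderiv_slice hf.isOpen c1 hf.mem).clm_apply (by fun_prop))
      (HasCompactSupport.intro hK fun p hp ↦ ?_)
    rw [fderiv_eq_zero_of_notMem hf.isOpen hK.isClosed hf.mem z1 hp]
    simp
  have i2 : Integrable fun p ↦ fderiv ℝ (cutRep f x fun s ↦ √s * cutoff s) (u, p)
      (0, WithLp.toLp 2 ((F.matrix g x).mulVec p)) := by
    refine Continuous.integrable_of_hasCompactSupport
      ((continuous_fderiv_slice hf.isOpen c2 hf.mem).clm_apply (by fun_prop))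
      (HasCompactSupport.intro hK fun p hp ↦ ?_)
    rw [fderiv_eq_zero_of_notMem hf.isOpen hK.isClosed hf.mem z2 hp]
    simp
  have h0 : ∫ p, fderiv ℝ (cutRep f x fun s ↦ √s * cutoff s) (u, p)
      (0, WithLp.toLp 2 ((F.matrix g x).mulVec p)) = 0 := by
    rw [← integral_fderiv_traceless (F.trace_matrix g τ x) (contDiff_slice c2 hf.mem)
      (HasCompactSupport.intro hK fun p hp ↦ z2 u hf.mem p hp)]
    simp only [fderiv_slice hf.isOpen c2 hf.mem]
    rfl
  -- Applied to a function of degree `0`, the geodesic part has degree `1` in the scale and the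
  -- field part degree `0`. The factor `√s = l` in the second cut-off gives both the common weight
  -- `l χ(l²)`.
  have hsum : ∫ p, fderiv ℝ (cutRep f x cutoff) (u, p) (p, geodesicForce (g.gamma x) p)
      = ∫ p, (fderiv ℝ (cutRep f x cutoff) (u, p) (p, geodesicForce (g.gamma x) p)
        + q * fderiv ℝ (cutRep f x fun s ↦ √s * cutoff s) (u, p)
          (0, WithLp.toLp 2 ((F.matrix g x).mulVec p))) := by
    rw [integral_add i1 (i2.const_mul q), integral_const_mul, h0]
    ring
  rw [hsum]
  have hxs := mem_chart_source (EuclideanSpace ℝ (Fin (d + 1))) x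
  refine sqrt_mul_integral_eq_fibreIntegral hm hxs
    (fun l ↦ l * cutoff (l ^ 2)) _ _ (fun X hX ↦ ?_) fun l hl p ↦ ?_
  · have hn : (u, chartDiff x x X) ∉ localCone τ x := by
      rintro ⟨-, h1, h2⟩
      simp only [localNorm, localTime, hu] at h1 h2
      rw [extChartAt_to_inv x, ← metric_eq_sum g hxs] at h1 h2
      exact hX ⟨h1, h2⟩
    rw [(cutRep_eventually_zero hm isCutoff_cutoff hut hn).fderiv_eq,
      (cutRep_eventually_zero hm isCutoff_sqrt_mul_cutoff hut hn).fderiv_eq]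
    simp
  · set P := chartDiff x x p.1 with hP
    have hnorm : localNorm g x (u, l • P) = -(l ^ 2 * m ^ 2) := by
      rw [hP, ← map_smul]
      simp only [localNorm, hu]
      rw [extChartAt_to_inv x, ← metric_eq_sum g hxs]
      simp only [map_smul, smul_apply, smul_eq_mul, p.2.1]
      ring
    have hcone : (u, l • P) ∈ localCone τ x := by
      refine ⟨hut, by rw [hnorm]; have := mul_pos (sq_pos_of_pos hl) (sq_pos_of_pos hm); linarith, ?_⟩
      rw [hP, ← map_smul]
      simp only [localTime, hu]
      rw [extChartAt_to_inv x, ← metric_eq_sum g hxs]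
      simp only [map_smul, smul_apply, smul_eq_mul]
      exact mul_neg_of_pos_of_neg hl p.2.2
    have hs : -localNorm g x (u, l • P) / m ^ 2 = l ^ 2 := by
      rw [hnorm]; field_simp
    have hg : geodesicForce (g.gamma x) (l • P) = l • (l • geodesicForce (g.gamma x) P) := by
      ext μ
      simp only [geodesicForce, PiLp.smul_apply, smul_eq_mul, mul_neg, Finset.mul_sum]
      congr 1
      refine Finset.sum_congr rfl fun α _ ↦ Finset.sum_congr rfl fun β _ ↦ ?_
      ring
    have hA : WithLp.toLp 2 ((F.matrix g x).mulVec (WithLp.ofLp (l • P)))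
        = l • WithLp.toLp 2 ((F.matrix g x).mulVec P) := by
      rw [WithLp.ofLp_smul, Matrix.mulVec_smul, WithLp.toLp_smul]
    rw [hf.fderiv_cutRep hm isCutoff_cutoff hcone (fderiv_localNorm_geodesic g τ x _),
      hf.fderiv_cutRep hm isCutoff_sqrt_mul_cutoff hcone (fderiv_localNorm_field F g x _), hs,
      Real.sqrt_sq hl.le, hg, hA, fderiv_localRep_smul f x u P _ _ hl,
      fderiv_localRep_smul f x u P _ _ hl, hf.lieDeriv_eq hm,
      show ((l • P, l • geodesicForce (g.gamma x) P) :
        EuclideanSpace ℝ (Fin (d + 1)) × EuclideanSpace ℝ (Fin (d + 1)))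
        = l • (P, geodesicForce (g.gamma x) P) from rfl, map_smul, smul_eq_mul]
    ring

lemma RegularNear.currentDensity_eventuallyEq (hm : 0 < m) (hf : RegularNear f x N R)
    (μ : Fin (d + 1)) :
    (fun y ↦ currentDensity hm f y (coordForm x y μ)) ∘ (extChartAt (𝓡 (d + 1)) x).symm
      =ᶠ[𝓝 (extChartAt (𝓡 (d + 1)) x x)] fun u ↦ (cutConstant d m)⁻¹ *
        (√(-(g.coeff x ((extChartAt (𝓡 (d + 1)) x).symm u)).det) *
          ∫ p, cutRep f x cutoff (u, p) * p μ) := by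
  filter_upwards [hf.isOpen.mem_nhds hf.mem] with u hu
  rw [hf.sqrt_mul_integral_cutRep hm hu μ, ← mul_assoc, inv_mul_cancel₀ (cutConstant_ne_zero d hm),
    one_mul]
  rfl

lemma RegularNear.differentiableAt_sqrt_mul_integral (hm : 0 < m) (hf : RegularNear f x N R)
    (μ : Fin (d + 1)) : DifferentiableAt ℝ (fun u ↦
        √(-(g.coeff x ((extChartAt (𝓡 (d + 1)) x).symm u)).det) *
          ∫ p, cutRep f x cutoff (u, p) * p μ) (extChartAt (𝓡 (d + 1)) x x) := by
  obtain ⟨w', hw, -⟩ := hasFDerivAt_sqrt_det g τ x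
  obtain ⟨L, hL, -⟩ := hasFDerivAt_integral_mul_coord hf.isOpen
    (hf.contDiffOn_cutRep hm isCutoff_cutoff) (isCompact_closedBall _ _)
    (hf.cutRep_eq_zero hm isCutoff_cutoff) hf.mem μ
  exact (hw.fun_mul hL).differentiableAt

lemma RegularNear.mdifferentiableAt_currentDensity (hm : 0 < m) (hf : RegularNear f x N R)
    (μ : Fin (d + 1)) : MDifferentiableAt (𝓡 (d + 1)) 𝓘(ℝ, ℝ)
      (fun y ↦ currentDensity hm f y (coordForm x y μ)) x := by
  have h1 : DifferentiableAt ℝ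
      ((fun y ↦ currentDensity hm f y (coordForm x y μ)) ∘ (extChartAt (𝓡 (d + 1)) x).symm)
      (extChartAt (𝓡 (d + 1)) x x) :=
    ((hf.differentiableAt_sqrt_mul_integral hm μ).const_mul _).congr_of_eventuallyEq
      (hf.currentDensity_eventuallyEq hm μ)
  have h2 : MDifferentiableAt (𝓡 (d + 1)) 𝓘(ℝ, EuclideanSpace ℝ (Fin (d + 1)))
      (extChartAt (𝓡 (d + 1)) x) x :=
    (contMDiffAt_extChartAt (n := 1)).mdifferentiableAt one_ne_zero
  refine (h1.mdifferentiableAt.comp x h2).congr_of_eventuallyEq ?_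
  filter_upwards [extChartAt_source_mem_nhds (I := 𝓡 (d + 1)) x] with y hy
  exact (congrArg (fun y ↦ currentDensity hm f y (coordForm x y μ))
    ((extChartAt (𝓡 (d + 1)) x).left_inv hy)).symm

theorem RegularNear.divVector_currentDensity (hm : 0 < m) (hf : RegularNear f x N R)
    (F : TwoForm d M) (q : ℝ) :
    g.divVector (currentDensity hm f) x
      = fibreIntegral hm x (onFibre (lieDeriv F q f) x) := by
  obtain ⟨w', hw, hw'⟩ := hasFDerivAt_sqrt_det g τ x
  have hxx : (extChartAt (𝓡 (d + 1)) x).symm (extChartAt (𝓡 (d + 1)) x x) = x :=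
    extChartAt_to_inv x
  -- The density is `w = √(-det g)`; dividing by `cutConstant` afterwards recovers `J`.
  have h1 := divergence_integral hf.isOpen
    (hf.contDiffOn_cutRep hm isCutoff_cutoff) (isCompact_closedBall _ _)
    (hf.cutRep_eq_zero hm isCutoff_cutoff) hf.mem (γ := g.gamma x) (christoffel_symm g x) hw
    (by simp only [hxx]; exact hw')
  simp only [hxx, hf.sqrt_mul_integral_fderiv_cutRep hm F q] at h1
  have hc := cutConstant_ne_zero d hm
  apply mul_left_cancel₀ hc
  rw [← h1, LorentzMetric.divVector, Finset.mul_sum]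
  refine Finset.sum_congr rfl fun μ _ ↦ ?_
  rw [mul_add, Finset.mul_sum]
  congr 1
  · rw [partialDeriv, (hf.currentDensity_eventuallyEq hm μ).fderiv_eq,
      fderiv_const_mul (hf.differentiableAt_sqrt_mul_integral hm μ), smul_apply, smul_eq_mul,
      ← mul_assoc, mul_inv_cancel₀ hc, one_mul]
  · refine Finset.sum_congr rfl fun l _ ↦ ?_
    have h2 := hf.sqrt_mul_integral_cutRep hm hf.mem l
    rw [hxx] at h2
    rw [h2, LorentzMetric.gamma]
    ring

end Current

section StressEnergy

variable {d : ℕ} {M : Type*} [TopologicalSpace M]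
  [ChartedSpace (EuclideanSpace ℝ (Fin (d + 1))) M] [IsManifold (𝓡 (d + 1)) ∞ M]
  {g : LorentzMetric d M} {τ : TimeOrientation g} {m : ℝ}
  {f : massShell g τ m → ℝ} {N : Set (EuclideanSpace ℝ (Fin (d + 1)))} {R : ℝ} {x : M}

/-! ### Multiplication by a momentum component -/

/-- The product of `f` with the momentum component `p^ν` in the chart around `x₀`. -/
def mulCoord (f : massShell g τ m → ℝ) (x₀ : M) (ν : Fin (d + 1)) (v : massShell g τ m) : ℝ :=
  f v * coordForm x₀ v.1.1 ν v.1.2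

lemma scale_eq (hm : 0 < m) {y : M} {X : TangentSpace (𝓡 (d + 1)) y} {l : ℝ} (hl : 0 < l)
    (hl2 : l ^ 2 = -g.val y X X / m ^ 2) : m / √(-g.val y X X) = l⁻¹ := by
  have h : -g.val y X X = (l * m) ^ 2 := by
    rw [mul_pow, hl2]; field_simp
  rw [h, Real.sqrt_sq (by positivity)]
  field_simp

/-- The ray extension of `f p^ν` contains the momentum rescaled to mass `m`, not `p^ν` itself. -/
lemma localRep_mulCoord (hm : 0 < m) (f : massShell g τ m → ℝ) (x₀ : M) (ν : Fin (d + 1))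
    {z : EuclideanSpace ℝ (Fin (d + 1)) × EuclideanSpace ℝ (Fin (d + 1))}
    (hz : z ∈ localCone τ x₀) :
    localRep (mulCoord f x₀ ν) x₀ z
      = localRep f x₀ z * (m / √(-localNorm g x₀ z) * z.2 ν) := by
  obtain ⟨u, p⟩ := z
  have hu : u ∈ (extChartAt (𝓡 (d + 1)) x₀).target := hz.1
  obtain ⟨X, rfl⟩ := exists_chartDiff_eq hu p
  have h1 := hz.2.1
  have h2 := hz.2.2
  rw [localNorm_chartDiff hu] at h1 ⊢
  rw [localTime_chartDiff hu] at h2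
  obtain ⟨l, hl, hl2, P, hP, hX⟩ := exists_eq_smul_massHyperboloid hm h1 h2
  rw [scale_eq hm hl hl2, localRep_chartDiff _ hu, localRep_chartDiff _ hu, hX,
    rayExtension_smul _ _ _ hl, rayExtension_smul _ _ _ hl,
    rayExtension_of_mem hm _ ⟨⟨_, P⟩, hP⟩, rayExtension_of_mem hm _ ⟨⟨_, P⟩, hP⟩, mulCoord,
    map_smul, PiLp.smul_apply, smul_eq_mul, inv_mul_cancel_left₀ hl.ne', coordForm_apply]

lemma contDiffAt_localNorm {x₀ : M}
    {z : EuclideanSpace ℝ (Fin (d + 1)) × EuclideanSpace ℝ (Fin (d + 1))}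
    (hz : z ∈ localCone τ x₀) : ContDiffAt ℝ ∞ (localNorm g x₀) z :=
  (contDiffOn_localNorm g x₀).contDiffAt
    (((isOpen_extChartAt_target x₀).prod isOpen_univ).mem_nhds ⟨hz.1, mem_univ z.2⟩)

lemma contDiffAt_scale {x₀ : M}
    {z : EuclideanSpace ℝ (Fin (d + 1)) × EuclideanSpace ℝ (Fin (d + 1))}
    (hz : z ∈ localCone τ x₀) : ContDiffAt ℝ ∞ (fun z ↦ m / √(-localNorm g x₀ z)) z := by
  have h : 0 < -localNorm g x₀ z := by linarith [hz.2.1]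
  exact contDiffAt_const.div ((contDiffAt_localNorm hz).neg.sqrt h.ne') (Real.sqrt_pos.2 h).ne'

/-- The coordinate momentum is meaningful only over one chart, so `f p^ν` need not be smooth on the
whole mass shell; regularity near the fibre is what survives the multiplication. -/
lemma RegularNear.mulCoord (hm : 0 < m) (hf : RegularNear f x N R) (ν : Fin (d + 1)) :
    RegularNear (mulCoord f x ν) x N R where
  isOpen := hf.isOpen
  mem := hf.mem
  subset := hf.subset
  radius_nonneg := hf.radius_nonneg
  eq_zero u hu v hv hR := by rw [KineticTheory.mulCoord, hf.eq_zero u hu v hv hR, zero_mul]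
  contDiffAt z hz hzN := by
    have h : ContDiffAt ℝ 1 (fun z ↦ localRep f x z * (m / √(-localNorm g x z) * z.2 ν)) z :=
      (hf.contDiffAt z hz hzN).mul (((contDiffAt_scale hz).of_le (by simp)).mul
        (ContDiff.contDiffAt (by fun_prop)))
    refine h.congr_of_eventuallyEq ?_
    filter_upwards [(isOpen_localCone τ x).mem_nhds hz] with w hw
    exact localRep_mulCoord hm f x ν hw

/-- The normalizing factor `m / √(-g(p,p))` equals `1` on the shell and has zero derivative in
tangent directions, so the plain Leibniz rule holds. -/
lemma RegularNear.fderiv_localRep_mulCoord (hm : 0 < m) (hf : RegularNear f x N R)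
    (ν : Fin (d + 1)) (p : massHyperboloid g τ m x)
    {X : EuclideanSpace ℝ (Fin (d + 1)) × EuclideanSpace ℝ (Fin (d + 1))}
    (hX : fderiv ℝ (localNorm g x) (extChartAt (𝓡 (d + 1)) x x, chartDiff x x p.1) X = 0) :
    fderiv ℝ (localRep (KineticTheory.mulCoord f x ν) x)
        (extChartAt (𝓡 (d + 1)) x x, chartDiff x x p.1) X
      = fderiv ℝ (localRep f x) (extChartAt (𝓡 (d + 1)) x x, chartDiff x x p.1) X
          * chartDiff x x p.1 ν + onFibre f x p * X.2 ν := by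
  have hz := mem_localCone_self hm p
  have hnorm : localNorm g x (extChartAt (𝓡 (d + 1)) x x, chartDiff x x p.1) = -m ^ 2 := by
    simp only [localNorm, extChartAt_to_inv]
    rw [← metric_eq_sum g (mem_chart_source _ x), p.2.1]
  have hrep := localRep_self hm f p
  set z := (extChartAt (𝓡 (d + 1)) x x, chartDiff x x p.1) with hzdef
  have h1 := ((hf.contDiffAt z hz hf.mem).differentiableAt one_ne_zero).hasFDerivAt
  have h2 := ((contDiffAt_localNorm hz).differentiableAt (by simp)).hasFDerivAt
  have hpos : -localNorm g x z ≠ 0 := by rw [hnorm, neg_neg]; positivity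
  have hsq : √(-localNorm g x z) = m := by rw [hnorm, neg_neg, Real.sqrt_sq hm.le]
  have h3 := (h2.fun_neg.sqrt hpos)
  have h4 := HasDerivAt.comp_hasFDerivAt (f := fun z ↦ √(-localNorm g x z)) z
    (hasDerivAt_inv (by rw [hsq]; exact hm.ne')) h3
  have hc : HasFDerivAt (fun z : EuclideanSpace ℝ (Fin (d + 1)) ×
      EuclideanSpace ℝ (Fin (d + 1)) ↦ z.2 ν)
      ((EuclideanSpace.proj (𝕜 := ℝ) ν).comp (ContinuousLinearMap.snd ℝ _ _)) z :=
    ((EuclideanSpace.proj (𝕜 := ℝ) ν : EuclideanSpace ℝ (Fin (d + 1)) →L[ℝ] ℝ).hasFDerivAt).comp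
      z hasFDerivAt_snd
  have h5 : HasFDerivAt (fun z ↦ localRep f x z * (m * (√(-localNorm g x z))⁻¹ * z.2 ν)) _ z :=
    h1.fun_mul ((h4.const_mul m).fun_mul hc)
  have h6 : localRep (KineticTheory.mulCoord f x ν) x
      =ᶠ[𝓝 z] fun z ↦ localRep f x z * (m * (√(-localNorm g x z))⁻¹ * z.2 ν) := by
    filter_upwards [(isOpen_localCone τ x).mem_nhds hz] with w hw
    rw [localRep_mulCoord hm f x ν hw, div_eq_mul_inv]
  rw [h6.fderiv_eq, h5.fderiv]
  simp only [add_apply, smul_apply, neg_apply, smul_eq_mul, hX, neg_zero, mul_zero, add_zero,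
    Function.comp_apply, ContinuousLinearMap.comp_apply, ContinuousLinearMap.coe_snd',
    PiLp.proj_apply, hsq, hrep, mul_inv_cancel₀ hm.ne', one_mul]
  ring

lemma RegularNear.lieDeriv_mulCoord (hm : 0 < m) (hf : RegularNear f x N R) (F : TwoForm d M)
    (q : ℝ) (ν : Fin (d + 1)) (p : massHyperboloid g τ m x) :
    onFibre (lieDeriv F q (KineticTheory.mulCoord f x ν)) x p
      = onFibre (lieDeriv F q f) x p * chartDiff x x p.1 ν
        + onFibre f x p * (geodesicForce (g.gamma x) (chartDiff x x p.1) ν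
          + q * (F.matrix g x).mulVec (chartDiff x x p.1) ν) := by
  rw [(hf.mulCoord hm ν).lieDeriv_eq hm, hf.lieDeriv_eq hm,
    hf.fderiv_localRep_mulCoord hm ν p (fderiv_localNorm_geodesic g τ x _),
    hf.fderiv_localRep_mulCoord hm ν p (fderiv_localNorm_field F g x _)]
  ring

/-! ### The divergence of the stress-energy tensor -/

lemma fibreIntegral_sum (hm : 0 < m) {ι : Type*} (s : Finset ι) (c : ι → ℝ)
    (φ : ι → massHyperboloid g τ m x → ℝ) (hφ : ∀ i ∈ s, FibreIntegrable hm x (φ i)) :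
    fibreIntegral hm x (fun p ↦ ∑ i ∈ s, c i * φ i p) = ∑ i ∈ s, c i * fibreIntegral hm x (φ i) := by
  simp only [fibreIntegral, ← integral_const_mul]
  rw [← integral_finsetSum]
  · simp only [Finset.sum_div, mul_div_assoc]
  · exact fun i hi ↦ (hφ i hi).const_mul (c i)

lemma fibreIntegral_add (hm : 0 < m) {φ ψ : massHyperboloid g τ m x → ℝ}
    (hφ : FibreIntegrable hm x φ) (hψ : FibreIntegrable hm x ψ) :
    fibreIntegral hm x (fun p ↦ φ p + ψ p) = fibreIntegral hm x φ + fibreIntegral hm x ψ := by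
  simp only [fibreIntegral]
  rw [← integral_add hφ hψ]
  simp only [add_div]

/-- With one index fixed in a chart, `T` is the current of `f p^ν`, so that the theorem for `J`
applies to it. -/
lemma stressEnergy_eq_currentDensity (hm : 0 < m) (f : massShell g τ m → ℝ) (x₀ y : M)
    (α : TangentSpace (𝓡 (d + 1)) y →L[ℝ] ℝ) (ν : Fin (d + 1)) :
    stressEnergy hm f y α (coordForm x₀ y ν) = currentDensity hm (mulCoord f x₀ ν) y α := by
  simp only [stressEnergy, currentDensity]
  congr 1 with p
  simp only [onFibre, mulCoord]
  ring

/-- Apply the result for `J` to `f p^ν`, then contract with `β_ν`. The Leibniz rule supplies the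
force terms. -/
lemma RegularNear.divTensor_stressEnergy (hm : 0 < m) (hf : RegularNear f x N R)
    (F : TwoForm d M) (q : ℝ) (β : TangentSpace (𝓡 (d + 1)) x →L[ℝ] ℝ) :
    g.divTensor (stressEnergy hm f) x β
      = fibreIntegral (g := g) (τ := τ) hm x (fun p ↦ onFibre (lieDeriv F q f) x p * β p.1)
        + q * β (F.endo g x (currentVector hm f x)) := by
  have hxs := mem_chart_source (EuclideanSpace ℝ (Fin (d + 1))) x
  have hIf {h : EuclideanSpace ℝ (Fin (d + 1)) → ℝ} (hh : Continuous h) :=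
    hf.fibreIntegrable hm hh
  have hIl {h : EuclideanSpace ℝ (Fin (d + 1)) → ℝ} (hh : Continuous h) :=
    hf.fibreIntegrable_lieDeriv hm F q hh
  have hinner (ν : Fin (d + 1)) :
      ∑ μ, (partialDeriv x μ (fun y ↦ stressEnergy hm f y (coordForm x y μ) (coordForm x y ν)) x
        + ∑ l, g.christoffel x x μ μ l * stressEnergy hm f x (coordForm x x l) (coordForm x x ν)
        + ∑ l, g.christoffel x x ν μ l * stressEnergy hm f x (coordForm x x μ) (coordForm x x l))
      = fibreIntegral (g := g) (τ := τ) hm x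
          (fun p ↦ onFibre (lieDeriv F q f) x p * chartDiff x x p.1 ν)
        + q * ∑ σ, F.matrix g x ν σ * currentDensity hm f x (coordForm x x σ) := by
    rw [Finset.sum_add_distrib]
    have e1 := (hf.mulCoord hm ν).divVector_currentDensity hm F q
    simp only [LorentzMetric.divVector, ← stressEnergy_eq_currentDensity] at e1
    rw [e1]
    have e2 : fibreIntegral hm x (onFibre (lieDeriv F q (KineticTheory.mulCoord f x ν)) x)
        = fibreIntegral (g := g) (τ := τ) hm x
            (fun p ↦ onFibre (lieDeriv F q f) x p * chartDiff x x p.1 ν)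
          + (fibreIntegral (g := g) (τ := τ) hm x
            (fun p ↦ onFibre f x p * geodesicForce (g.gamma x) (chartDiff x x p.1) ν)
          + fibreIntegral (g := g) (τ := τ) hm x
            (fun p ↦ onFibre f x p * (q * (F.matrix g x).mulVec (chartDiff x x p.1) ν))) := by
      rw [← fibreIntegral_add hm (hIf (contDiff_geodesicForce _ ν).continuous)
          (hIf (h := fun p ↦ q * (F.matrix g x).mulVec p ν) (by fun_prop)),
        ← fibreIntegral_add hm (hIl (h := fun p ↦ p ν) (by fun_prop))]
      · congr 1 with p
        rw [hf.lieDeriv_mulCoord hm]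
        ring
      · simp only [← mul_add]
        exact hIf (h := fun p ↦ geodesicForce (g.gamma x) p ν + q * (F.matrix g x).mulVec p ν)
          ((contDiff_geodesicForce _ ν).continuous.add (by fun_prop))
    -- The geodesic force contributes exactly the negative of the Christoffel term belonging to the
    -- index `ν`, and the two cancel.
    have e3 : fibreIntegral (g := g) (τ := τ) hm x
        (fun p ↦ onFibre f x p * geodesicForce (g.gamma x) (chartDiff x x p.1) ν)
        = -∑ μ, ∑ l, g.christoffel x x ν μ l *
          stressEnergy hm f x (coordForm x x μ) (coordForm x x l) := by
      simp only [stressEnergy, coordForm_apply, ← Finset.sum_neg_distrib]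
      rw [← Finset.sum_product']
      simp only [← neg_mul]
      rw [← fibreIntegral_sum hm _ (fun i : Fin (d + 1) × Fin (d + 1) ↦ -g.christoffel x x ν i.1 i.2)
        (fun i p ↦ onFibre f x p * chartDiff x x p.1 i.1 * chartDiff x x p.1 i.2)]
      · congr 1 with p
        rw [Finset.sum_product]
        simp only [geodesicForce, ← Finset.sum_neg_distrib, Finset.mul_sum, LorentzMetric.gamma]
        refine Finset.sum_congr rfl fun μ _ ↦ Finset.sum_congr rfl fun l _ ↦ ?_
        ring
      · intro i _
        simp only [mul_assoc]
        exact hIf (h := fun p ↦ p i.1 * p i.2) (by fun_prop)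
    have e4 : fibreIntegral (g := g) (τ := τ) hm x
        (fun p ↦ onFibre f x p * (q * (F.matrix g x).mulVec (chartDiff x x p.1) ν))
        = q * ∑ σ, F.matrix g x ν σ * currentDensity hm f x (coordForm x x σ) := by
      simp only [currentDensity, coordForm_apply, Finset.mul_sum, ← mul_assoc q]
      rw [← fibreIntegral_sum hm _ (fun σ ↦ q * F.matrix g x ν σ)
        (fun σ p ↦ onFibre f x p * chartDiff x x p.1 σ)]
      · congr 1 with p
        simp only [Matrix.mulVec, dotProduct, Finset.mul_sum]
        refine Finset.sum_congr rfl fun σ _ ↦ ?_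
        ring
      · exact fun σ _ ↦ hIf (h := fun p ↦ p σ) (by fun_prop)
    rw [e2, e3, e4]
    ring
  rw [LorentzMetric.divTensor]
  simp only [hinner, mul_add, Finset.sum_add_distrib]
  congr 1
  · rw [← fibreIntegral_sum hm _ (fun ν ↦ β (coordVec x x ν))
      (fun ν p ↦ onFibre (lieDeriv F q f) x p * chartDiff x x p.1 ν)
      fun ν _ ↦ hIl (h := fun p ↦ p ν) (by fun_prop)]
    congr 1 with p
    conv_rhs => rw [← sum_smul_coordVec hxs p.1]
    simp only [map_sum, map_smul, smul_eq_mul, Finset.mul_sum]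
    refine Finset.sum_congr rfl fun ν _ ↦ ?_
    ring
  · rw [currentVector, F.endo_sum_smul]
    have h (σ : Fin (d + 1)) : β (F.endo g x (coordVec x x σ))
        = ∑ ν, F.matrix g x ν σ * β (coordVec x x ν) := by
      conv_lhs => rw [← sum_smul_coordVec hxs (F.endo g x (coordVec x x σ))]
      simp only [map_sum, map_smul, smul_eq_mul]
      rfl
    simp only [map_sum, map_smul, smul_eq_mul, h, Finset.mul_sum]
    rw [Finset.sum_comm]
    refine Finset.sum_congr rfl fun ν _ ↦ Finset.sum_congr rfl fun σ _ ↦ ?_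
    ring

/-! ### Smooth functions of compact support are regular near every fibre -/

/-- Inside the cone, `localRep` is `f` after the smooth projection `S` to the mass shell along rays,
and near each point of the shell `f` is the restriction of a smooth function on `TM`. -/
lemma SmoothOnShell.contDiffAt_localRep (hm : 0 < m) (hf : SmoothOnShell f) {x₀ : M}
    {z : EuclideanSpace ℝ (Fin (d + 1)) × EuclideanSpace ℝ (Fin (d + 1))}
    (hz : z ∈ localCone τ x₀) : ContDiffAt ℝ ∞ (localRep f x₀) z := by
  let c : EuclideanSpace ℝ (Fin (d + 1)) × EuclideanSpace ℝ (Fin (d + 1)) → ℝ :=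
    fun z ↦ m / √(-localNorm g x₀ z)
  let S : EuclideanSpace ℝ (Fin (d + 1)) × EuclideanSpace ℝ (Fin (d + 1)) →
      EuclideanSpace ℝ (Fin (d + 1)) × EuclideanSpace ℝ (Fin (d + 1)) := fun z ↦ (z.1, c z • z.2)
  have key : ∀ w ∈ localCone τ x₀, ∃ hw : liftPoint x₀ (S w) ∈ massShell g τ m,
      localRep f x₀ w = f ⟨_, hw⟩ := by
    rintro ⟨u, p⟩ hw
    have hu : u ∈ (extChartAt (𝓡 (d + 1)) x₀).target := hw.1
    obtain ⟨X, rfl⟩ := exists_chartDiff_eq hu p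
    have h1 := hw.2.1
    have h2 := hw.2.2
    rw [localNorm_chartDiff hu] at h1
    rw [localTime_chartDiff hu] at h2
    obtain ⟨l, hl, hl2, P, hP, hX⟩ := exists_eq_smul_massHyperboloid hm h1 h2
    have hS : liftPoint x₀ (S (u, chartDiff x₀ _ X)) = ⟨_, P⟩ := by
      simp only [S, c, localNorm_chartDiff hu, scale_eq hm hl hl2]
      rw [← map_smul, hX, smul_smul, inv_mul_cancel₀ hl.ne', one_smul, liftPoint,
        inverse_chartDiff_apply (mem_chart_source_of_mem_target hu)]
    have hmem : liftPoint x₀ (S (u, chartDiff x₀ _ X)) ∈ massShell g τ m := by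
      rw [hS]; exact hP
    refine ⟨hmem, ?_⟩
    have e : rayExtension f ⟨_, X⟩ = f ⟨⟨_, P⟩, hP⟩ := by
      rw [hX, rayExtension_smul f _ _ hl, rayExtension_of_mem hm f ⟨⟨_, P⟩, hP⟩]
    rw [localRep_chartDiff f hu, e]
    exact congrArg f (Subtype.ext hS.symm)
  obtain ⟨hv, -⟩ := key z hz
  obtain ⟨U, h, hU, hvU, hh, hfh⟩ := hf ⟨_, hv⟩
  have hS : ContDiffAt ℝ ∞ S z :=
    contDiffAt_fst.prodMk ((contDiffAt_scale hz).smul contDiffAt_snd)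
  have hlift : ContMDiffAt 𝓘(ℝ, EuclideanSpace ℝ (Fin (d + 1)) × EuclideanSpace ℝ (Fin (d + 1)))
      (𝓡 (d + 1)).tangent ∞ (liftPoint x₀) (S z) :=
    (contMDiffOn_liftPoint x₀).contMDiffAt
      (((isOpen_extChartAt_target x₀).prod isOpen_univ).mem_nhds ⟨hz.1, mem_univ _⟩)
  have hLS : ContMDiffAt 𝓘(ℝ, EuclideanSpace ℝ (Fin (d + 1)) × EuclideanSpace ℝ (Fin (d + 1)))
      (𝓡 (d + 1)).tangent ∞ (fun w ↦ liftPoint x₀ (S w)) z :=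
    ContMDiffAt.comp z hlift hS.contMDiffAt
  have hall : ContMDiffAt 𝓘(ℝ, EuclideanSpace ℝ (Fin (d + 1)) × EuclideanSpace ℝ (Fin (d + 1)))
      𝓘(ℝ, ℝ) ∞ (fun w ↦ h (liftPoint x₀ (S w))) z :=
    ContMDiffAt.comp z (hh.contMDiffAt (hU.mem_nhds hvU)) hLS
  refine hall.contDiffAt.congr_of_eventuallyEq ?_
  filter_upwards [(isOpen_localCone τ x₀).mem_nhds hz,
    hLS.continuousAt.preimage_mem_nhds (hU.mem_nhds hvU)] with w hw hwU
  obtain ⟨hw', e⟩ := key w hw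
  rw [e, hfh ⟨_, hw'⟩ hwU]

/-- Over a compact coordinate ball the support of `f` is a compact subset of `TM`, so the fibre
coordinate is bounded on it. -/
lemma exists_momentum_bound [T2Space M] (hc : HasCompactSupport f) (x₀ : M) :
    ∃ r > 0, Metric.ball (extChartAt (𝓡 (d + 1)) x₀ x₀) r ⊆ (extChartAt (𝓡 (d + 1)) x₀).target ∧
      ∃ R, 0 ≤ R ∧ ∀ u ∈ Metric.ball (extChartAt (𝓡 (d + 1)) x₀ x₀) r, ∀ v : massShell g τ m,
        v.1.1 = (extChartAt (𝓡 (d + 1)) x₀).symm u → R < ‖chartDiff x₀ v.1.1 v.1.2‖ → f v = 0 := by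
  obtain ⟨r, hr, hrt⟩ := Metric.nhds_basis_closedBall.mem_iff.1
    (extChartAt_target_mem_nhds (I := 𝓡 (d + 1)) x₀)
  refine ⟨r, hr, Metric.ball_subset_closedBall.trans hrt, ?_⟩
  set B := (extChartAt (𝓡 (d + 1)) x₀).symm '' Metric.closedBall (extChartAt (𝓡 (d + 1)) x₀ x₀) r
  have hB : IsCompact B := (isCompact_closedBall _ r).image_of_continuousOn
    ((continuousOn_extChartAt_symm x₀).mono hrt)
  set K : Set (TangentBundle (𝓡 (d + 1)) M) := Subtype.val '' tsupport f
  have hK : IsCompact K := hc.isCompact.image continuous_subtype_val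
  -- This is where the Hausdorff property enters: the compact set `B` has to be closed in `M`.
  have hK2 : IsCompact (K ∩ Bundle.TotalSpace.proj ⁻¹' B) :=
    hK.inter_right (hB.isClosed.preimage (FiberBundle.continuous_proj _ _))
  let v₀ : TangentBundle (𝓡 (d + 1)) M := ⟨x₀, 0⟩
  have hsub : ∀ w ∈ K ∩ Bundle.TotalSpace.proj ⁻¹' B,
      w.1 ∈ (chartAt (EuclideanSpace ℝ (Fin (d + 1))) x₀).source := by
    rintro w ⟨-, u, hu, huw⟩
    change (extChartAt (𝓡 (d + 1)) x₀).symm u = w.1 at huw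
    rw [← huw]
    exact mem_chart_source_of_mem_target (hrt hu)
  have hcont : ContinuousOn (fun w ↦ (extChartAt (𝓡 (d + 1)).tangent v₀ w).2)
      (K ∩ Bundle.TotalSpace.proj ⁻¹' B) := by
    refine continuous_snd.comp_continuousOn ((continuousOn_extChartAt v₀).mono fun w hw ↦ ?_)
    rw [extChartAt_source, TangentBundle.mem_chart_source_iff]
    exact hsub w hw
  obtain ⟨R, hR⟩ := hK2.exists_bound_of_continuousOn hcont
  refine ⟨max R 0, le_max_right _ _, fun u hu v hv hlt ↦ ?_⟩
  by_contra hne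
  have hmem : v.1 ∈ K ∩ Bundle.TotalSpace.proj ⁻¹' B :=
    ⟨⟨v, subset_tsupport f hne, rfl⟩, u, Metric.ball_subset_closedBall hu, hv.symm⟩
  have h := hR v.1 hmem
  rw [extChartAt_tangent_apply v₀ v.1 (hsub _ hmem)] at h
  exact absurd (h.trans (le_max_left _ _)) hlt.not_ge

theorem exists_regularNear [T2Space M] (hm : 0 < m) (hf : SmoothOnShell f)
    (hc : HasCompactSupport f) (x₀ : M) : ∃ N R, RegularNear f x₀ N R := by
  obtain ⟨r, hr, hsub, R, hR, h0⟩ := exists_momentum_bound hc x₀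
  exact ⟨_, R, Metric.isOpen_ball, Metric.mem_ball_self hr, hsub,
    fun z hz _ ↦ (hf.contDiffAt_localRep hm hz).of_le (by simp), hR, h0⟩

end StressEnergy

end KineticTheory

end

/-! ### The main theorem -/

theorem mainTheorem1 {d : ℕ} {M : Type*} [TopologicalSpace M] [T2Space M]
    [ChartedSpace (EuclideanSpace ℝ (Fin (d + 1))) M] [IsManifold (𝓡 (d + 1)) ∞ M]
    (g : KineticTheory.LorentzMetric d M) (τ : KineticTheory.TimeOrientation g)
    (F : KineticTheory.TwoForm d M) (q : ℝ) {m : ℝ} (hm : 0 < m)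
    (f : KineticTheory.massShell g τ m → ℝ)
    (hf : KineticTheory.SmoothOnShell f) (hc : HasCompactSupport f) :
    -- all integrals exist
    (∀ (x : M) (α β : TangentSpace (𝓡 (d + 1)) x →L[ℝ] ℝ),
      KineticTheory.FibreIntegrable (g := g) (τ := τ) hm x
        (fun p ↦ KineticTheory.onFibre f x p * α p.1) ∧
      KineticTheory.FibreIntegrable (g := g) (τ := τ) hm x
        (fun p ↦ KineticTheory.onFibre f x p * α p.1 * β p.1) ∧
      KineticTheory.FibreIntegrable (g := g) (τ := τ) hm x
        (KineticTheory.onFibre (KineticTheory.lieDeriv F q f) x) ∧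
      KineticTheory.FibreIntegrable (g := g) (τ := τ) hm x
        (fun p ↦ KineticTheory.onFibre (KineticTheory.lieDeriv F q f) x p * β p.1)) ∧
    -- the components of `J` and `T` are differentiable
    (∀ (x : M) (μ ν : Fin (d + 1)),
      MDifferentiableAt (𝓡 (d + 1)) 𝓘(ℝ, ℝ)
        (fun y ↦ KineticTheory.currentDensity hm f y (KineticTheory.coordForm x y μ)) x ∧
      MDifferentiableAt (𝓡 (d + 1)) 𝓘(ℝ, ℝ)
        (fun y ↦ KineticTheory.stressEnergy hm f y (KineticTheory.coordForm x y μ)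
          (KineticTheory.coordForm x y ν)) x) ∧
    -- the two identities
    (∀ x : M, g.divVector (KineticTheory.currentDensity hm f) x =
      KineticTheory.fibreIntegral hm x
        (KineticTheory.onFibre (KineticTheory.lieDeriv F q f) x)) ∧
    (∀ (x : M) (β : TangentSpace (𝓡 (d + 1)) x →L[ℝ] ℝ),
      g.divTensor (KineticTheory.stressEnergy hm f) x β =
        KineticTheory.fibreIntegral (g := g) (τ := τ) hm x
          (fun p ↦ KineticTheory.onFibre (KineticTheory.lieDeriv F q f) x p * β p.1)
        + q * β (F.endo g x (KineticTheory.currentVector hm f x))) ∧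
    -- the conservation laws under the Liouville equation
    ((∀ v : KineticTheory.massShell g τ m, KineticTheory.lieDeriv F q f v = 0) →
      (∀ x : M, g.divVector (KineticTheory.currentDensity hm f) x = 0) ∧
      ∀ (x : M) (β : TangentSpace (𝓡 (d + 1)) x →L[ℝ] ℝ),
        g.divTensor (KineticTheory.stressEnergy hm f) x β =
          q * β (F.endo g x (KineticTheory.currentVector hm f x))) := by
  have hreg (x : M) := KineticTheory.exists_regularNear hm hf hc x
  have hinv (x : M) (X : TangentSpace (𝓡 (d + 1)) x) :=
    KineticTheory.inverse_chartDiff_apply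
      (mem_chart_source (EuclideanSpace ℝ (Fin (d + 1))) x) X
  -- The integrability lemmas accept continuous functions of the chart components; pulling a
  -- covector back by the inverse of `chartDiff` brings it into this form.
  have hcont (x : M) (α : TangentSpace (𝓡 (d + 1)) x →L[ℝ] ℝ) :
      Continuous fun p ↦ α ((KineticTheory.chartDiff x x).inverse p) :=
    (α.comp (KineticTheory.chartDiff x x).inverse).continuous
  have hvec (x : M) : g.divVector (KineticTheory.currentDensity hm f) x =
      KineticTheory.fibreIntegral hm x
        (KineticTheory.onFibre (KineticTheory.lieDeriv F q f) x) := by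
    obtain ⟨N, R, h⟩ := hreg x
    exact h.divVector_currentDensity hm F q
  have hten (x : M) (β : TangentSpace (𝓡 (d + 1)) x →L[ℝ] ℝ) :
      g.divTensor (KineticTheory.stressEnergy hm f) x β =
        KineticTheory.fibreIntegral (g := g) (τ := τ) hm x
          (fun p ↦ KineticTheory.onFibre (KineticTheory.lieDeriv F q f) x p * β p.1)
        + q * β (F.endo g x (KineticTheory.currentVector hm f x)) := by
    obtain ⟨N, R, h⟩ := hreg x
    exact h.divTensor_stressEnergy hm F q β
  refine ⟨fun x α β ↦ ?_, fun x μ ν ↦ ?_, hvec, hten, fun hL ↦ ⟨fun x ↦ ?_, fun x β ↦ ?_⟩⟩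
  · obtain ⟨N, R, h⟩ := hreg x
    refine ⟨?_, ?_, ?_, ?_⟩
    · simpa only [hinv] using h.fibreIntegrable hm (hcont x α)
    · simpa only [hinv, mul_assoc, Pi.mul_apply] using h.fibreIntegrable hm ((hcont x α).mul (hcont x β))
    · simpa only [mul_one] using h.fibreIntegrable_lieDeriv hm F q (continuous_const (y := 1))
    · simpa only [hinv] using h.fibreIntegrable_lieDeriv hm F q (hcont x β)
  · obtain ⟨N, R, h⟩ := hreg x
    refine ⟨h.mdifferentiableAt_currentDensity hm μ, ?_⟩
    simp only [KineticTheory.stressEnergy_eq_currentDensity]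
    exact (h.mulCoord hm ν).mdifferentiableAt_currentDensity hm μ
  · rw [hvec]
    simp [KineticTheory.fibreIntegral, KineticTheory.onFibre, hL]
  · rw [hten]
    simp [KineticTheory.fibreIntegral, KineticTheory.onFibre, hL]
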